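/- Let $\mathbb K$ be an imaginary quadratic field, embedded in $\mathbb C$, with ring of integers $R$; let $\Lambda\subset\mathbb K$ be a nonzero fractional ideal, $E=\mathbb C/\Lambda$, on which $R$ acts by multiplication, and let $p:L\to E$ be a holomorphic line bundle. Put $R^\times_0=R\setminus\{0\}$. For a holomorphic line bundle $M$ on $E$ let $K(M)=\{x\in E: t_x^*M\simeq M\}$, where $t_x$ is translation by $x$, and let $\mathcal G(M)$ be the group (under composition) of biholomorphic maps $\phi:M\to M$ which lie over some translation $t_x$ and are linear on the fibres; $\mathcal G(M)_x$ denotes the set of those over $t_x$, and $g_M:\mathcal G(M)\to E$ sends $\mathcal G(M)_x$ to $x$. Let $V(E)$ be the group of families $x=(x_a)_{a\in R^\times_0}$ of points of $E$ with $\frac ab x_a=x_b$ whenever $b\mid a$ and with $x_1$ a torsion point, $\nu_a:V(E)\to E$ the map $x\mapsto x_a$, and $T(E)=\varprojlim_a E[a]=\ker\nu_1\subset V(E)$. For $x\in V(E)$ let $J_x=\{a\in R^\times_0: x_a\in K(a^*L)\}$. For $a,b\in R^\times_0$ let $\tilde b:(ab)^*L\to a^*L$ be the canonical map over multiplication by $b$.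 Let $\hat{\mathcal G}(L)$ be the set of all $(x,(\phi_a)_{a\in J_x})$ with $x\in V(E)$, $\phi_a\in\mathcal G(a^*L)_{x_a}$, and $\tilde b\circ\phi_{ab}=\phi_a\circ\tilde b$ for all $a\in J_x$ and $b\in R^\times_0$. Then there is exactly one group structure on $\hat{\mathcal G}(L)$ for which the product of $(x,(\phi_a))$ and $(y,(\psi_a))$ has first component $x+y$ and has $a$-component $\phi_a\circ\psi_a$ for every $a\in J_x\cap J_y$ (in particular $J_x\cap J_y\subset J_{x+y}$). With this structure (the adelic Heisenberg group) the following hold. 1. The map $g:(x,(\phi_a))\mapsto x$ is a homomorphism, and there is an exact sequence of groups $$1\to\mathbb C^*\to\hat{\mathcal G}(L)\stackrel{g}{\to}V(E)\to 0,$$ where $c\in\mathbb C^*$ is sent to $(0,(\phi_a))$ with every $\phi_a$ equal to multiplication by $c$ on the fibres. 2. For every $a\in R^\times_0$ the set $\mathcal V_a=\nu_a^{-1}(K(a^*L))$ is a subgroup of $V(E)$, and $(x,(\phi_b))\mapsto(x,\phi_a)$ is an isomorphism of groups from $\hat{\mathcal G}(L)|_{\mathcal V_a}=g^{-1}(\mathcal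 V_a)$ onto the pull-back $$\nu_a^*\mathcal G(a^*L)=\{(x,\phi)\in\mathcal V_a\times\mathcal G(a^*L):\nu_a(x)=g_{a^*L}(\phi)\}.$$ 3. There is an isomorphism of groups $\hat{\mathcal G}(L)|_{T(E)}=g^{-1}(T(E))\simeq T(E)\times\mathbb C^*$, sending $(x,(\phi_a))$ to $(x,c)$, where $\phi_1$ is multiplication by $c$. There is a homomorphism $\sigma^L:T(E)\to\hat{\mathcal G}(L)$ with $g\circ\sigma^L=\mathrm{id}_{T(E)}$, and $\sigma^L(x)$ is the unique element of $\hat{\mathcal G}(L)$ over $x$ whose component $\phi_1$ is the identity. -/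

import Mathlib

open Bundle Topology
open scoped Manifold ContDiff NumberField nonZeroDivisors

noncomputable section

set_option linter.unusedSectionVars false

/-! ### The complex structure of `ℂ ⧸ S` for a discrete subgroup `S` -/

namespace ComplexTorus

variable {R : Type*} [CommRing R] [Algebra R ℂ] (S : Submodule R ℂ) [DiscreteTopology S]

theorem isLocalHomeomorph_mkQ : IsLocalHomeomorph (S.mkQ : ℂ → ℂ ⧸ S) :=
  (AddSubgroup.isAddQuotientCoveringMap_of_comm S.toAddSubgroup
    ⟨inferInstanceAs (DiscreteTopology S)⟩).isCoveringMap.isLocalHomeomorph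

/-- The charts of `ℂ ⧸ S` are local inverses of the projection `ℂ → ℂ ⧸ S`. -/
instance : ChartedSpace ℂ (ℂ ⧸ S) :=
  (isLocalHomeomorph_mkQ S).chartedSpace S.mkQ_surjective

theorem mkQ_chart {e : OpenPartialHomeomorph (ℂ ⧸ S) ℂ} (he : e ∈ atlas ℂ (ℂ ⧸ S))
    {y : ℂ ⧸ S} (hy : y ∈ e.source) : S.mkQ (e y) = y := by
  obtain ⟨q, rfl⟩ := he
  simp only [chartAt_self_eq, mfld_simps] at hy ⊢
  exact (isLocalHomeomorph_mkQ S).apply_localInverseAt_of_mem hy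

theorem chart_symm {e : OpenPartialHomeomorph (ℂ ⧸ S) ℂ} (he : e ∈ atlas ℂ (ℂ ⧸ S))
    {z : ℂ} (hz : z ∈ e.target) : e.symm z = S.mkQ z := by
  have h := mkQ_chart S he (e.map_target hz)
  rw [e.right_inv hz] at h
  exact h.symm

/-- Two functions with the same class modulo a discrete subgroup differ by a constant. -/
theorem eventually_eq_add {f h : ℂ → ℂ} {z₀ : ℂ} (hf : ContinuousAt f z₀)
    (hh : ContinuousAt h z₀) (hfh : ∀ᶠ z in 𝓝 z₀, S.mkQ (f z) = S.mkQ (h z)) :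
    ∀ᶠ z in 𝓝 z₀, f z = h z + (f z₀ - h z₀) := by
  have hmem : ∀ᶠ z in 𝓝 z₀, f z - h z ∈ S := hfh.mono fun z hz => by
    have := (Submodule.Quotient.eq S).1 hz
    exact this
  have hd : IsDiscrete (S : Set ℂ) := ⟨inferInstanceAs (DiscreteTopology S)⟩
  obtain ⟨U, hU, hUS⟩ := (isDiscrete_iff_forall_mem_exists_isOpen.1 hd) (f z₀ - h z₀)
    hmem.self_of_nhds
  have hc : ContinuousAt (fun z => f z - h z) z₀ := hf.sub hh
  have hmU : f z₀ - h z₀ ∈ U := by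
    have : f z₀ - h z₀ ∈ U ∩ (S : Set ℂ) := by rw [hUS]; rfl
    exact this.1
  filter_upwards [hmem, hc.preimage_mem_nhds (hU.mem_nhds hmU)] with z h1 h2
  have : f z - h z ∈ U ∩ (S : Set ℂ) := ⟨h2, h1⟩
  rw [hUS] at this
  rw [← (show f z - h z = _ from this)]
  ring

instance : IsManifold 𝓘(ℂ) ω (ℂ ⧸ S) := by
  apply isManifold_of_contDiffOn
  intro e e' he he' z hz
  simp only [mfld_simps] at hz
  have hc : ContinuousAt (fun w => e' (e.symm w)) z :=
    (e'.continuousAt hz.2).comp (e.continuousAt_symm hz.1)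
  have hev : ∀ᶠ w in 𝓝 z, S.mkQ (e' (e.symm w)) = S.mkQ w := by
    filter_upwards [e.open_target.mem_nhds hz.1,
      (e.continuousAt_symm hz.1).preimage_mem_nhds (e'.open_source.mem_nhds hz.2)] with w h1 h2
    rw [mkQ_chart S he' h2, chart_symm S he h1]
  have h := eventually_eq_add S hc continuousAt_id hev
  refine ContDiffAt.contDiffWithinAt (ContDiffAt.congr_of_eventuallyEq
    (contDiffAt_id.add (contDiffAt_const (c := e' (e.symm z) - id z))) ?_)
  exact h

theorem contMDiff_of_lift {F : ℂ ⧸ S → ℂ ⧸ S} {f : ℂ → ℂ} (hf : ContDiff ℂ ω f)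
    (hF : ∀ z, F (S.mkQ z) = S.mkQ (f z)) : ContMDiff 𝓘(ℂ) 𝓘(ℂ) ω F := by
  have hFc : Continuous F := by
    rw [← S.isOpenQuotientMap_mkQ.continuous_comp_iff]
    refine (S.continuous_mkQ.comp hf.continuous).congr fun z => (hF z).symm
  intro y
  rw [contMDiffAt_iff]
  refine ⟨hFc.continuousAt, ContDiffAt.contDiffWithinAt ?_⟩
  have hy := mem_chart_source ℂ y
  have hz := mem_chart_target ℂ y
  have hs := (chartAt ℂ y).left_inv hy
  have hFy := mem_chart_source ℂ (F y)
  have hcF : ContinuousAt (fun w => F ((chartAt ℂ y).symm w)) (chartAt ℂ y y) :=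
    hFc.continuousAt.comp ((chartAt ℂ y).continuousAt_symm hz)
  have hc : ContinuousAt (fun w => chartAt ℂ (F y) (F ((chartAt ℂ y).symm w)))
      (chartAt ℂ y y) := by
    refine ContinuousAt.comp (g := chartAt ℂ (F y)) ?_ hcF
    rw [hs]
    exact (chartAt ℂ (F y)).continuousAt hFy
  have hev : ∀ᶠ w in 𝓝 (chartAt ℂ y y),
      S.mkQ (chartAt ℂ (F y) (F ((chartAt ℂ y).symm w))) = S.mkQ (f w) := by
    filter_upwards [(chartAt ℂ y).open_target.mem_nhds hz,
      hcF.preimage_mem_nhds ((chartAt ℂ (F y)).open_source.mem_nhds (by rw [hs]; exact hFy))]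
      with w h1 h2
    rw [mkQ_chart S (chart_mem_atlas ℂ (F y)) h2]
    change F ((chartAt ℂ y).symm w) = _
    rw [chart_symm S (chart_mem_atlas ℂ y) h1, hF]
  have h := eventually_eq_add S hc hf.continuous.continuousAt hev
  exact ContDiffAt.congr_of_eventuallyEq (hf.contDiffAt.add contDiffAt_const) h

/-- The translation `t_x : y ↦ y + x`. -/
def trans (x : ℂ ⧸ S) : C^ω⟮𝓘(ℂ), ℂ ⧸ S; 𝓘(ℂ), ℂ ⧸ S⟯ where
  val y := y + x
  property := by
    obtain ⟨c, rfl⟩ := S.mkQ_surjective x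
    exact contMDiff_of_lift S (f := fun z => z + c) (by fun_prop) fun z => by simp

/-- Multiplication by `a`. -/
def mulBy (a : R) : C^ω⟮𝓘(ℂ), ℂ ⧸ S; 𝓘(ℂ), ℂ ⧸ S⟯ where
  val y := a • y
  property := contMDiff_of_lift S (f := fun z => a • z)
    (by simp only [Algebra.smul_def]; fun_prop) fun z => by simp

end ComplexTorus

/-! ### Heisenberg group of a holomorphic line bundle on a complex torus -/

section Heisenberg

variable {R : Type*} [CommRing R] [Algebra R ℂ] {S : Submodule R ℂ} [DiscreteTopology S]
  (M : ℂ ⧸ S → Type*) [TopologicalSpace (TotalSpace ℂ M)]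
  [∀ y, TopologicalSpace (M y)] [∀ y, AddCommMonoid (M y)] [∀ y, Module ℂ (M y)]
  [FiberBundle ℂ M] [VectorBundle ℂ ℂ M]

/-- Isomorphism of holomorphic line bundles: a biholomorphic map of total spaces over the identity
of the base which is linear on the fibres. -/
def LineBundleIso (M N : ℂ ⧸ S → Type*) [TopologicalSpace (TotalSpace ℂ M)]
    [∀ y, TopologicalSpace (M y)] [∀ y, AddCommMonoid (M y)] [∀ y, Module ℂ (M y)]
    [FiberBundle ℂ M] [VectorBundle ℂ ℂ M] [TopologicalSpace (TotalSpace ℂ N)]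
    [∀ y, TopologicalSpace (N y)] [∀ y, AddCommMonoid (N y)] [∀ y, Module ℂ (N y)]
    [FiberBundle ℂ N] [VectorBundle ℂ ℂ N] : Prop :=
  ∃ Φ : TotalSpace ℂ M ≃ TotalSpace ℂ N,
    ContMDiff (𝓘(ℂ).prod 𝓘(ℂ)) (𝓘(ℂ).prod 𝓘(ℂ)) ω Φ ∧
    ContMDiff (𝓘(ℂ).prod 𝓘(ℂ)) (𝓘(ℂ).prod 𝓘(ℂ)) ω Φ.symm ∧
    ∀ y, ∃ A : M y →ₗ[ℂ] N y, ∀ v, Φ ⟨y, v⟩ = ⟨y, A v⟩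

/-- `K(M)`: the points `x` with `t_x^* M ≅ M`. -/
def KSet : Set (ℂ ⧸ S) :=
  {x | LineBundleIso ((ComplexTorus.trans S x : ℂ ⧸ S → ℂ ⧸ S) *ᵖ M) M}

/-- `φ` is an automorphism of `M` over `x`: a biholomorphic map of the total space over the
translation `t_x` which is linear on the fibres. -/
def IsAutOver (x : ℂ ⧸ S) (φ : Equiv.Perm (TotalSpace ℂ M)) : Prop :=
  ContMDiff (𝓘(ℂ).prod 𝓘(ℂ)) (𝓘(ℂ).prod 𝓘(ℂ)) ω φ ∧
  ContMDiff (𝓘(ℂ).prod 𝓘(ℂ)) (𝓘(ℂ).prod 𝓘(ℂ)) ω φ.symm ∧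
  ∀ y, ∃ A : M y →ₗ[ℂ] M (y + x), ∀ v, φ ⟨y, v⟩ = ⟨y + x, A v⟩

variable {M}

theorem exists_fibre_cast {z w : ℂ ⧸ S} (h : z = w) :
    ∃ C : M z →ₗ[ℂ] M w, ∀ v, (⟨w, C v⟩ : TotalSpace ℂ M) = ⟨z, v⟩ := by
  subst h
  exact ⟨LinearMap.id, fun v => rfl⟩

theorem isAutOver_one : IsAutOver M 0 1 := by
  refine ⟨contMDiff_id, contMDiff_id, fun y => ?_⟩
  obtain ⟨C, hC⟩ := exists_fibre_cast (M := M) (add_zero y).symm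
  exact ⟨C, fun v => (hC v).symm⟩

theorem IsAutOver.mul {x x' : ℂ ⧸ S} {φ φ' : Equiv.Perm (TotalSpace ℂ M)}
    (h : IsAutOver M x φ) (h' : IsAutOver M x' φ') : IsAutOver M (x + x') (φ * φ') := by
  refine ⟨h.1.comp h'.1, h'.2.1.comp h.2.1, fun y => ?_⟩
  obtain ⟨A', hA'⟩ := h'.2.2 y
  obtain ⟨A, hA⟩ := h.2.2 (y + x')
  obtain ⟨C, hC⟩ := exists_fibre_cast (M := M) (show y + x' + x = y + (x + x') by abel)
  refine ⟨C ∘ₗ A ∘ₗ A', fun v => ?_⟩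
  simp only [Equiv.Perm.mul_apply, hA', hA, LinearMap.comp_apply, hC]

theorem IsAutOver.proj_eq {x : ℂ ⧸ S} {φ : Equiv.Perm (TotalSpace ℂ M)}
    (h : IsAutOver M x φ) (u : TotalSpace ℂ M) : (φ u).proj = u.proj + x := by
  obtain ⟨A, hA⟩ := h.2.2 u.proj
  exact congrArg TotalSpace.proj (hA u.2)

theorem IsAutOver.inv {x : ℂ ⧸ S} {φ : Equiv.Perm (TotalSpace ℂ M)}
    (h : IsAutOver M x φ) : IsAutOver M (-x) φ⁻¹ := by
  refine ⟨h.2.1, h.1, fun y => ?_⟩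
  obtain ⟨z, rfl⟩ : ∃ z, y = z + x := ⟨y - x, by simp⟩
  obtain ⟨A, hA⟩ := h.2.2 z
  have hinj : Function.Injective A := fun v v' hv => by
    have : φ ⟨z, v⟩ = φ ⟨z, v'⟩ := by rw [hA, hA, hv]
    simpa using φ.injective this
  have hsurj : Function.Surjective A := fun w => by
    obtain ⟨⟨u, v⟩, hu⟩ := φ.surjective ⟨z + x, w⟩
    have hp := h.proj_eq ⟨u, v⟩
    rw [hu] at hp
    obtain rfl : z = u := add_right_cancel hp
    rw [hA] at hu
    exact ⟨v, by simpa using hu⟩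
  obtain ⟨C, hC⟩ := exists_fibre_cast (M := M) (show z = z + x + -x by abel)
  refine ⟨C ∘ₗ (LinearEquiv.ofBijective A ⟨hinj, hsurj⟩).symm.toLinearMap, fun v => ?_⟩
  rw [Equiv.Perm.inv_eq_iff_eq]
  simp only [LinearMap.comp_apply, hC, LinearEquiv.coe_coe, hA]
  congr 1
  exact ((LinearEquiv.ofBijective A ⟨hinj, hsurj⟩).apply_symm_apply v).symm

variable (M)

/-- The Heisenberg group `𝒢(M)`, under composition. -/
def Heisenberg : Subgroup (Equiv.Perm (TotalSpace ℂ M)) where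
  carrier := {φ | ∃ x, IsAutOver M x φ}
  one_mem' := ⟨0, isAutOver_one⟩
  mul_mem' := by rintro _ _ ⟨x, hx⟩ ⟨x', hx'⟩; exact ⟨x + x', hx.mul hx'⟩
  inv_mem' := by rintro _ ⟨x, hx⟩; exact ⟨-x, hx.inv⟩

/-- The projection `g_M` of `𝒢(M)`: it sends an automorphism over `x` to `x`. -/
def Heisenberg.base : Heisenberg M →* Multiplicative (ℂ ⧸ S) where
  toFun φ := Multiplicative.ofAdd φ.2.choose
  map_one' := by
    have h := IsAutOver.proj_eq (1 : Heisenberg M).2.choose_spec ⟨0, 0⟩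
    simpa using h.symm
  map_mul' φ ψ := by
    have h := (φ * ψ).2.choose_spec.proj_eq ⟨0, 0⟩
    have h' := (φ.2.choose_spec.mul ψ.2.choose_spec).proj_eq ⟨0, 0⟩
    exact congrArg Multiplicative.ofAdd (add_left_cancel (h.symm.trans h'))

theorem Heisenberg.base_eq_iff (φ : Heisenberg M) (x : ℂ ⧸ S) :
    Heisenberg.base M φ = Multiplicative.ofAdd x ↔ IsAutOver M x φ.1 := by
  constructor
  · intro h
    have h' := φ.2.choose_spec
    rwa [show φ.2.choose = x from h] at h'
  · intro h
    refine congrArg Multiplicative.ofAdd (add_left_cancel (a := (0 : ℂ ⧸ S)) ?_)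
    exact ((φ.2.choose_spec.proj_eq ⟨0, 0⟩).symm.trans (h.proj_eq ⟨0, 0⟩))

end Heisenberg

/-! ### Elliptic curves with complex multiplication and their adelic versions -/

section CM

variable {K : Type*} [Field K] [NumberField K] [Algebra.IsQuadraticExtension ℚ K]
  [NumberField.IsTotallyComplex K] [Algebra K ℂ]

/-- The image in `ℂ` of a fractional ideal of `K`, for the given embedding of `K` in `ℂ`. -/
def cmLattice (Λ : FractionalIdeal (𝓞 K)⁰ K) : Submodule (𝓞 K) ℂ :=
  (Λ : Submodule (𝓞 K) K).map ((Algebra.linearMap K ℂ).restrictScalars (𝓞 K))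

instance (Λ : FractionalIdeal (𝓞 K)⁰ K) : DiscreteTopology (cmLattice Λ) := by
  have hsub (v w : NumberField.InfinitePlace K) : v = w := by
    have h1 := NumberField.InfinitePlace.card_add_two_mul_card_eq_rank K
    have h2 := NumberField.InfinitePlace.card_eq_nrRealPlaces_add_nrComplexPlaces K
    rw [NumberField.IsTotallyComplex.nrRealPlaces_eq_zero,
      Algebra.IsQuadraticExtension.finrank_eq_two ℚ K] at h1
    rw [NumberField.IsTotallyComplex.nrRealPlaces_eq_zero] at h2
    exact Fintype.card_le_one_iff.1 (by omega) v w
  obtain ⟨n, hn, hint⟩ := Λ.2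
  have hnorm (x : 𝓞 K) (hx : x ≠ 0) : 1 ≤ ‖algebraMap K ℂ x‖ :=
    NumberField.InfinitePlace.one_le_of_lt_one
      (w := NumberField.InfinitePlace.mk (algebraMap K ℂ)) hx
      fun z hz => absurd (hsub z _) hz
  have hn0 : 0 < ‖algebraMap K ℂ n‖ :=
    zero_lt_one.trans_le (hnorm n (nonZeroDivisors.ne_zero hn))
  refine DiscreteTopology.of_forall_le_dist (r := 1 / ‖algebraMap K ℂ n‖) (by positivity) ?_
  intro s t hst
  obtain ⟨u, hu, hus⟩ := (cmLattice Λ).sub_mem s.2 t.2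
  have hu0 : u ≠ 0 := by
    rintro rfl
    exact hst (Subtype.ext (sub_eq_zero.1 (by rw [← hus]; simp)))
  obtain ⟨m, hm⟩ := hint u hu
  have hm' : algebraMap K ℂ m = algebraMap K ℂ n * algebraMap K ℂ u := by
    rw [← map_mul]
    rw [Algebra.smul_def] at hm
    exact congrArg (algebraMap K ℂ) hm
  have hm0 : m ≠ 0 := by
    rintro rfl
    rw [map_zero, Algebra.smul_def] at hm
    rcases mul_eq_zero.1 hm.symm with h | h
    · exact nonZeroDivisors.ne_zero hn (by simpa using h)
    · exact hu0 h
  have h1 := hnorm m hm0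
  rw [hm', norm_mul] at h1
  have h2 : ‖algebraMap K ℂ u‖ = dist s t := by
    rw [Subtype.dist_eq, dist_eq_norm, ← hus]
    rfl
  rw [div_le_iff₀ hn0, ← h2]
  linarith

/-- `E = ℂ / Λ`, with its action of the ring of integers of `K`. -/
abbrev CMCurve (Λ : FractionalIdeal (𝓞 K)⁰ K) : Type := ℂ ⧸ cmLattice Λ

variable (Λ : FractionalIdeal (𝓞 K)⁰ K)

/-- `V(E)`: families `(x_a)` of points of `E`, indexed by the nonzero integers of `K`, such that
`(a / b) x_a = x_b` whenever `b ∣ a` (write `a = b * c`), and `x_1` is a torsion point. -/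
def AdelicCurve : AddSubgroup ((𝓞 K)⁰ → CMCurve Λ) where
  carrier := {x | (∀ b c : (𝓞 K)⁰, (c : 𝓞 K) • x (b * c) = x b) ∧ IsOfFinAddOrder (x 1)}
  zero_mem' := ⟨fun _ _ => smul_zero _, IsOfFinAddOrder.zero⟩
  add_mem' hx hy := ⟨fun b c => by simp [smul_add, hx.1 b c, hy.1 b c], hx.2.add hy.2⟩
  neg_mem' hx := ⟨fun b c => by simp [hx.1 b c], hx.2.neg⟩

/-- The projection `ν_a : V(E) → E`, `(x_b) ↦ x_a`. -/
def nu (a : (𝓞 K)⁰) : AdelicCurve Λ →+ CMCurve Λ :=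
  (Pi.evalAddMonoidHom (fun _ : (𝓞 K)⁰ => CMCurve Λ) a).comp (AdelicCurve Λ).subtype

/-- `T(E) = lim E[a]`, inside `V(E)`: the families with `x_a ∈ E[a]` for all `a`. -/
def TateModule : AddSubgroup (AdelicCurve Λ) where
  carrier := {x | ∀ a : (𝓞 K)⁰, (a : 𝓞 K) • nu Λ a x = 0}
  zero_mem' a := by simp
  add_mem' hx hy a := by simp [smul_add, hx a, hy a]
  neg_mem' hx a := by simp [hx a]

/-- `T(E)` is the kernel of `ν_1`. -/
theorem tateModule_eq_ker : TateModule Λ = (nu Λ 1).ker := by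
  ext x
  have h (a : (𝓞 K)⁰) : (a : 𝓞 K) • nu Λ a x = nu Λ 1 x := by
    have := x.2.1 1 a
    rwa [one_mul] at this
  refine ⟨fun hx => (h 1).symm.trans (hx 1), fun hx a => (h a).trans hx⟩

variable (L : CMCurve Λ → Type*)

/-- The pull-back `a^* L` of `L` under multiplication by `a`. -/
abbrev mulPullback (a : (𝓞 K)⁰) : CMCurve Λ → Type _ :=
  (ComplexTorus.mulBy (cmLattice Λ) (a : 𝓞 K) : CMCurve Λ → CMCurve Λ) *ᵖ L

variable {L} in
/-- The canonical map `b̃ : (ab)^* L → a^* L` over multiplication by `b`: the fibre of `(ab)^* L`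
at `y` and the fibre of `a^* L` at `b y` are both the fibre of `L` at `(ab) y = a (b y)`. -/
def mulPullbackMap (a b : (𝓞 K)⁰) (u : TotalSpace ℂ (mulPullback Λ L (a * b))) :
    TotalSpace ℂ (mulPullback Λ L a) :=
  ⟨(b : 𝓞 K) • u.proj, cast (congrArg L (mul_smul (a : 𝓞 K) (b : 𝓞 K) u.proj)) u.2⟩

variable [TopologicalSpace (TotalSpace ℂ L)] [∀ y, TopologicalSpace (L y)]
  [∀ y, AddCommMonoid (L y)] [∀ y, Module ℂ (L y)] [FiberBundle ℂ L] [VectorBundle ℂ ℂ L]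

/-- `J_x`: the set of those `a` with `x_a ∈ K(a^* L)`. -/
def JSet (x : AdelicCurve Λ) : Set (𝓞 K)⁰ := {a | nu Λ a x ∈ KSet (mulPullback Λ L a)}

/-- `𝒱_a = ν_a⁻¹(K(a^* L))`. -/
def VSet (a : (𝓞 K)⁰) : Set (AdelicCurve Λ) := nu Λ a ⁻¹' KSet (mulPullback Λ L a)

/-- The set underlying the adelic Heisenberg group: a point `x` of `V(E)` with a coherent system
of automorphisms `φ_a` of `a^* L` over `x_a`, for `a ∈ J_x`. Coherence means that `φ_{ab}` covers
`φ_a`. -/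
@[ext] structure AdelicHeisenberg where
  pt : AdelicCurve Λ
  aut : ∀ a ∈ JSet Λ L pt, Heisenberg (mulPullback Λ L a)
  base_aut : ∀ a ha, Heisenberg.base _ (aut a ha) = Multiplicative.ofAdd (nu Λ a pt)
  covers : ∀ (a b : (𝓞 K)⁰) (ha : a ∈ JSet Λ L pt) (hab : a * b ∈ JSet Λ L pt)
    (u : TotalSpace ℂ (mulPullback Λ L (a * b))),
    mulPullbackMap Λ a b ((aut (a * b) hab).1 u) = (aut a ha).1 (mulPullbackMap Λ a b u)

/-- A group law on the set of pairs `(x, (φ_a))` is the one of the adelic Heisenberg group if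
points of `V(E)` are added and automorphisms are composed, wherever both factors have a component
of the given index. -/
def IsCompositionLaw (G : Group (AdelicHeisenberg Λ L)) : Prop :=
  ∀ α β : AdelicHeisenberg Λ L, (α * β).pt = α.pt + β.pt ∧
    ∀ (a : (𝓞 K)⁰) (hα : a ∈ JSet Λ L α.pt) (hβ : a ∈ JSet Λ L β.pt),
      ∃ h : a ∈ JSet Λ L (α * β).pt, (α * β).aut a h = α.aut a hα * β.aut a hβ

/-- The pull-back `ν_a^* 𝒢(a^* L)` of `g : 𝒢(a^* L) → E` under `ν_a` restricted to a subgroup `W`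
of `V(E)`: the pairs `(x, φ)` with `x ∈ W` and `φ` over `x_a`. -/
def pullbackHeisenberg (a : (𝓞 K)⁰) (W : AddSubgroup (AdelicCurve Λ)) :
    Subgroup (Multiplicative W × Heisenberg (mulPullback Λ L a)) :=
  (((nu Λ a).comp W.subtype).toMultiplicative.comp (MonoidHom.fst _ _)).eqLocus
    ((Heisenberg.base (mulPullback Λ L a)).comp (MonoidHom.snd _ _))

end CM

end

/-!
The group law, the exact sequence and the two descriptions of subgroups all follow from three facts.

* An element of the adelic Heisenberg group is determined by its point `x` and by any one of its
  components, and every automorphism of `a^* L` over `x_a` is a component of some element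
  (`AdelicHeisenberg.eq_of_aut_eq`, `AdelicHeisenberg.exists_aut_eq`). Indeed an automorphism of
  `a^* L` over `b x` lifts to exactly one automorphism of `(ab)^* L` over `x`, and is determined by
  the lift, since `(ab)^* L → a^* L` is bijective on fibres and surjective. Two components `φ_a` and
  `φ_b` are thus compared through `(ab)^* L`.
* Two automorphisms of a line bundle over the same translation differ by a constant, because `E` is
  compact (`IsAutOver.exists_eq_mul_scalarAut`). This is why an arbitrary choice of automorphisms
  can be rescaled to a coherent one.
* No `J_x` is empty (`JSet_nonempty`). Since `J_x` is closed under multiples, `J_x ∩ J_y` is not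
  empty either, and a product is determined by a single component; group axioms are checked there.

For the last fact, let `n x_1 = 0` with `n ≥ 1`. The pull-back of `L` to `ℂ` has a frame `e` with
`e (z + l) = C_l exp(β_l z) e z` for `l` in the lattice (`exists_isFrame`). The slopes `β` are
additive, and `exp(β_l m) = exp(β_m l)` by comparing the two ways to compute `e (z + l + m)`. If `t`
lifts `x_n`, then `n² t` lies in the lattice, and these relations show that the map which sends
`e (n z)` to `exp(-β_{n² t} z) e (n (z + t))` descends to an automorphism of `n^* L` over `x_n`
(`mkQ_mem_KSet_natIndex`).

The frame comes from a splitting of the transition functions `g_ij` of `L`. On the cover `ℂ` their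
logarithmic derivatives form a periodic additive cocycle. A periodic partition of unity splits it
smoothly, and a solution of the Cauchy–Riemann equation with periodic right-hand side corrects the
splitting to a holomorphic one with constant periods (`exists_additive_splitting`). The solution is
a sum of translates of a Cauchy transform, made convergent as for the Weierstrass zeta function; its
periods are affine functions, and subtracting a quadratic polynomial makes them constant. The
additive splitting is a holomorphic connection, and the frame is a flat section, obtained by
continuation over growing discs (`exists_multiplicative_splitting`).
-/

noncomputable section

set_option linter.unusedSectionVars false

/-! ### The Cauchy–Riemann operator and the Cauchy transform -/

section CauchyTransform

open MeasureTheory Complex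

/-- `f` is real differentiable at `z` with `(∂_x + i ∂_y) f = w`; up to a factor `2` this is the
derivative with respect to `z̄`. -/
def HasDbarAt (f : ℂ → ℂ) (w z : ℂ) : Prop :=
  ∃ f' : ℂ →L[ℝ] ℂ, HasFDerivAt f f' z ∧ f' 1 + I * f' I = w

namespace HasDbarAt

variable {f g : ℂ → ℂ} {v w z : ℂ}

theorem add (hf : HasDbarAt f v z) (hg : HasDbarAt g w z) :
    HasDbarAt (fun y => f y + g y) (v + w) z := by
  obtain ⟨f', hf, rfl⟩ := hf
  obtain ⟨g', hg, rfl⟩ := hg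
  refine ⟨f' + g', hf.add hg, ?_⟩
  simp only [add_apply]
  ring

theorem sub (hf : HasDbarAt f v z) (hg : HasDbarAt g w z) :
    HasDbarAt (fun y => f y - g y) (v - w) z := by
  obtain ⟨f', hf, rfl⟩ := hf
  obtain ⟨g', hg, rfl⟩ := hg
  refine ⟨f' - g', hf.sub hg, ?_⟩
  simp only [sub_apply]
  ring

theorem sum {ι : Type*} {s : Finset ι} {F : ι → ℂ → ℂ} {W : ι → ℂ}
    (h : ∀ i ∈ s, HasDbarAt (F i) (W i) z) :
    HasDbarAt (fun y => ∑ i ∈ s, F i y) (∑ i ∈ s, W i) z := by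
  classical
  induction s using Finset.induction_on with
  | empty => exact ⟨0, by simpa using hasFDerivAt_const (0 : ℂ) z, by simp⟩
  | insert i s hi ih =>
    simp only [Finset.sum_insert hi]
    exact (h i (Finset.mem_insert_self i s)).add
      (ih fun j hj => h j (Finset.mem_insert_of_mem hj))

theorem comp_add_const (c : ℂ) (hf : HasDbarAt f w (z + c)) :
    HasDbarAt (fun y => f (y + c)) w z := by
  obtain ⟨f', hf, rfl⟩ := hf
  exact ⟨f', (hasFDerivAt_comp_add_right c).2 hf, rfl⟩

theorem congr (hf : HasDbarAt f w z) (h : ∀ᶠ y in 𝓝 z, g y = f y) : HasDbarAt g w z := by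
  obtain ⟨f', hf, rfl⟩ := hf
  exact ⟨f', hf.congr_of_eventuallyEq h, rfl⟩

theorem unique (hf : HasDbarAt f v z) (hf' : HasDbarAt f w z) : v = w := by
  obtain ⟨f', hf, rfl⟩ := hf
  obtain ⟨f'', hf', rfl⟩ := hf'
  rw [hf.unique hf']

theorem of_differentiableAt (h : DifferentiableAt ℂ f z) : HasDbarAt f 0 z := by
  refine ⟨_, h.hasFDerivAt.restrictScalars ℝ, ?_⟩
  have : fderiv ℂ f z I = I * fderiv ℂ f z 1 := by
    conv_lhs => rw [show (I : ℂ) = I • (1 : ℂ) by simp, map_smul, smul_eq_mul]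
  simp only [ContinuousLinearMap.coe_restrictScalars', this]
  rw [← mul_assoc, I_mul_I]
  ring

theorem differentiableAt (h : HasDbarAt f 0 z) : DifferentiableAt ℂ f z := by
  obtain ⟨f', hf, h0⟩ := h
  rw [differentiableAt_complex_iff_differentiableAt_real]
  refine ⟨hf.differentiableAt, ?_⟩
  rw [hf.fderiv, smul_eq_mul]
  linear_combination (-I) * h0 + f' I * I_mul_I

end HasDbarAt

theorem locallyIntegrable_inv : LocallyIntegrable (fun w : ℂ => w⁻¹) := by
  refine locallyIntegrable_of_norm_le_rpow (C := 1) (α := 1) (by simp) (by simp) ?_ ?_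
  · refine Filter.Eventually.of_forall fun x => ?_
    rw [norm_inv, Real.rpow_neg_one, one_mul]
  · exact (measurable_inv : Measurable fun w : ℂ => w⁻¹).aestronglyMeasurable

variable {G : ℂ → ℂ}

/-- The Cauchy–Pompeiu formula, for functions with compact support. In polar coordinates around `x`
the integrand is the sum of a radial derivative, which integrates to `2π G(x)`, and an angular
derivative, which integrates to `0`. -/
theorem integral_dbar_mul_inv (hG : ContDiff ℝ 1 G) (hs : HasCompactSupport G) (x : ℂ) :
    ∫ t, (fderiv ℝ G t 1 + I * fderiv ℝ G t I) * (x - t)⁻¹ = 2 * Real.pi * G x := by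
  rw [← integral_sub_left_eq_self (fun t => (fderiv ℝ G t 1 + I * fderiv ℝ G t I) * (x - t)⁻¹)
    volume x, ← Complex.integral_comp_polarCoord_symm]
  set e : ℝ → ℂ := fun θ => cos θ + sin θ * I with he
  have he_ne (θ : ℝ) : e θ * (cos θ - sin θ * I) = 1 := by
    simp only [he]
    linear_combination (Complex.cos_sq_add_sin_sq (θ : ℂ)) - sin (θ : ℂ) ^ 2 * I_sq
  set F₁ : ℝ × ℝ → ℂ := fun p => fderiv ℝ G (x - p.1 * e p.2) (e p.2) with hF₁
  set F₂ : ℝ × ℝ → ℂ := fun p => fderiv ℝ G (x - p.1 * e p.2) (I * e p.2) with hF₂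
  have hec : Continuous e := by fun_prop
  have hfd : Continuous (fderiv ℝ G) := hG.continuous_fderiv one_ne_zero
  have hF₁c : Continuous F₁ := by
    refine Continuous.clm_apply (hfd.comp ?_) ?_ <;> fun_prop
  have hF₂c : Continuous F₂ := by
    refine Continuous.clm_apply (hfd.comp ?_) ?_ <;> fun_prop
  have hee (θ : ℝ) : ‖e θ‖ = 1 := by
    have := Complex.norm_exp_ofReal_mul_I θ
    rwa [Complex.exp_mul_I] at this
  obtain ⟨ρ, hρ0, hρ⟩ : ∃ ρ : ℝ, 0 < ρ ∧ ∀ r θ : ℝ, ρ ≤ r → x - r * e θ ∉ tsupport G := by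
    obtain ⟨B, hB⟩ := hs.isCompact.isBounded.exists_norm_le
    refine ⟨max (‖x‖ + B + 1) 1, by positivity, fun r θ hr hmem => ?_⟩
    have h1 := hB _ hmem
    have h2 : ‖(r : ℂ) * e θ‖ ≤ ‖x‖ + ‖x - r * e θ‖ := by
      have := norm_sub_le x (x - r * e θ)
      rwa [sub_sub_cancel] at this
    rw [norm_mul, hee, mul_one, Complex.norm_real] at h2
    have := Real.le_norm_self r
    have := le_max_left (‖x‖ + B + 1) 1
    linarith
  have hfd0 (r θ : ℝ) (hr : ρ ≤ r) : fderiv ℝ G (x - r * e θ) = 0 := by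
    have := hρ r θ hr
    contrapose! this
    exact support_fderiv_subset ℝ this
  have hint (F : ℝ × ℝ → ℂ) (hFc : Continuous F) (hF : ∀ r θ, ρ ≤ r → F (r, θ) = 0) :
      IntegrableOn F (Set.Ioi 0 ×ˢ Set.Ioo (-Real.pi) Real.pi) (volume.prod volume) := by
    have h1 : IntegrableOn F (Set.Icc 0 ρ ×ˢ Set.Icc (-Real.pi) Real.pi) (volume.prod volume) :=
      hFc.continuousOn.integrableOn_compact (isCompact_Icc.prod isCompact_Icc)
    refine IntegrableOn.of_forall_sdiff_eq_zero h1
      (measurableSet_Ioi.prod measurableSet_Ioo) ?_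
    rintro ⟨r, θ⟩ ⟨⟨hr, hθ⟩, hn⟩
    refine hF r θ ?_
    by_contra hlt
    exact hn ⟨⟨le_of_lt hr, (not_le.1 hlt).le⟩, ⟨hθ.1.le, hθ.2.le⟩⟩
  have hi₁ := hint F₁ hF₁c fun r θ hr => by simp only [hF₁, hfd0 r θ hr, _root_.zero_apply]
  have hi₂ := hint F₂ hF₂c fun r θ hr => by simp only [hF₂, hfd0 r θ hr, _root_.zero_apply]
  have hv₁ : ∫ p in Set.Ioi 0 ×ˢ Set.Ioo (-Real.pi) Real.pi, F₁ p = 2 * Real.pi * G x := by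
    rw [Measure.volume_eq_prod, ← setIntegral_prod_swap]
    rw [setIntegral_prod (fun z : ℝ × ℝ => F₁ z.swap) hi₁.swap]
    have hin (θ : ℝ) : ∫ r in Set.Ioi 0, F₁ (r, θ) = G x := by
      have hd (r : ℝ) : HasDerivAt (fun r : ℝ => -G (x - r * e θ)) (F₁ (r, θ)) r := by
        have h1 : HasDerivAt (fun r : ℝ => x - r * e θ) (-e θ) r := by
          have := ((hasDerivAt_id r).ofReal_comp.mul_const (e θ)).const_sub x
          simpa using this
        have h2 : HasDerivAt (fun r : ℝ => -G (x - r * e θ)) _ r :=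
          ((hG.differentiable one_ne_zero (x - r * e θ)).hasFDerivAt.comp_hasDerivAt r h1).neg
        exact h2.congr_deriv (by simp [hF₁])
      have hcont : Continuous fun r : ℝ => F₁ (r, θ) := hF₁c.comp (by fun_prop)
      have := integral_Ioi_of_hasDerivAt_of_tendsto (a := 0) (m := 0)
        (hd 0).continuousAt.continuousWithinAt (fun r _ => hd r) ?_ ?_
      · rw [this]
        simp
      · refine IntegrableOn.of_forall_sdiff_eq_zero
          (hcont.continuousOn.integrableOn_compact (isCompact_Icc (a := 0) (b := ρ)))
          measurableSet_Ioi ?_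
        rintro r ⟨hr, hn⟩
        simp only [hF₁]
        rw [hfd0 r θ (by by_contra hlt; exact hn ⟨le_of_lt hr, (not_le.1 hlt).le⟩)]
        rfl
      · refine tendsto_const_nhds.congr' ?_
        filter_upwards [Filter.eventually_ge_atTop ρ] with r hr
        rw [image_eq_zero_of_notMem_tsupport (hρ r θ hr), neg_zero]
    simp only [Prod.swap_prod_mk, hin]
    rw [setIntegral_const]
    simp [Measure.real, Real.pi_pos.le]
    left
    ring
  have hv₂ : ∫ p in Set.Ioi 0 ×ˢ Set.Ioo (-Real.pi) Real.pi, F₂ p = 0 := by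
    rw [Measure.volume_eq_prod, setIntegral_prod _ hi₂]
    refine setIntegral_eq_zero_of_forall_eq_zero fun r hr => ?_
    have hr : 0 < r := hr
    have hrC : (r : ℂ) ≠ 0 := by exact_mod_cast hr.ne'
    have hd (θ : ℝ) : HasDerivAt (fun θ : ℝ => -(r : ℂ)⁻¹ * G (x - r * e θ)) (F₂ (r, θ)) θ := by
      have h0 : HasDerivAt e (I * e θ) θ := by
        have h1 := (Complex.hasDerivAt_cos (θ : ℂ)).comp_ofReal
        have h2 := ((Complex.hasDerivAt_sin (θ : ℂ)).comp_ofReal).mul_const I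
        refine (h1.add h2).congr_deriv ?_
        simp only [he]
        linear_combination -sin (θ : ℂ) * I_sq
      have h1 : HasDerivAt (fun θ : ℝ => x - r * e θ) (-(r * (I * e θ))) θ :=
        (h0.const_mul (r : ℂ)).const_sub x
      have h2 := ((hG.differentiable one_ne_zero (x - r * e θ)).hasFDerivAt.comp_hasDerivAt θ
        h1).const_mul (-(r : ℂ)⁻¹)
      refine h2.congr_deriv ?_
      rw [map_neg, show (r : ℂ) * (I * e θ) = r • (I * e θ) from real_smul.symm, map_smul,
        real_smul]
      simp only [hF₂]
      field_simp
    rw [← integral_Ioc_eq_integral_Ioo,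
      ← intervalIntegral.integral_of_le (by linarith [Real.pi_pos]),
      intervalIntegral.integral_eq_sub_of_hasDerivAt (fun θ _ => hd θ)
        ((hF₂c.comp (by fun_prop : Continuous fun θ : ℝ => (r, θ))).intervalIntegrable _ _)]
    simp [he]
  rw [polarCoord_target]
  calc _ = ∫ p in Set.Ioi 0 ×ˢ Set.Ioo (-Real.pi) Real.pi, (F₁ p + I * F₂ p) := by
        refine setIntegral_congr_fun (measurableSet_Ioi.prod measurableSet_Ioo) ?_
        rintro ⟨r, θ⟩ ⟨hr, -⟩
        have hr : 0 < r := hr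
        have hrC : (r : ℂ) ≠ 0 := by exact_mod_cast hr.ne'
        have h0 : (Complex.polarCoord.symm (r, θ) : ℂ) = r * e θ := by
          rw [Complex.polarCoord_symm_apply]
          simp [he]
        have hre : e θ = Real.cos θ • (1 : ℂ) + Real.sin θ • I := by simp [he]
        have hIe : I * e θ = (-Real.sin θ) • (1 : ℂ) + Real.cos θ • I := by
          simp only [he, real_smul]
          push_cast
          linear_combination sin (θ : ℂ) * I_sq
        have hinv : (e θ)⁻¹ = cos θ - sin θ * I := by
          refine inv_eq_of_mul_eq_one_right (he_ne θ)
        simp only [h0, hF₁, hF₂, sub_sub_cancel]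
        generalize fderiv ℝ G (x - r * e θ) = A
        rw [hIe, mul_inv, hinv, hre]
        simp only [map_add, map_smul]
        simp only [real_smul]
        push_cast
        field_simp
        linear_combination (-sin (θ : ℂ) * A I) * I_sq
    _ = _ := by
        rw [Measure.volume_eq_prod] at hv₁ hv₂ ⊢
        rw [integral_add hi₁ (hi₂.const_mul I), integral_const_mul, hv₁, hv₂]
        ring

/-- The Cauchy transform of a function. -/
def cauchyTransform (G : ℂ → ℂ) (z : ℂ) : ℂ :=
  (2 * Real.pi : ℂ)⁻¹ * ∫ t, G t * (z - t)⁻¹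

theorem integrable_mul_inv (hG : Continuous G) (hs : HasCompactSupport G) (z : ℂ) :
    Integrable fun t => G t * (z - t)⁻¹ :=
  HasCompactSupport.convolutionExists_left (ContinuousLinearMap.mul ℝ ℂ) hs hG
    locallyIntegrable_inv z

theorem hasDbarAt_cauchyTransform (hG : ContDiff ℝ 1 G) (hs : HasCompactSupport G) (z : ℂ) :
    HasDbarAt (cauchyTransform G) (G z) z := by
  have h := hs.hasFDerivAt_convolution_left (ContinuousLinearMap.mul ℝ ℂ) hG
    locallyIntegrable_inv z
  have hex := (hs.fderiv ℝ).convolutionExists_left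
    (ContinuousLinearMap.precompL ℂ (ContinuousLinearMap.mul ℝ ℂ))
    (hG.continuous_fderiv one_ne_zero) locallyIntegrable_inv z
  have h' : HasFDerivAt (cauchyTransform G) _ z := h.const_mul ((2 * Real.pi : ℂ)⁻¹)
  refine ⟨_, h', ?_⟩
  have happ (v : ℂ) : (convolution (fderiv ℝ G) (fun w => w⁻¹)
      (ContinuousLinearMap.precompL ℂ (ContinuousLinearMap.mul ℝ ℂ)) volume z) v =
      ∫ t, fderiv ℝ G t v * (z - t)⁻¹ := ContinuousLinearMap.integral_apply hex v
  have hi (v : ℂ) : Integrable fun t => fderiv ℝ G t v * (z - t)⁻¹ :=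
    integrable_mul_inv ((hG.continuous_fderiv one_ne_zero).clm_apply continuous_const)
      (hs.fderiv_apply ℝ v) z
  have hp := integral_dbar_mul_inv hG hs z
  simp only [add_mul, mul_assoc] at hp
  rw [integral_add (hi 1) ((hi I).const_mul I), integral_const_mul] at hp
  have hpi : (2 * Real.pi : ℂ) ≠ 0 := by exact_mod_cast Real.two_pi_pos.ne'
  simp only [smul_apply, happ, smul_eq_mul]
  linear_combination (2 * Real.pi : ℂ)⁻¹ * hp + G z * inv_mul_cancel₀ hpi

end CauchyTransform

/-! ### Sums over a lattice -/

section Lattice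

open MeasureTheory Complex

variable (Λ : Submodule ℤ ℂ) [DiscreteTopology Λ] [IsZLattice ℝ Λ]

theorem exists_norm_add_le_of_isZLattice : ∃ B : ℝ, ∀ z : ℂ, ∃ l ∈ Λ, ‖z + l‖ ≤ B := by
  have : Fintype (Module.Free.ChooseBasisIndex ℤ Λ) := inferInstance
  let b := (Module.Free.chooseBasis ℤ Λ).ofZLatticeBasis ℝ Λ
  refine ⟨∑ i, ‖b i‖, fun z => ⟨-(ZSpan.floor b z : ℂ), Λ.neg_mem ?_, ?_⟩⟩
  · exact (Module.Basis.ofZLatticeBasis_span ℝ Λ _).le (ZSpan.floor b z).2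
  · have h := ZSpan.norm_fract_le b z
    rwa [ZSpan.fract_apply, sub_eq_add_neg] at h

theorem finite_norm_le (B : ℝ) : {l : Λ | ‖(l : ℂ)‖ ≤ B}.Finite := by
  have h := Metric.finite_isBounded_inter_isClosed (K := Metric.closedBall (0 : ℂ) B)
    (s := (Λ : Set ℂ)) ⟨inferInstanceAs (DiscreteTopology Λ)⟩ Metric.isBounded_closedBall
    (AddSubgroup.isClosed_of_discrete (H := Λ.toAddSubgroup))
  refine Set.Finite.of_finite_image (f := ((↑) : Λ → ℂ)) (h.subset ?_)
    Subtype.val_injective.injOn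
  rintro _ ⟨l, hl, rfl⟩
  exact ⟨by simpa using hl, l.2⟩

/-- The lattice points of norm at most `B`. -/
def latticeBall (B : ℝ) : Finset Λ := (finite_norm_le Λ B).toFinset

variable {Λ}

theorem mem_latticeBall {B : ℝ} {l : Λ} : l ∈ latticeBall Λ B ↔ ‖(l : ℂ)‖ ≤ B := by
  simp [latticeBall]

/-- The periodization of a function with bounded support is a finite sum on every bounded set. -/
theorem finsum_translate_eq {E : Type*} [AddCommMonoid E] {f : ℂ → E} {ρ R : ℝ}
    (hf : ∀ z, ρ < ‖z‖ → f z = 0) {z : ℂ} (hz : ‖z‖ ≤ R) :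
    ∑ᶠ l : Λ, f (z + l) = ∑ l ∈ latticeBall Λ (R + ρ), f (z + l) := by
  refine finsum_eq_sum_of_support_subset _ fun l hl => ?_
  rw [Finset.mem_coe, mem_latticeBall]
  by_contra hlt
  refine hl (hf _ ?_)
  have := norm_sub_norm_le (l : ℂ) (-z)
  rw [norm_neg, sub_neg_eq_add, add_comm] at this
  linarith

theorem finsum_translate_periodic {E : Type*} [AddCommMonoid E] (f : ℂ → E) (z : ℂ) (m : Λ) :
    ∑ᶠ l : Λ, f (z + m + l) = ∑ᶠ l : Λ, f (z + l) := by
  rw [← finsum_comp_equiv (Equiv.addLeft m) (f := fun l : Λ => f (z + l))]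
  simp [add_assoc]

variable (Λ) in
/-- A smooth function with compact support whose translates by the lattice sum up to `1`. -/
theorem exists_partition_of_lattice :
    ∃ (χ : ℂ → ℝ), ContDiff ℝ ∞ χ ∧ HasCompactSupport χ ∧ ∀ z, ∑ᶠ l : Λ, χ (z + l) = 1 := by
  obtain ⟨B, hB⟩ := exists_norm_add_le_of_isZLattice Λ
  have hB0 : 0 ≤ B := by
    obtain ⟨l, -, hl⟩ := hB 0
    exact (norm_nonneg _).trans hl
  let p : ContDiffBump (0 : ℂ) := ⟨B + 1, B + 2, by linarith, by linarith⟩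
  have hp0 (z : ℂ) (hz : B + 2 < ‖z‖) : p z = 0 := p.zero_of_le_dist (by simpa using hz.le)
  set P : ℂ → ℝ := fun z => ∑ᶠ l : Λ, p (z + l) with hP
  have hPsum {R : ℝ} {z : ℂ} (hz : ‖z‖ ≤ R) :
      P z = ∑ l ∈ latticeBall Λ (R + (B + 2)), p (z + l) := finsum_translate_eq hp0 hz
  have hPpos (z : ℂ) : 0 < P z := by
    rw [hPsum le_rfl]
    obtain ⟨l, hl, hlB⟩ := hB z
    refine Finset.sum_pos' (fun _ _ => p.nonneg) ⟨⟨l, hl⟩, ?_, p.pos_of_mem_ball ?_⟩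
    · rw [mem_latticeBall]
      have := norm_sub_le (z + l) z
      rw [add_sub_cancel_left] at this
      simp only
      linarith
    · rw [mem_ball_zero_iff]
      change ‖z + l‖ < B + 2
      linarith
  have hPsmooth : ContDiff ℝ ∞ P := by
    rw [contDiff_iff_contDiffAt]
    intro z₀
    have : ContDiff ℝ ∞ fun z => ∑ l ∈ latticeBall Λ (‖z₀‖ + 1 + (B + 2)), p (z + l) :=
      ContDiff.sum fun l _ => p.contDiff.comp (contDiff_id.add contDiff_const)
    refine this.contDiffAt.congr_of_eventuallyEq ?_
    filter_upwards [Metric.ball_mem_nhds z₀ one_pos] with z hz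
    refine hPsum ?_
    have := norm_sub_norm_le z z₀
    rw [Metric.mem_ball, dist_eq_norm] at hz
    linarith
  have hPper (z : ℂ) (l : Λ) : P (z + l) = P z := finsum_translate_periodic _ z l
  refine ⟨fun z => p z / P z, p.contDiff.div hPsmooth fun z => (hPpos z).ne', ?_, fun z => ?_⟩
  · simp only [div_eq_mul_inv]
    exact p.hasCompactSupport.mul_right
  · have h0 (w : ℂ) (hw : B + 2 < ‖w‖) : p w / P w = 0 := by rw [hp0 w hw, zero_div]
    rw [finsum_translate_eq (f := fun w => p w / P w) h0 le_rfl]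
    simp only [hPper]
    rw [← Finset.sum_div, ← hPsum le_rfl, div_self (hPpos z).ne']

/-! ### The Cauchy–Riemann equation with periodic right-hand side -/

/-- Far from the support of `G` its Cauchy transform is approximated by the first two terms of its
Laurent expansion at infinity. -/
theorem exists_norm_cauchyTransform_sub_le {G : ℂ → ℂ} (hG : Continuous G)
    (hs : HasCompactSupport G) : ∃ (m₀ m₁ : ℂ) (ρ C : ℝ), 0 < ρ ∧ (∀ z, ρ < ‖z‖ → G z = 0) ∧
      ∀ (R : ℝ) (z l : ℂ), ‖z‖ ≤ R → 2 * (R + ρ) < ‖l‖ →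
        ‖cauchyTransform G (z + l) - (m₀ / l - (z * m₀ - m₁) / l ^ 2)‖ ≤
          C * (R + ρ) ^ 2 * ‖l‖ ^ (-3 : ℤ) := by
  obtain ⟨B, hB⟩ := hs.isCompact.isBounded.exists_norm_le
  set ρ := max B 1 with hρ
  have hρB : B ≤ ρ := le_max_left _ _
  have hρ0 : 0 < ρ := lt_of_lt_of_le one_pos (le_max_right _ _)
  have hi : Integrable G := hG.integrable_of_hasCompactSupport hs
  have hi' : Integrable fun t => t * G t :=
    (continuous_id.mul hG).integrable_of_hasCompactSupport hs.mul_left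
  have hz0 (z : ℂ) (hz : ρ < ‖z‖) : G z = 0 := by
    refine image_eq_zero_of_notMem_tsupport fun hmem => ?_
    linarith [hB z hmem]
  refine ⟨(2 * Real.pi : ℂ)⁻¹ * ∫ t, G t, (2 * Real.pi : ℂ)⁻¹ * ∫ t, t * G t, ρ,
    ‖(2 * Real.pi : ℂ)⁻¹‖ * (2 * ∫ t, ‖G t‖), hρ0, hz0, fun R z l hz hl => ?_⟩
  have hR : 0 ≤ R := (norm_nonneg z).trans hz
  have hlpos : 0 < ‖l‖ := by linarith
  have hl0 : l ≠ 0 := norm_pos_iff.1 hlpos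
  have hI : cauchyTransform G (z + l) - ((2 * Real.pi : ℂ)⁻¹ * (∫ t, G t) / l -
      (z * ((2 * Real.pi : ℂ)⁻¹ * ∫ t, G t) - (2 * Real.pi : ℂ)⁻¹ * ∫ t, t * G t) / l ^ 2) =
      (2 * Real.pi : ℂ)⁻¹ * ∫ t, (G t * (z + l - t)⁻¹ -
        (G t * (l⁻¹ - z / l ^ 2) + t * G t * (l ^ 2)⁻¹)) := by
    have hadd : Integrable fun t => G t * (l⁻¹ - z / l ^ 2) + t * G t * (l ^ 2)⁻¹ :=
      (hi.mul_const _).add (hi'.mul_const _)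
    rw [integral_sub (integrable_mul_inv hG hs _) hadd, integral_add (hi.mul_const _)
      (hi'.mul_const _), integral_mul_const, integral_mul_const, cauchyTransform]
    ring
  rw [hI, norm_mul]
  have hb : ‖∫ t, (G t * (z + l - t)⁻¹ - (G t * (l⁻¹ - z / l ^ 2) + t * G t * (l ^ 2)⁻¹))‖ ≤
      ∫ t, ‖G t‖ * (2 * (R + ρ) ^ 2 * ‖l‖ ^ (-3 : ℤ)) := by
    refine norm_integral_le_of_norm_le (hi.norm.mul_const _)
      (Filter.Eventually.of_forall fun t => ?_)
    by_cases ht : ρ < ‖t‖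
    · simp [hz0 t ht]
    · have ht : ‖t‖ ≤ ρ := not_lt.1 ht
      have h1 : ‖z - t‖ ≤ R + ρ := (norm_sub_le z t).trans (add_le_add hz ht)
      have h2 : ‖l‖ / 2 ≤ ‖z + l - t‖ := by
        have := norm_sub_norm_le l (-(z - t))
        rw [norm_neg, show l - -(z - t) = z + l - t by ring] at this
        linarith
      have h3 : z + l - t ≠ 0 := norm_pos_iff.1 (by linarith)
      have h4 : G t * (z + l - t)⁻¹ - (G t * (l⁻¹ - z / l ^ 2) + t * G t * (l ^ 2)⁻¹) =
          G t * ((z - t) ^ 2 / (l ^ 2 * (z + l - t))) := by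
        field_simp
        ring
      rw [h4, norm_mul, norm_div, norm_pow, norm_mul, norm_pow]
      refine mul_le_mul_of_nonneg_left ?_ (norm_nonneg _)
      rw [div_le_iff₀ (by positivity)]
      have h5 : ‖z - t‖ ^ 2 ≤ (R + ρ) ^ 2 := by gcongr
      have h6 : (2 * (R + ρ) ^ 2 * ‖l‖ ^ (-3 : ℤ)) * (‖l‖ ^ 2 * (‖l‖ / 2)) = (R + ρ) ^ 2 := by
        rw [zpow_neg]
        field_simp
      calc ‖z - t‖ ^ 2 ≤ (R + ρ) ^ 2 := h5
        _ = (2 * (R + ρ) ^ 2 * ‖l‖ ^ (-3 : ℤ)) * (‖l‖ ^ 2 * (‖l‖ / 2)) := h6.symm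
        _ ≤ _ := by gcongr
  calc _ ≤ ‖(2 * Real.pi : ℂ)⁻¹‖ * ∫ t, ‖G t‖ * (2 * (R + ρ) ^ 2 * ‖l‖ ^ (-3 : ℤ)) := by gcongr
    _ = _ := by
      rw [integral_mul_const]
      ring

/-- A holomorphic function with vanishing second differences is affine. -/
theorem eq_affine_of_second_difference {v : ℂ → ℂ} (hv : Differentiable ℂ v)
    (h : ∀ a b, v (a + b) + v 0 = v a + v b) (z : ℂ) : v z = deriv v 0 * z + v 0 := by
  have hd (b : ℂ) : deriv v b = deriv v 0 := by
    have h1 : (fun a => v (a + b)) = fun a => v a + (v b - v 0) := by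
      funext a
      linear_combination h a b
    have h2 := congrArg (fun f => deriv f 0) h1
    simpa [deriv_comp_add_const] using h2
  have h0 : ∀ z, HasDerivAt (fun z => v z - deriv v 0 * z) 0 z := fun z => by
    have : HasDerivAt (fun z => v z - deriv v 0 * z) _ z :=
      (hv z).hasDerivAt.sub ((hasDerivAt_id z).const_mul (deriv v 0))
    exact this.congr_deriv (by rw [hd]; ring)
  have := is_const_of_deriv_eq_zero (fun z => (h0 z).differentiableAt) (fun z => (h0 z).deriv) z 0
  simp only [mul_zero, sub_zero] at this
  linear_combination this

/-- The equation `∂u/∂z̄ = κ` with `Λ`-periodic smooth right-hand side has a solution on `ℂ` that is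
periodic up to affine functions. It is the sum of the translates of a Cauchy transform, made
convergent by subtracting affine functions of `z`. -/
theorem exists_hasDbarAt_of_periodic {κ : ℂ → ℂ} (hκ : ContDiff ℝ 1 κ)
    (hper : ∀ z, ∀ l ∈ Λ, κ (z + l) = κ z) :
    ∃ u : ℂ → ℂ, (∀ z, HasDbarAt u (κ z) z) ∧
      ∀ l ∈ Λ, ∃ α β : ℂ, ∀ z, u (z + l) = u z + (α * z + β) := by
  obtain ⟨χ, hχ, hχs, hχsum⟩ := exists_partition_of_lattice Λ
  set G : ℂ → ℂ := fun z => (χ z : ℂ) * κ z with hGdef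
  have hG : ContDiff ℝ 1 G :=
    ((ofRealCLM.contDiff.comp hχ).of_le (by exact_mod_cast le_top)).mul hκ
  have hGs : HasCompactSupport G :=
    (hχs.comp_left (g := ((↑) : ℝ → ℂ)) (by simp)).mul_right
  obtain ⟨m₀, m₁, ρ, C, hρ0, hGz, hC⟩ := exists_norm_cauchyTransform_sub_le hG.continuous hGs
  set term : Λ → ℂ → ℂ := fun l z =>
    cauchyTransform G (z + l) - (m₀ / l - (z * m₀ - m₁) / (l : ℂ) ^ 2) with hterm
  have hrank : (-3 : ℤ) < -(Module.finrank ℤ Λ : ℤ) := by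
    rw [ZLattice.rank ℝ Λ, Complex.finrank_real_complex]
    norm_num
  have hsum3 : Summable fun l : Λ => ‖(l : ℂ)‖ ^ (-3 : ℤ) := by
    simpa using ZLattice.summable_norm_sub_zpow Λ (-3) hrank 0
  have hbound (R : ℝ) (z : ℂ) (hz : ‖z‖ ≤ R) (l : Λ) (hl : l ∉ latticeBall Λ (2 * (R + ρ))) :
      ‖term l z‖ ≤ C * (R + ρ) ^ 2 * ‖(l : ℂ)‖ ^ (-3 : ℤ) := by
    rw [mem_latticeBall, not_le] at hl
    exact hC R z l hz hl
  have hsummable (z : ℂ) : Summable fun l => term l z := by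
    refine Summable.of_norm_bounded_eventually (g := fun l : Λ => C * (‖z‖ + ρ) ^ 2 *
      ‖(l : ℂ)‖ ^ (-3 : ℤ)) (hsum3.mul_left _) ?_
    rw [Filter.eventually_cofinite]
    refine (latticeBall Λ (2 * (‖z‖ + ρ))).finite_toSet.subset fun l hl => ?_
    by_contra hmem
    exact hl (hbound _ z le_rfl l hmem)
  have hdterm (l : Λ) (z : ℂ) : HasDbarAt (term l) (G (z + l)) z := by
    have h1 := (hasDbarAt_cauchyTransform hG hGs (z + l)).comp_add_const (l : ℂ)
    have h2 : DifferentiableAt ℂ (fun z : ℂ => m₀ / l - (z * m₀ - m₁) / (l : ℂ) ^ 2) z := by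
      fun_prop
    simpa using h1.sub (HasDbarAt.of_differentiableAt h2)
  set u : ℂ → ℂ := fun z => ∑' l, term l z with hu
  have hud (z₀ : ℂ) : HasDbarAt u (κ z₀) z₀ := by
    set R := ‖z₀‖ + 1 with hR
    set F := latticeBall Λ (2 * (R + ρ)) with hF
    have hz₀ : Metric.ball (0 : ℂ) R ∈ 𝓝 z₀ :=
      Metric.isOpen_ball.mem_nhds (by simp [hR])
    have htail : DifferentiableOn ℂ (fun z => ∑' l : {l // l ∉ F}, term l z)
        (Metric.ball 0 R) := by
      refine differentiableOn_tsum_of_summable_norm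
        (u := fun l : {l // l ∉ F} => C * (R + ρ) ^ 2 * ‖((l : Λ) : ℂ)‖ ^ (-3 : ℤ))
        ((hsum3.mul_left _).subtype _) (fun l z hz => ?_) Metric.isOpen_ball fun l z hz => ?_
      · have hzR : ‖z‖ < R := by simpa using hz
        have hl : 2 * (R + ρ) < ‖((l : Λ) : ℂ)‖ :=
          not_le.1 fun h => l.2 (mem_latticeBall.2 h)
        have h0 : G (z + (l : Λ)) = 0 := by
          refine hGz _ ?_
          have := norm_sub_norm_le ((l : Λ) : ℂ) (-z)
          rw [norm_neg, sub_neg_eq_add, add_comm] at this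
          have := norm_nonneg z
          linarith
        have := hdterm l z
        rw [h0] at this
        exact this.differentiableAt.differentiableWithinAt
      · have hzR : ‖z‖ < R := by simpa using hz
        exact hbound R z hzR.le l l.2
    have h1 := (HasDbarAt.sum (s := F) fun l _ => hdterm l z₀).add
      (HasDbarAt.of_differentiableAt (htail.differentiableAt hz₀))
    have h2 : ∑ l ∈ F, G (z₀ + l) = κ z₀ := by
      have h3 : ∑ᶠ l : Λ, G (z₀ + l) = ∑ l ∈ F, G (z₀ + l) := by
        rw [finsum_translate_eq (ρ := R + 2 * ρ) (R := R)
          (fun w hw => hGz w (by have := norm_nonneg z₀; linarith)) (by simp [hR])]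
        rw [hF, show R + (R + 2 * ρ) = 2 * (R + ρ) by ring]
      obtain ⟨B, hB⟩ := hχs.isCompact.isBounded.exists_norm_le
      have hχB (w : ℂ) (hw : B < ‖w‖) : χ w = 0 :=
        image_eq_zero_of_notMem_tsupport fun hmem => absurd (hB w hmem) (not_le.2 hw)
      have hGB (w : ℂ) (hw : B < ‖w‖) : G w = 0 := by simp [hGdef, hχB w hw]
      rw [← h3, finsum_translate_eq hGB le_rfl]
      have h4 := hχsum z₀
      rw [finsum_translate_eq hχB le_rfl] at h4
      simp only [hGdef]
      rw [Finset.sum_congr rfl fun l _ => by rw [hper z₀ l l.2], ← Finset.sum_mul, ← ofReal_sum,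
        h4, ofReal_one, one_mul]
    rw [h2, add_zero] at h1
    refine h1.congr (Filter.Eventually.of_forall fun z => ?_)
    exact ((hsummable z).sum_add_tsum_subtype_compl F).symm
  -- second differences of `u` are sums over the lattice of second differences of the Cauchy
  -- transform, and thus periodic
  have hsecond (a b z : ℂ) (l : Λ) : u (z + l + a + b) - u (z + l + a) - u (z + l + b) + u (z + l) =
      u (z + a + b) - u (z + a) - u (z + b) + u z := by
    set d : ℂ → ℂ := fun z => cauchyTransform G (z + a + b) - cauchyTransform G (z + a) -
      cauchyTransform G (z + b) + cauchyTransform G z with hd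
    have key (z : ℂ) : u (z + a + b) - u (z + a) - u (z + b) + u z = ∑' l : Λ, d (z + l) := by
      rw [hu, ← (hsummable _).tsum_sub (hsummable _), ← ((hsummable _).sub
        (hsummable _)).tsum_sub (hsummable _), ← (((hsummable _).sub
        (hsummable _)).sub (hsummable _)).tsum_add (hsummable _)]
      refine tsum_congr fun l => ?_
      simp only [hterm, hd]
      rw [show z + a + b + l = z + l + a + b by ring, show z + a + l = z + l + a by ring,
        show z + b + l = z + l + b by ring]
      ring
    rw [key, key, ← (Equiv.addLeft l).tsum_eq fun m : Λ => d (z + m)]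
    simp [add_assoc]
  refine ⟨u, hud, fun l hl => ?_⟩
  set v : ℂ → ℂ := fun z => u (z + l) - u z with hv
  have hvd : Differentiable ℂ v := fun z => by
    have h1 := (hud (z + l)).comp_add_const l
    have h2 := h1.sub (hud z)
    rw [hper z l hl, sub_self] at h2
    exact h2.differentiableAt
  have hv2 (a b : ℂ) : v (a + b) + v 0 = v a + v b := by
    have h1 := hsecond a b 0 ⟨l, hl⟩
    simp only [zero_add] at h1
    simp only [hv, zero_add]
    rw [show a + b + l = l + a + b by ring, add_comm a l, add_comm b l]
    linear_combination h1
  refine ⟨deriv v 0, v 0, fun z => ?_⟩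
  rw [← eq_affine_of_second_difference hvd hv2 z, hv]
  ring

end Lattice

/-! ### Additive cocycles on a complex torus -/

section Cousin

open MeasureTheory Complex

variable {Λ : Submodule ℤ ℂ} [DiscreteTopology Λ] [IsZLattice ℝ Λ]

/-- The linear terms of the additive periods of `exists_hasDbarAt_of_periodic` are removed by adding
a quadratic polynomial to the solution. -/
theorem exists_hasDbarAt_of_periodic' {κ : ℂ → ℂ} (hκ : ContDiff ℝ 1 κ)
    (hper : ∀ z, ∀ l ∈ Λ, κ (z + l) = κ z) :
    ∃ u : ℂ → ℂ, (∀ z, HasDbarAt u (κ z) z) ∧ ∀ l ∈ Λ, ∃ β : ℂ, ∀ z, u (z + l) = u z + β := by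
  obtain ⟨u, hu, hul⟩ := exists_hasDbarAt_of_periodic hκ hper
  by_cases h0 : ∃ l₀ ∈ Λ, l₀ ≠ 0
  · obtain ⟨l₀, hl₀, hne⟩ := h0
    obtain ⟨α₀, β₀, h₀⟩ := hul l₀ hl₀
    refine ⟨fun z => u z - α₀ / l₀ * z ^ 2 / 2, fun z => ?_, fun l hl => ?_⟩
    · have : DifferentiableAt ℂ (fun z : ℂ => α₀ / l₀ * z ^ 2 / 2) z := by fun_prop
      simpa using (hu z).sub (HasDbarAt.of_differentiableAt this)
    · obtain ⟨α, β, h⟩ := hul l hl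
      -- `u (z + l + l₀)` computed in two ways
      have hsymm : α * l₀ = α₀ * l := by
        have h1 := h₀ (0 + l)
        have h2 := h (0 + l₀)
        rw [h] at h1
        rw [h₀, show (0 : ℂ) + l₀ + l = 0 + l + l₀ by ring, h1] at h2
        linear_combination -h2
      have hα : α = α₀ / l₀ * l := by
        field_simp
        exact hsymm
      refine ⟨β - α₀ / l₀ * l ^ 2 / 2, fun z => ?_⟩
      beta_reduce
      rw [h, hα]
      ring
  · push Not at h0
    refine ⟨u, hu, fun l hl => ⟨0, fun z => ?_⟩⟩
    rw [h0 l hl, add_zero, add_zero]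

/-- An additive cocycle of `Λ`-periodic holomorphic functions is the coboundary of holomorphic
functions on `ℂ` that are periodic up to constants. -/
theorem exists_additive_splitting {ι : Type*} {U : ι → Set ℂ} (hU : ∀ i, IsOpen (U i))
    (hcov : ∀ z, ∃ i, z ∈ U i) (hUper : ∀ i, ∀ z ∈ U i, ∀ l ∈ Λ, z + l ∈ U i)
    {h : ι → ι → ℂ → ℂ} (hh : ∀ i j, DifferentiableOn ℂ (h i j) (U i ∩ U j))
    (hper : ∀ i j z, z ∈ U i → z ∈ U j → ∀ l ∈ Λ, h i j (z + l) = h i j z)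
    (hcoc : ∀ i j k z, z ∈ U i → z ∈ U j → z ∈ U k → h i k z = h i j z + h j k z) :
    ∃ t : ι → ℂ → ℂ, (∀ i, DifferentiableOn ℂ (t i) (U i)) ∧
      (∀ i j z, z ∈ U i → z ∈ U j → t j z = t i z + h i j z) ∧
      ∀ l ∈ Λ, ∃ β : ℂ, ∀ i, ∀ z ∈ U i, t i (z + l) = t i z + β := by
  obtain ⟨χ, hχ, hχs, hχsum⟩ := exists_partition_of_lattice Λ
  obtain ⟨B, hB⟩ := hχs.isCompact.isBounded.exists_norm_le
  have hχB (w : ℂ) (hw : B < ‖w‖) : χ w = 0 :=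
    image_eq_zero_of_notMem_tsupport fun hmem => absurd (hB w hmem) (not_le.2 hw)
  obtain ⟨f, hf⟩ := SmoothPartitionOfUnity.exists_isSubordinate 𝓘(ℝ, ℂ) (isClosed_tsupport χ) U hU
    fun z _ => Set.mem_iUnion.2 (hcov z)
  have hfU (k) {z : ℂ} (hz : z ∈ tsupport (f k)) : z ∈ U k := hf k hz
  -- a smooth splitting, first of `χ h i j`, then, summed over translates, of `h i j` itself
  set Θ : ι → ℂ → ℂ := fun i z => (χ z : ℂ) * ∑ᶠ k, f k z • h k i z with hΘ
  have hΘB (i) (w : ℂ) (hw : B < ‖w‖) : Θ i w = 0 := by simp [hΘ, hχB w hw]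
  have hΘsmooth (i) {z : ℂ} (hz : z ∈ U i) : ContDiffAt ℝ ∞ (Θ i) z := by
    refine ((ofRealCLM.contDiff.comp hχ).contDiffAt).mul ?_
    rw [← contMDiffAt_iff_contDiffAt]
    refine f.contMDiffAt_finsum fun k hk => ?_
    rw [contMDiffAt_iff_contDiffAt]
    have h1 := ((hh k i).contDiffOn (n := ∞) ((hU k).inter (hU i))).contDiffAt
      (((hU k).inter (hU i)).mem_nhds ⟨hfU k hk, hz⟩)
    exact h1.restrict_scalars ℝ
  have hΘsub (i j) (z : ℂ) (hi : z ∈ U i) (hj : z ∈ U j) :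
      Θ j z = Θ i z + (χ z : ℂ) * h i j z := by
    by_cases hz : z ∈ tsupport χ
    · have hfin : (Function.support fun k => f k z).Finite := f.locallyFinite.point_finite z
      have h1 : ∑ᶠ k, f k z • h k j z = ∑ᶠ k, (f k z • h k i z + f k z • h i j z) := by
        refine finsum_congr fun k => ?_
        by_cases hk : f k z = 0
        · simp [hk]
        · rw [hcoc k i j z (hfU k (subset_tsupport _ hk)) hi hj, smul_add]
      have h2 : ∑ᶠ k, f k z • h i j z = h i j z := by
        rw [← finsum_smul, f.sum_eq_one hz, one_smul]
      simp only [hΘ]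
      rw [h1, finsum_add_distrib (hfin.subset fun k hk => ?_) (hfin.subset fun k hk => ?_), h2,
        mul_add]
      · exact left_ne_zero_of_smul hk
      · exact left_ne_zero_of_smul hk
    · simp [hΘ, image_eq_zero_of_notMem_tsupport hz]
  set θ : ι → ℂ → ℂ := fun i z => ∑ᶠ l : Λ, Θ i (z + l) with hθ
  have hθsum (i) {R : ℝ} {z : ℂ} (hz : ‖z‖ ≤ R) :
      θ i z = ∑ l ∈ latticeBall Λ (R + B), Θ i (z + l) := finsum_translate_eq (hΘB i) hz
  have hθsmooth (i) {z₀ : ℂ} (hz : z₀ ∈ U i) : ContDiffAt ℝ ∞ (θ i) z₀ := by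
    have : ContDiffAt ℝ ∞ (fun z => ∑ l ∈ latticeBall Λ (‖z₀‖ + 1 + B), Θ i (z + l)) z₀ :=
      ContDiffAt.sum fun l _ => (hΘsmooth i (hUper i z₀ hz l l.2)).comp z₀
        (contDiffAt_id.add contDiffAt_const)
    refine this.congr_of_eventuallyEq ?_
    filter_upwards [Metric.ball_mem_nhds z₀ one_pos] with z hz
    refine hθsum i ?_
    have := norm_sub_norm_le z z₀
    rw [Metric.mem_ball, dist_eq_norm] at hz
    linarith
  have hθper (i) (z : ℂ) (l : ℂ) (hl : l ∈ Λ) : θ i (z + l) = θ i z :=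
    finsum_translate_periodic (Θ i) z ⟨l, hl⟩
  have hθsub (i j) (z : ℂ) (hi : z ∈ U i) (hj : z ∈ U j) : θ j z = θ i z + h i j z := by
    have h1 := hχsum z
    rw [finsum_translate_eq hχB le_rfl] at h1
    have h2 (l : Λ) : Θ j (z + l) = Θ i (z + l) + (χ (z + l) : ℂ) * h i j z := by
      rw [hΘsub i j (z + l) (hUper i z hi l l.2) (hUper j z hj l l.2), hper i j z hi hj l l.2]
    rw [hθsum j le_rfl, hθsum i le_rfl, Finset.sum_congr rfl fun l _ => h2 l,
      Finset.sum_add_distrib, ← Finset.sum_mul, ← ofReal_sum, h1, ofReal_one, one_mul]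
  -- the derivatives `∂θ_i/∂z̄` agree on overlaps, so that all `θ i` are made holomorphic by
  -- subtracting one and the same function
  choose c hc using hcov
  set κ : ℂ → ℂ := fun z => fderiv ℝ (θ (c z)) z 1 + I * fderiv ℝ (θ (c z)) z I with hκ
  have hθdiff (i) {z : ℂ} (hz : z ∈ U i) : DifferentiableAt ℝ (θ i) z :=
    (hθsmooth i hz).differentiableAt (by simp)
  have hθκ (i) {z : ℂ} (hz : z ∈ U i) : HasDbarAt (θ i) (κ z) z := by
    have h1 : HasDbarAt (θ (c z)) (κ z) z := ⟨_, (hθdiff _ (hc z)).hasFDerivAt, rfl⟩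
    have hopen := (hU (c z)).inter (hU i)
    have h2 := (hh (c z) i).differentiableAt (hopen.mem_nhds ⟨hc z, hz⟩)
    have h3 := h1.add (HasDbarAt.of_differentiableAt h2)
    rw [add_zero] at h3
    refine h3.congr ?_
    filter_upwards [hopen.mem_nhds ⟨hc z, hz⟩] with w hw
    exact hθsub _ _ _ hw.1 hw.2
  have hκsmooth : ContDiff ℝ 1 κ := by
    rw [contDiff_iff_contDiffAt]
    intro z₀
    set i := c z₀
    have h1 : ContDiffAt ℝ 1 (fderiv ℝ (θ i)) z₀ :=
      (hθsmooth i (hc z₀)).fderiv_right (by norm_cast)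
    have h2 : ContDiffAt ℝ 1 (fun z => fderiv ℝ (θ i) z 1 + I * fderiv ℝ (θ i) z I) z₀ :=
      (h1.clm_apply contDiffAt_const).add
        (contDiffAt_const.mul (h1.clm_apply contDiffAt_const))
    refine h2.congr_of_eventuallyEq ?_
    filter_upwards [(hU i).mem_nhds (hc z₀)] with z hz
    exact (hθκ i hz).unique ⟨_, (hθdiff i hz).hasFDerivAt, rfl⟩
  have hκper (z : ℂ) (l : ℂ) (hl : l ∈ Λ) : κ (z + l) = κ z := by
    have h1 := (hθκ (c z) (hUper _ z (hc z) l hl)).comp_add_const l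
    exact (h1.congr (Filter.Eventually.of_forall fun y => (hθper _ y l hl).symm)).unique
      (hθκ (c z) (hc z))
  obtain ⟨u, hu, hul⟩ := exists_hasDbarAt_of_periodic' hκsmooth hκper
  refine ⟨fun i z => θ i z - u z, fun i z hz => ?_, fun i j z hi hj => ?_, fun l hl => ?_⟩
  · have := (hθκ i hz).sub (hu z)
    rw [sub_self] at this
    exact this.differentiableAt.differentiableWithinAt
  · beta_reduce
    rw [hθsub i j z hi hj]
    ring
  · obtain ⟨β, hβ⟩ := hul l hl
    refine ⟨-β, fun i z _ => ?_⟩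
    beta_reduce
    rw [hθper i z l hl, hβ]
    ring

end Cousin

/-! ### Flat sections and multiplicative cocycles on a complex torus -/

section Flat

open Complex Metric

variable {ι : Type*} {U : ι → Set ℂ} {t : ι → ℂ → ℂ} {g : ι → ι → ℂ → ℂ}

/-- The functions `f i` are, near `z`, the coordinates of a section without zeros of the line bundle
with transition functions `g i j`, and the section is flat for the connection with connection form
`-t i dz` on `U i`. -/
def IsFlatAt (U : ι → Set ℂ) (t : ι → ℂ → ℂ) (g : ι → ι → ℂ → ℂ) (f : ι → ℂ → ℂ) (z : ℂ) : Prop :=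
  ∀ i, z ∈ U i → f i z ≠ 0 ∧ HasDerivAt (f i) (t i z * f i z) z ∧
    ∀ j, z ∈ U j → f j z = g i j z * f i z

theorem IsFlatAt.const_mul {f : ι → ℂ → ℂ} {z c : ℂ} (hf : IsFlatAt U t g f z) (hc : c ≠ 0) :
    IsFlatAt U t g (fun i w => c * f i w) z := fun i hi =>
  ⟨mul_ne_zero hc (hf i hi).1, ((hf i hi).2.1.const_mul c).congr_deriv (by ring),
    fun j hj => by beta_reduce; rw [(hf i hi).2.2 j hj]; ring⟩

theorem IsFlatAt.congr {f f' : ι → ℂ → ℂ} {z : ℂ} (hf : IsFlatAt U t g f z)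
    (hU : ∀ i, IsOpen (U i)) (h : ∀ᶠ w in 𝓝 z, ∀ i, w ∈ U i → f' i w = f i w) :
    IsFlatAt U t g f' z := fun i hi => by
  have h0 := h.self_of_nhds
  rw [h0 i hi]
  refine ⟨(hf i hi).1, (hf i hi).2.1.congr_of_eventuallyEq ?_, fun j hj => ?_⟩
  · filter_upwards [h, (hU i).mem_nhds hi] with w h1 h2
    exact h1 i h2
  · rw [h0 j hj, (hf i hi).2.2 j hj]

/-- Two flat sections over a connected open set differ by a constant. -/
theorem exists_eq_const_mul_of_isFlatAt (hU : ∀ i, IsOpen (U i)) (hcov : ∀ z, ∃ i, z ∈ U i)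
    {V : Set ℂ} (hV : IsOpen V) (hVc : Convex ℝ V) {f f' : ι → ℂ → ℂ}
    (hf : ∀ z ∈ V, IsFlatAt U t g f z) (hf' : ∀ z ∈ V, IsFlatAt U t g f' z) :
    ∃ c : ℂ, c ≠ 0 ∧ ∀ z ∈ V, ∀ i, z ∈ U i → f' i z = c * f i z := by
  rcases V.eq_empty_or_nonempty with rfl | ⟨z₀, hz₀⟩
  · exact ⟨1, one_ne_zero, fun z hz => hz.elim⟩
  choose k hk using hcov
  set ρ : ℂ → ℂ := fun z => f' (k z) z / f (k z) z with hρ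
  have hρi (z) (hz : z ∈ V) (i) (hi : z ∈ U i) : ρ z = f' i z / f i z := by
    obtain ⟨h1, -, h2⟩ := hf z hz i hi
    have h3 := (hf' z hz i hi).2.2 _ (hk z)
    have h4 := h2 _ (hk z)
    have h5 := (hf z hz _ (hk z)).1
    have hg : g i (k z) z ≠ 0 := by
      rw [h4] at h5
      exact left_ne_zero_of_mul h5
    simp only [hρ]
    rw [h3, h4, mul_div_mul_left _ _ hg]
  have hd (z) (hz : z ∈ V) : HasDerivAt ρ 0 z := by
    obtain ⟨h1, h2, -⟩ := hf z hz _ (hk z)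
    obtain ⟨-, h3, -⟩ := hf' z hz _ (hk z)
    have h4 : HasDerivAt (fun w => f' (k z) w / f (k z) w) 0 z :=
      (h3.div h2 h1).congr_deriv (by ring)
    refine h4.congr_of_eventuallyEq ?_
    filter_upwards [hV.mem_nhds hz, (hU _).mem_nhds (hk z)] with w hw hw'
    exact hρi w hw _ hw'
  have hconst (z) (hz : z ∈ V) : ρ z = ρ z₀ :=
    hV.is_const_of_deriv_eq_zero hVc.isPreconnected
      (fun w hw => (hd w hw).differentiableAt.differentiableWithinAt)
      (fun w hw => (hd w hw).deriv) hz hz₀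
  refine ⟨ρ z₀, div_ne_zero (hf' z₀ hz₀ _ (hk z₀)).1 (hf z₀ hz₀ _ (hk z₀)).1, fun z hz i hi => ?_⟩
  rw [← hconst z hz, hρi z hz i hi, div_mul_cancel₀ _ (hf z hz i hi).1]

/-- A flat section over a disc around `0` extends by the radius `r` if there are flat sections over
all discs of radius `r`. -/
theorem exists_extension_of_isFlatAt (hU : ∀ i, IsOpen (U i)) (hcov : ∀ z, ∃ i, z ∈ U i) {r : ℝ}
    (hr : 0 < r) (hloc : ∀ z, ∃ f, ∀ w ∈ ball z r, IsFlatAt U t g f w) {R : ℝ} (hR : 0 < R)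
    {f : ι → ℂ → ℂ} (hf : ∀ w ∈ ball 0 R, IsFlatAt U t g f w) :
    ∃ f', (∀ w ∈ ball 0 (R + r), IsFlatAt U t g f' w) ∧
      ∀ w ∈ ball 0 R, ∀ i, w ∈ U i → f' i w = f i w := by
  have hglue (z : ℂ) : ∃ F, (∀ w ∈ ball z r, IsFlatAt U t g F w) ∧
      ∀ w ∈ ball z r ∩ ball 0 R, ∀ i, w ∈ U i → F i w = f i w := by
    obtain ⟨F, hF⟩ := hloc z
    obtain ⟨c, hc, h⟩ := exists_eq_const_mul_of_isFlatAt hU hcov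
      (isOpen_ball.inter isOpen_ball) ((convex_ball z r).inter (convex_ball 0 R))
      (fun w hw => hF w hw.1) (fun w hw => hf w hw.2)
    exact ⟨fun i w => c * F i w, fun w hw => (hF w hw).const_mul hc,
      fun w hw i hi => (h w hw i hi).symm⟩
  choose F hF hFf using hglue
  refine ⟨fun i z => F z i z, fun z hz => ?_, fun w hw i hi => hFf w w ⟨mem_ball_self hr, hw⟩ i hi⟩
  obtain ⟨q, hqz, hq⟩ : ∃ q, q ∈ ball z r ∧ q ∈ ball (0 : ℂ) R := by
    have hRr : 0 < R + r := by linarith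
    have hz' : ‖z‖ < R + r := by simpa using hz
    refine ⟨((R / (R + r) : ℝ) : ℂ) * z, ?_, ?_⟩
    · have h1 : ((R / (R + r) : ℝ) : ℂ) * z - z = ((-(r / (R + r)) : ℝ) : ℂ) * z := by
        have : R / (R + r) = 1 + -(r / (R + r)) := by field_simp; ring
        rw [this]
        push_cast
        ring
      rw [mem_ball, dist_eq_norm, h1, norm_mul, Complex.norm_real, norm_neg,
        Real.norm_of_nonneg (by positivity), div_mul_eq_mul_div, div_lt_iff₀ hRr]
      exact mul_lt_mul_of_pos_left hz' hr
    · rw [mem_ball_zero_iff, norm_mul, Complex.norm_real, Real.norm_of_nonneg (by positivity),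
        div_mul_eq_mul_div, div_lt_iff₀ hRr]
      exact mul_lt_mul_of_pos_left hz' hR
  refine (hF z z (mem_ball_self hr)).congr hU ?_
  have hq' : ∀ᶠ w in 𝓝 z, q ∈ ball w r := by
    filter_upwards [isOpen_ball.mem_nhds (mem_ball'.2 (mem_ball.1 hqz) : z ∈ ball q r)] with w hw
    exact mem_ball'.2 (mem_ball.1 hw)
  filter_upwards [hq', ball_mem_nhds z hr] with w hqw hwz i hi
  -- the sections over the discs around `w` and `z` agree at `q`
  obtain ⟨c, -, h⟩ := exists_eq_const_mul_of_isFlatAt hU hcov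
    (isOpen_ball.inter isOpen_ball) ((convex_ball z r).inter (convex_ball w r))
    (fun y hy => hF z y hy.1) (fun y hy => hF w y hy.2)
  obtain ⟨j, hj⟩ := hcov q
  have h1 := h q ⟨hqz, hqw⟩ j hj
  rw [hFf w q ⟨hqw, hq⟩ j hj, hFf z q ⟨hqz, hq⟩ j hj] at h1
  have h2 : c = 1 := (mul_eq_right₀ (hf q hq j hj).1).1 h1.symm
  rw [h w ⟨hwz, mem_ball_self hr⟩ i hi, h2, one_mul]

/-- Flat sections over all discs of a fixed radius give a flat section over `ℂ`. -/
theorem exists_global_of_isFlatAt (hU : ∀ i, IsOpen (U i)) (hcov : ∀ z, ∃ i, z ∈ U i) {r : ℝ}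
    (hr : 0 < r) (hloc : ∀ z, ∃ f, ∀ w ∈ ball z r, IsFlatAt U t g f w) :
    ∃ f, ∀ z, IsFlatAt U t g f z := by
  have hpos (n : ℕ) : 0 < (n + 1) * r := by positivity
  have hstep (n : ℕ) (f : {f : ι → ℂ → ℂ // ∀ w ∈ ball 0 ((n + 1) * r), IsFlatAt U t g f w}) :
      ∃ f' : {f : ι → ℂ → ℂ // ∀ w ∈ ball 0 (((n + 1 : ℕ) + 1) * r), IsFlatAt U t g f w},
        ∀ w ∈ ball 0 ((n + 1) * r), ∀ i, w ∈ U i → f'.1 i w = f.1 i w := by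
    obtain ⟨f', h1, h2⟩ := exists_extension_of_isFlatAt hU hcov hr hloc (hpos n) f.2
    refine ⟨⟨f', fun w hw => h1 w ?_⟩, h2⟩
    rwa [show (n + 1) * r + r = ((n + 1 : ℕ) + 1) * r by push_cast; ring]
  choose next hnext using hstep
  obtain ⟨f₀, hf₀⟩ := hloc 0
  let F : (n : ℕ) → {f : ι → ℂ → ℂ // ∀ w ∈ ball 0 ((n + 1) * r), IsFlatAt U t g f w} :=
    fun n => Nat.rec ⟨f₀, by simpa using hf₀⟩ next n
  have hmono (n m : ℕ) (hnm : n ≤ m) : ∀ w ∈ ball (0 : ℂ) ((n + 1) * r), ∀ i, w ∈ U i →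
      (F m).1 i w = (F n).1 i w := by
    induction m, hnm using Nat.le_induction with
    | base => exact fun w _ i _ => rfl
    | succ m hnm ih =>
      intro w hw i hi
      rw [← ih w hw i hi]
      refine hnext m (F m) w (ball_subset_ball ?_ hw) i hi
      have : (n : ℝ) ≤ m := by exact_mod_cast hnm
      gcongr
  have hN (z : ℂ) : ∃ n : ℕ, z ∈ ball (0 : ℂ) ((n + 1) * r) := by
    obtain ⟨n, hn⟩ := exists_nat_gt (‖z‖ / r)
    refine ⟨n, ?_⟩
    rw [div_lt_iff₀ hr] at hn
    rw [mem_ball_zero_iff]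
    linarith
  choose N hN using hN
  refine ⟨fun i z => (F (N z)).1 i z, fun z => ((F (N z)).2 z (hN z)).congr hU ?_⟩
  filter_upwards [isOpen_ball.mem_nhds (hN z)] with w hw i hi
  rcases le_total (N z) (N w) with h | h
  · exact hmono _ _ h w hw i hi
  · exact (hmono _ _ h w (hN w) i hi).symm

/-- A multiplicative cocycle of `Λ`-periodic holomorphic functions, that is, a holomorphic line
bundle on `ℂ / Λ`, has on `ℂ` a holomorphic section without zeros whose factors of automorphy are
exponentials of affine functions. The logarithmic derivatives of the transition functions split
additively, which gives a holomorphic connection on the pull-back of the bundle to `ℂ`; the section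
is a flat one. -/
theorem exists_multiplicative_splitting {Λ : Submodule ℤ ℂ} [DiscreteTopology Λ] [IsZLattice ℝ Λ]
    (hU : ∀ i, IsOpen (U i)) (hcov : ∀ z, ∃ i, z ∈ U i)
    (hUper : ∀ i, ∀ z ∈ U i, ∀ l ∈ Λ, z + l ∈ U i)
    (hg : ∀ i j, DifferentiableOn ℂ (g i j) (U i ∩ U j))
    (hg0 : ∀ i j z, z ∈ U i → z ∈ U j → g i j z ≠ 0)
    (hper : ∀ i j z, z ∈ U i → z ∈ U j → ∀ l ∈ Λ, g i j (z + l) = g i j z)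
    (hcoc : ∀ i j k z, z ∈ U i → z ∈ U j → z ∈ U k → g i k z = g i j z * g j k z) :
    ∃ f : ι → ℂ → ℂ, (∀ i z, z ∈ U i → f i z ≠ 0 ∧ DifferentiableAt ℂ (f i) z) ∧
      (∀ i j z, z ∈ U i → z ∈ U j → f j z = g i j z * f i z) ∧
      ∀ l ∈ Λ, ∃ C β : ℂ, ∀ i, ∀ z ∈ U i, f i (z + l) = C * exp (β * z) * f i z := by
  have hopen (i j) : IsOpen (U i ∩ U j) := (hU i).inter (hU j)
  have hgd (i j z) (hi : z ∈ U i) (hj : z ∈ U j) : HasDerivAt (g i j) (deriv (g i j) z) z :=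
    ((hg i j).differentiableAt ((hopen i j).mem_nhds ⟨hi, hj⟩)).hasDerivAt
  obtain ⟨t, ht, hth, htper⟩ := exists_additive_splitting (Λ := Λ) hU hcov hUper
    (h := fun i j z => deriv (g i j) z / g i j z)
    (fun i j => ((hg i j).deriv (hopen i j)).div (hg i j) fun z hz => hg0 i j z hz.1 hz.2)
    (fun i j z hi hj l hl => by
      have h1 : (fun w => g i j (w + l)) =ᶠ[𝓝 z] g i j := by
        filter_upwards [(hopen i j).mem_nhds ⟨hi, hj⟩] with w hw
        exact hper i j w hw.1 hw.2 l hl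
      have h2 := h1.deriv_eq
      rw [deriv_comp_add_const] at h2
      rw [h2, hper i j z hi hj l hl])
    (fun i j k z hi hj hk => by
      have h1 : g i k =ᶠ[𝓝 z] fun w => g i j w * g j k w := by
        filter_upwards [(hopen i j).mem_nhds ⟨hi, hj⟩, (hU k).mem_nhds hk] with w hw hw'
        exact hcoc i j k w hw.1 hw.2 hw'
      have h2 : HasDerivAt (fun w => g i j w * g j k w) _ z :=
        (hgd i j z hi hj).mul (hgd j k z hj hk)
      have h3 := hg0 i j z hi hj
      have h4 := hg0 j k z hj hk
      rw [h1.deriv_eq, h2.deriv, hcoc i j k z hi hj hk]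
      field_simp)
  -- a common radius for the discs that lie in some `U i`
  obtain ⟨r, hr, hball⟩ : ∃ r > 0, ∀ z, ∃ i, ball z r ⊆ U i := by
    obtain ⟨B, hB⟩ := exists_norm_add_le_of_isZLattice Λ
    obtain ⟨r, hr, h⟩ := lebesgue_number_lemma_of_metric (isCompact_closedBall (0 : ℂ) B) hU
      fun z _ => Set.mem_iUnion.2 (hcov z)
    refine ⟨r, hr, fun z => ?_⟩
    obtain ⟨l, hl, hzl⟩ := hB z
    obtain ⟨i, hi⟩ := h (z + l) (by simpa using hzl)
    refine ⟨i, fun w hw => ?_⟩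
    have h1 := hUper i (w + l) (hi (by simpa [dist_eq_norm] using hw)) (-l) (Λ.neg_mem hl)
    simpa using h1
  have hloc (z : ℂ) : ∃ f, ∀ w ∈ ball z r, IsFlatAt U t g f w := by
    obtain ⟨i, hi⟩ := hball z
    obtain ⟨T, hT⟩ := ((ht i).mono hi).isExactOn_ball
    have hf₀ (w) (hw : w ∈ ball z r) : HasDerivAt (fun w => exp (T w)) (exp (T w) * t i w) w :=
      (hT w hw).cexp
    refine ⟨fun j w => g i j w * exp (T w), fun w hw j hj => ⟨?_, ?_, fun k hk => ?_⟩⟩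
    · exact mul_ne_zero (hg0 i j w (hi hw) hj) (exp_ne_zero _)
    · refine ((hgd i j w (hi hw) hj).mul (hf₀ w hw)).congr_deriv ?_
      rw [hth i j w (hi hw) hj]
      have := hg0 i j w (hi hw) hj
      field_simp
      ring
    · beta_reduce
      rw [hcoc i j k w (hi hw) hj hk]
      ring
  obtain ⟨f, hf⟩ := exists_global_of_isFlatAt hU hcov hr hloc
  refine ⟨f, fun i z hi => ⟨(hf z i hi).1, (hf z i hi).2.1.differentiableAt⟩,
    fun i j z hi hj => (hf z i hi).2.2 j hj, fun l hl => ?_⟩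
  obtain ⟨β, hβ⟩ := htper l hl
  -- the translate by `l`, corrected for the change of the connection form, is flat as well
  have hf' (z : ℂ) : IsFlatAt U t g (fun i z => f i (z + l) * exp (-(β * z))) z := by
    intro i hi
    have hi' := hUper i z hi l hl
    obtain ⟨h1, h2, h3⟩ := hf (z + l) i hi'
    refine ⟨mul_ne_zero h1 (exp_ne_zero _), ?_, fun j hj => ?_⟩
    · have h4 : HasDerivAt (fun z => exp (-(β * z))) (exp (-(β * z)) * -(β * 1)) z :=
        (((hasDerivAt_id z).const_mul β).neg).cexp
      have h5 : HasDerivAt (fun z => f i (z + l)) (t i (z + l) * f i (z + l)) z :=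
        h2.comp_add_const z l
      refine (h5.mul h4).congr_deriv ?_
      rw [hβ i z hi]
      ring
    · beta_reduce
      rw [h3 j (hUper j z hj l hl), hper i j z hi hj l hl]
      ring
  obtain ⟨C, -, hC⟩ := exists_eq_const_mul_of_isFlatAt hU hcov isOpen_univ convex_univ
    (fun z _ => hf z) (fun z _ => hf' z)
  refine ⟨C, β, fun i z hi => ?_⟩
  have h1 := hC z trivial i hi
  have h2 : exp (-(β * z)) * exp (β * z) = 1 := by rw [← exp_add, neg_add_cancel, exp_zero]
  linear_combination exp (β * z) * h1 - f i (z + l) * h2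

end Flat

/-! ### Holomorphic maps into line bundles -/

section LineBundle

variable {R : Type*} [CommRing R] [Algebra R ℂ] {S : Submodule R ℂ} [DiscreteTopology S]
  {M : ℂ ⧸ S → Type*} [TopologicalSpace (TotalSpace ℂ M)]
  [∀ y, TopologicalSpace (M y)] [∀ y, AddCommMonoid (M y)] [∀ y, Module ℂ (M y)]
  [FiberBundle ℂ M] [VectorBundle ℂ ℂ M]
  {V : Type*} [NormedAddCommGroup V] [NormedSpace ℂ V] {H : Type*} [TopologicalSpace H]
  {I : ModelWithCorners ℂ V H} {X : Type*} [TopologicalSpace X] [ChartedSpace H X]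

/-- Multiplication by a number on the fibre of a point of the total space. -/
def fibreSMul (c : ℂ) (u : TotalSpace ℂ M) : TotalSpace ℂ M := ⟨u.proj, c • u.2⟩

@[simp] theorem fibreSMul_proj (c : ℂ) (u : TotalSpace ℂ M) : (fibreSMul c u).proj = u.proj := rfl

theorem fibreSMul_fibreSMul (c d : ℂ) (u : TotalSpace ℂ M) :
    fibreSMul c (fibreSMul d u) = fibreSMul (c * d) u :=
  congrArg (TotalSpace.mk u.proj) (mul_smul c d u.2).symm

@[simp] theorem fibreSMul_one (u : TotalSpace ℂ M) : fibreSMul 1 u = u := by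
  simp [fibreSMul]

theorem fibreSMul_coord {e : Trivialization ℂ (TotalSpace.proj : TotalSpace ℂ M → ℂ ⧸ S)}
    [MemTrivializationAtlas e] {u : TotalSpace ℂ M} (hu : u.proj ∈ e.baseSet) (c : ℂ) :
    (e (fibreSMul c u)).2 = c * (e u).2 :=
  (e.linear ℂ hu).map_smul c u.2

theorem coord_eq_zero_iff {e : Trivialization ℂ (TotalSpace.proj : TotalSpace ℂ M → ℂ ⧸ S)}
    [MemTrivializationAtlas e] {u : TotalSpace ℂ M} (hu : u.proj ∈ e.baseSet) :
    (e u).2 = 0 ↔ u.2 = 0 := by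
  have h : (e u).2 = (e.linearEquivAt ℂ u.proj hu) u.2 := rfl
  rw [h, LinearEquiv.map_eq_zero_iff]

/-- The fibres are one-dimensional. -/
theorem exists_eq_fibreSMul {u v : TotalSpace ℂ M} (h : v.proj = u.proj) (hu : u.2 ≠ 0) :
    ∃ c : ℂ, v = fibreSMul c u := by
  obtain ⟨y, u⟩ := u
  obtain ⟨z, v⟩ := v
  obtain rfl : z = y := h
  let e := (trivializationAt ℂ M z).linearEquivAt ℂ z (mem_baseSet_trivializationAt ℂ M z)
  have hu' : e u ≠ 0 := e.map_eq_zero_iff.not.2 hu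
  refine ⟨e v / e u, ?_⟩
  have : v = (e v / e u) • u := e.injective (by rw [map_smul, smul_eq_mul, div_mul_cancel₀ _ hu'])
  simp only [fibreSMul]
  rw [← this]

theorem fibreSMul_left_injective {u : TotalSpace ℂ M} (hu : u.2 ≠ 0) :
    Function.Injective fun c : ℂ => fibreSMul c u := by
  intro c d hcd
  let e := (trivializationAt ℂ M u.proj).linearEquivAt ℂ u.proj
    (mem_baseSet_trivializationAt ℂ M _)
  have hu' : e u.2 ≠ 0 := e.map_eq_zero_iff.not.2 hu
  have h : c • u.2 = d • u.2 := by simpa [fibreSMul] using hcd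
  have h := congrArg e h
  rw [map_smul, map_smul] at h
  exact mul_right_cancel₀ hu' h

theorem fibreSMul_snd_ne_zero {c : ℂ} (hc : c ≠ 0) {u : TotalSpace ℂ M} (hu : u.2 ≠ 0) :
    (fibreSMul c u).2 ≠ 0 := fun h =>
  hc (fibreSMul_left_injective hu (congrArg (TotalSpace.mk u.proj)
    (h.trans (zero_smul ℂ u.2).symm)))

variable (M) in
/-- Near every point of the base there is a holomorphic section without zeros. -/
theorem exists_local_section [ContMDiffVectorBundle ω ℂ M 𝓘(ℂ)] (y₀ : ℂ ⧸ S) :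
    ∃ s : ℂ ⧸ S → TotalSpace ℂ M, ∀ᶠ y in 𝓝 y₀,
      ContMDiffAt 𝓘(ℂ) (𝓘(ℂ).prod 𝓘(ℂ)) ω s y ∧ (s y).proj = y ∧ (s y).2 ≠ 0 := by
  let e := trivializationAt ℂ M y₀
  refine ⟨fun y => e.toOpenPartialHomeomorph.symm (y, 1), ?_⟩
  filter_upwards [e.open_baseSet.mem_nhds (mem_baseSet_trivializationAt ℂ M y₀)] with y hy
  have hp : (e.toOpenPartialHomeomorph.symm (y, (1 : ℂ))).proj = y :=
    e.proj_symm_apply (e.mem_target.2 hy)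
  refine ⟨?_, hp, fun h0 => ?_⟩
  · refine ContMDiffAt.comp (I' := 𝓘(ℂ).prod 𝓘(ℂ)) y (g := e.toOpenPartialHomeomorph.symm)
      (f := fun y => (y, (1 : ℂ))) ?_ (contMDiffAt_id.prodMk contMDiffAt_const)
    exact e.contMDiffOn_symm.contMDiffAt (e.open_target.mem_nhds (e.mem_target.2 hy))
  · rw [← coord_eq_zero_iff (e := e) (by rw [hp]; exact hy)] at h0
    rw [e.apply_symm_apply (e.mem_target.2 hy)] at h0
    exact one_ne_zero h0

theorem ContMDiffAt.fibreSMul {F : X → TotalSpace ℂ M} {c : X → ℂ} {x₀ : X}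
    (hc : ContMDiffAt I 𝓘(ℂ) ω c x₀) (hF : ContMDiffAt I (𝓘(ℂ).prod 𝓘(ℂ)) ω F x₀) :
    ContMDiffAt I (𝓘(ℂ).prod 𝓘(ℂ)) ω (fun x => fibreSMul (c x) (F x)) x₀ := by
  rw [contMDiffAt_totalSpace] at hF ⊢
  refine ⟨hF.1, (hc.mul hF.2).congr_of_eventuallyEq ?_⟩
  have h := hF.1.continuousAt.preimage_mem_nhds
    ((trivializationAt ℂ M (F x₀).proj).open_baseSet.mem_nhds
      (mem_baseSet_trivializationAt ℂ M (F x₀).proj))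
  filter_upwards [h] with x hx
  exact fibreSMul_coord hx _

/-- The ratio of two holomorphic maps into a line bundle is holomorphic. -/
theorem ContMDiffAt.of_fibreSMul {F G : X → TotalSpace ℂ M} {c : X → ℂ} {x₀ : X}
    (hF : ContMDiffAt I (𝓘(ℂ).prod 𝓘(ℂ)) ω F x₀) (hG : ContMDiffAt I (𝓘(ℂ).prod 𝓘(ℂ)) ω G x₀)
    (h0 : (G x₀).2 ≠ 0) (h : ∀ᶠ x in 𝓝 x₀, F x = _root_.fibreSMul (c x) (G x)) :
    ContMDiffAt I 𝓘(ℂ) ω c x₀ := by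
  rw [contMDiffAt_totalSpace] at hF hG
  have hp : (F x₀).proj = (G x₀).proj := by rw [h.self_of_nhds]; rfl
  rw [hp] at hF
  set e := trivializationAt ℂ M (G x₀).proj with he
  have hb : ∀ᶠ x in 𝓝 x₀, (G x).proj ∈ e.baseSet := hG.1.continuousAt.preimage_mem_nhds
    (e.open_baseSet.mem_nhds (mem_baseSet_trivializationAt ℂ M (G x₀).proj))
  have hG0 : (e (G x₀)).2 ≠ 0 := (coord_eq_zero_iff hb.self_of_nhds).not.2 h0
  refine (hF.2.div₀ hG.2 hG0).congr_of_eventuallyEq ?_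
  filter_upwards [h, hb, hG.2.continuousAt.eventually_ne hG0] with x h1 h2 h3
  rw [Pi.div_apply, h1, fibreSMul_coord h2, mul_div_cancel_right₀ _ h3]

variable {R' : Type*} [CommRing R'] [Algebra R' ℂ] {S' : Submodule R' ℂ} [DiscreteTopology S']

/-- The universal property of the pull-back of a line bundle. -/
theorem contMDiffAt_pullback_iff {f : C^ω⟮𝓘(ℂ), ℂ ⧸ S'; 𝓘(ℂ), ℂ ⧸ S⟯}
    {F : X → TotalSpace ℂ ((f : ℂ ⧸ S' → ℂ ⧸ S) *ᵖ M)} {x₀ : X} :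
    ContMDiffAt I (𝓘(ℂ).prod 𝓘(ℂ)) ω F x₀ ↔
      ContMDiffAt I 𝓘(ℂ) ω (fun x => (F x).proj) x₀ ∧
      ContMDiffAt I (𝓘(ℂ).prod 𝓘(ℂ)) ω (fun x => (Pullback.lift f (F x) : TotalSpace ℂ M)) x₀ := by
  rw [contMDiffAt_totalSpace, contMDiffAt_totalSpace]
  refine and_congr_right fun h => ?_
  refine (and_iff_right ?_).symm
  exact (f.contMDiff _).comp x₀ h

theorem contMDiff_pullback_iff {f : C^ω⟮𝓘(ℂ), ℂ ⧸ S'; 𝓘(ℂ), ℂ ⧸ S⟯}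
    {F : X → TotalSpace ℂ ((f : ℂ ⧸ S' → ℂ ⧸ S) *ᵖ M)} :
    ContMDiff I (𝓘(ℂ).prod 𝓘(ℂ)) ω F ↔
      ContMDiff I 𝓘(ℂ) ω (fun x => (F x).proj) ∧
      ContMDiff I (𝓘(ℂ).prod 𝓘(ℂ)) ω (fun x => (Pullback.lift f (F x) : TotalSpace ℂ M)) :=
  ⟨fun h => ⟨fun x => (contMDiffAt_pullback_iff.1 (h x)).1,
    fun x => (contMDiffAt_pullback_iff.1 (h x)).2⟩,
    fun h x => contMDiffAt_pullback_iff.2 ⟨h.1 x, h.2 x⟩⟩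

theorem contMDiff_pullback_lift (f : C^ω⟮𝓘(ℂ), ℂ ⧸ S'; 𝓘(ℂ), ℂ ⧸ S⟯) :
    ContMDiff (𝓘(ℂ).prod 𝓘(ℂ)) (𝓘(ℂ).prod 𝓘(ℂ)) ω
      (fun u : TotalSpace ℂ ((f : ℂ ⧸ S' → ℂ ⧸ S) *ᵖ M) =>
        (Pullback.lift f u : TotalSpace ℂ M)) :=
  (contMDiff_pullback_iff.1 contMDiff_id).2

end LineBundle

/-! ### Automorphisms of a line bundle over translations -/

section Automorphisms

variable {R : Type*} [CommRing R] [Algebra R ℂ] {S : Submodule R ℂ} [DiscreteTopology S]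
  {M : ℂ ⧸ S → Type*} [TopologicalSpace (TotalSpace ℂ M)]
  [∀ y, TopologicalSpace (M y)] [∀ y, AddCommMonoid (M y)] [∀ y, Module ℂ (M y)]
  [FiberBundle ℂ M] [VectorBundle ℂ ℂ M]

variable (M) in
theorem exists_ne_zero_over (y : ℂ ⧸ S) : ∃ u : TotalSpace ℂ M, u.proj = y ∧ u.2 ≠ 0 := by
  let e := (trivializationAt ℂ M y).linearEquivAt ℂ y (mem_baseSet_trivializationAt ℂ M y)
  refine ⟨⟨y, e.symm 1⟩, rfl, fun h => ?_⟩
  exact one_ne_zero (e.symm.map_eq_zero_iff.1 h)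

theorem IsAutOver.map_fibreSMul {x : ℂ ⧸ S} {φ : Equiv.Perm (TotalSpace ℂ M)}
    (h : IsAutOver M x φ) (c : ℂ) (u : TotalSpace ℂ M) :
    φ (fibreSMul c u) = fibreSMul c (φ u) := by
  obtain ⟨A, hA⟩ := h.2.2 u.proj
  have h1 := hA (c • u.2)
  have h2 : φ u = ⟨u.proj + x, A u.2⟩ := hA u.2
  rw [map_smul] at h1
  rw [h2]
  exact h1

theorem IsAutOver.map_snd_ne_zero {x : ℂ ⧸ S} {φ : Equiv.Perm (TotalSpace ℂ M)}
    (h : IsAutOver M x φ) {u : TotalSpace ℂ M} (hu : u.2 ≠ 0) : (φ u).2 ≠ 0 := by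
  intro h0
  have h1 : φ (fibreSMul 0 u) = φ u := by
    rw [h.map_fibreSMul]
    have : (0 : ℂ) • (φ u).2 = (φ u).2 := by rw [h0, smul_zero]
    exact congrArg (TotalSpace.mk _) this
  have h2 := φ.injective h1
  rw [← fibreSMul_one u, fibreSMul_fibreSMul] at h2
  exact zero_ne_one (fibreSMul_left_injective hu (by simpa using h2))

/-- On a line bundle, additivity of a map on the fibres follows from homogeneity. -/
theorem exists_linearMap_of_fibreSMul {N : ℂ ⧸ S → Type*} [∀ y, AddCommMonoid (N y)]
    [∀ y, Module ℂ (N y)] {F : TotalSpace ℂ M → TotalSpace ℂ N} {y z : ℂ ⧸ S}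
    (hp : ∀ u, u.proj = y → (F u).proj = z)
    (hc : ∀ (c : ℂ) (u : TotalSpace ℂ M), F ⟨u.proj, c • u.2⟩ = ⟨(F u).proj, c • (F u).2⟩) :
    ∃ A : M y →ₗ[ℂ] N z, ∀ v, F ⟨y, v⟩ = ⟨z, A v⟩ := by
  have hex (v : M y) : ∃ w : N z, F ⟨y, v⟩ = ⟨z, w⟩ := by
    have h := hp ⟨y, v⟩ rfl
    generalize F ⟨y, v⟩ = w at h
    obtain ⟨z', w⟩ := w
    obtain rfl : z' = z := h
    exact ⟨w, rfl⟩
  choose A hA using hex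
  have hsmul (c : ℂ) (v : M y) : A (c • v) = c • A v := by
    have h := hc c ⟨y, v⟩
    rw [hA v] at h
    simpa using (hA (c • v)).symm.trans h
  refine ⟨⟨⟨A, fun v w => ?_⟩, hsmul⟩, hA⟩
  obtain ⟨⟨y', u⟩, hy, hu⟩ := exists_ne_zero_over M y
  obtain rfl : y' = y := hy
  obtain ⟨c, hv⟩ := exists_eq_fibreSMul (u := ⟨y', u⟩) (v := ⟨y', v⟩) rfl hu
  obtain ⟨d, hw⟩ := exists_eq_fibreSMul (u := ⟨y', u⟩) (v := ⟨y', w⟩) rfl hu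
  have hv : v = c • u := by simpa [fibreSMul] using hv
  have hw : w = d • u := by simpa [fibreSMul] using hw
  rw [hv, hw, ← add_smul, hsmul, hsmul, hsmul, add_smul]

theorem isAutOver_of_fibreSMul {x : ℂ ⧸ S} {φ : Equiv.Perm (TotalSpace ℂ M)}
    (h1 : ContMDiff (𝓘(ℂ).prod 𝓘(ℂ)) (𝓘(ℂ).prod 𝓘(ℂ)) ω φ)
    (h2 : ContMDiff (𝓘(ℂ).prod 𝓘(ℂ)) (𝓘(ℂ).prod 𝓘(ℂ)) ω φ.symm)
    (hp : ∀ u, (φ u).proj = u.proj + x)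
    (hc : ∀ (c : ℂ) u, φ (fibreSMul c u) = fibreSMul c (φ u)) : IsAutOver M x φ :=
  ⟨h1, h2, fun _ => exists_linearMap_of_fibreSMul (fun u hu => by rw [hp, hu]) hc⟩

theorem contMDiff_fibreSMul (c : ℂ) :
    ContMDiff (𝓘(ℂ).prod 𝓘(ℂ)) (𝓘(ℂ).prod 𝓘(ℂ)) ω (fibreSMul c : TotalSpace ℂ M → _) :=
  fun _ => ContMDiffAt.fibreSMul contMDiffAt_const contMDiffAt_id

variable (M) in
/-- Multiplication by a nonzero number on the fibres. -/
def scalarAut : ℂˣ →* Equiv.Perm (TotalSpace ℂ M) where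
  toFun c := ⟨fibreSMul (c : ℂ), fibreSMul ((c⁻¹ : ℂˣ) : ℂ),
    fun u => by simp [fibreSMul_fibreSMul], fun u => by simp [fibreSMul_fibreSMul]⟩
  map_one' := by ext1 u; simp
  map_mul' c d := by ext1 u; simp [fibreSMul_fibreSMul]

theorem isAutOver_scalarAut (c : ℂˣ) : IsAutOver M 0 (scalarAut M c) := by
  refine isAutOver_of_fibreSMul (contMDiff_fibreSMul _) ?_ (fun u => by simp [scalarAut])
    fun d u => ?_
  · exact contMDiff_fibreSMul ((c⁻¹ : ℂˣ) : ℂ)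
  · simp [scalarAut, fibreSMul_fibreSMul, mul_comm]

/-- An automorphism over the identity of a compact base is multiplication by a constant. -/
theorem IsAutOver.eq_scalarAut [CompactSpace (ℂ ⧸ S)] [ContMDiffVectorBundle ω ℂ M 𝓘(ℂ)]
    {φ : Equiv.Perm (TotalSpace ℂ M)} (h : IsAutOver M 0 φ) : ∃ c : ℂˣ, φ = scalarAut M c := by
  have hex (y : ℂ ⧸ S) : ∃ c : ℂ, ∀ u : TotalSpace ℂ M, u.proj = y → φ u = fibreSMul c u := by
    obtain ⟨v, hv, hv0⟩ := exists_ne_zero_over M y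
    obtain ⟨c, hc⟩ := exists_eq_fibreSMul (u := v) (v := φ v)
      (by rw [h.proj_eq, add_zero]) hv0
    refine ⟨c, fun u hu => ?_⟩
    obtain ⟨d, rfl⟩ := exists_eq_fibreSMul (u := v) (v := u) (hu.trans hv.symm) hv0
    rw [h.map_fibreSMul, hc, fibreSMul_fibreSMul, fibreSMul_fibreSMul, mul_comm]
  choose c hc using hex
  have hsmooth : ContMDiff 𝓘(ℂ) 𝓘(ℂ) ω c := fun y₀ => by
    obtain ⟨s, hs⟩ := exists_local_section M y₀
    obtain ⟨hs₀, -, hs0⟩ := hs.self_of_nhds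
    refine ContMDiffAt.of_fibreSMul ((h.1 _).comp y₀ hs₀) hs₀ hs0 ?_
    filter_upwards [hs] with y hy
    exact hc y _ hy.2.1
  have : PreconnectedSpace (ℂ ⧸ S) :=
    S.mkQ_surjective.denseRange.preconnectedSpace S.continuous_mkQ
  have hconst : ∀ y, c y = c 0 := fun y =>
    (hsmooth.mdifferentiable (by simp)).apply_eq_of_compactSpace y 0
  have hc0 : c 0 ≠ 0 := by
    intro h0
    obtain ⟨v, hv, hv0⟩ := exists_ne_zero_over M (0 : ℂ ⧸ S)
    have h1 := hc 0 v hv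
    apply h.map_snd_ne_zero hv0
    rw [h1, h0]
    exact zero_smul ℂ _
  refine ⟨Units.mk0 _ hc0, Equiv.ext fun u => ?_⟩
  rw [hc u.proj u rfl, hconst]
  rfl

theorem IsAutOver.exists_eq_mul_scalarAut [CompactSpace (ℂ ⧸ S)]
    [ContMDiffVectorBundle ω ℂ M 𝓘(ℂ)] {x : ℂ ⧸ S} {φ ψ : Equiv.Perm (TotalSpace ℂ M)}
    (hφ : IsAutOver M x φ) (hψ : IsAutOver M x ψ) : ∃ c : ℂˣ, φ = ψ * scalarAut M c := by
  have h := hψ.inv.mul hφ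
  rw [neg_add_cancel] at h
  obtain ⟨c, hc⟩ := h.eq_scalarAut
  exact ⟨c, by rw [← hc, mul_inv_cancel_left]⟩

/-! ### The group `K(M)` -/

variable (M) in
/-- The canonical map `t_x^* M → M` over `t_x` is bijective. -/
def transPullbackEquiv (x : ℂ ⧸ S) :
    TotalSpace ℂ ((ComplexTorus.trans S x : ℂ ⧸ S → ℂ ⧸ S) *ᵖ M) ≃ TotalSpace ℂ M :=
  Equiv.ofBijective (Pullback.lift (ComplexTorus.trans S x)) <| by
    constructor
    · rintro ⟨y, v⟩ ⟨y', v'⟩ h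
      obtain rfl : y = y' := add_right_cancel (b := x) (congrArg TotalSpace.proj h)
      have h' : (⟨y + x, v⟩ : TotalSpace ℂ M) = ⟨y + x, v'⟩ := h
      have h'' : (v : M (y + x)) = v' := eq_of_heq (TotalSpace.mk.inj h').2
      exact congrArg (TotalSpace.mk y) h''
    · rintro ⟨y, v⟩
      obtain ⟨z, rfl⟩ : ∃ z, y = z + x := ⟨y - x, by simp⟩
      exact ⟨⟨z, v⟩, rfl⟩

theorem contMDiff_transPullbackEquiv (x : ℂ ⧸ S) :
    ContMDiff (𝓘(ℂ).prod 𝓘(ℂ)) (𝓘(ℂ).prod 𝓘(ℂ)) ω (transPullbackEquiv M x) :=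
  contMDiff_pullback_lift (ComplexTorus.trans S x)

theorem transPullbackEquiv_proj (x : ℂ ⧸ S) (u) :
    (transPullbackEquiv M x u).proj = u.proj + x := rfl

theorem transPullbackEquiv_symm_proj (x : ℂ ⧸ S) (u : TotalSpace ℂ M) :
    ((transPullbackEquiv M x).symm u).proj = u.proj + -x := by
  obtain ⟨v, rfl⟩ := (transPullbackEquiv M x).surjective u
  rw [Equiv.symm_apply_apply, transPullbackEquiv_proj, add_neg_cancel_right]

theorem contMDiff_transPullbackEquiv_symm (x : ℂ ⧸ S) :
    ContMDiff (𝓘(ℂ).prod 𝓘(ℂ)) (𝓘(ℂ).prod 𝓘(ℂ)) ω (transPullbackEquiv M x).symm := by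
  rw [contMDiff_pullback_iff]
  refine ⟨?_, ?_⟩
  · simp only [transPullbackEquiv_symm_proj]
    exact (ComplexTorus.trans S (-x)).contMDiff.comp (contMDiff_proj M)
  · exact contMDiff_id.congr fun u => (transPullbackEquiv M x).apply_symm_apply u

theorem transPullbackEquiv_fibreSMul (x : ℂ ⧸ S) (c : ℂ) (u) :
    transPullbackEquiv M x (fibreSMul c u) = fibreSMul c (transPullbackEquiv M x u) := rfl

/-- A point lies in `K(M)` if and only if the translation by it lifts to `M`. -/
theorem mem_KSet_iff {x : ℂ ⧸ S} : x ∈ KSet M ↔ ∃ φ, IsAutOver M x φ := by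
  constructor
  · rintro ⟨Φ, h1, h2, h3⟩
    have hΦp (u) : (Φ u).proj = u.proj := by
      obtain ⟨A, hA⟩ := h3 u.proj
      exact congrArg TotalSpace.proj (hA u.2)
    have hΦc (c : ℂ) (u) : Φ (fibreSMul c u) = fibreSMul c (Φ u) := by
      obtain ⟨A, hA⟩ := h3 u.proj
      have h := hA (c • u.2)
      have h' : Φ u = ⟨u.proj, A u.2⟩ := hA u.2
      rw [map_smul] at h
      rw [h']
      exact h
    refine ⟨Φ.symm.trans (transPullbackEquiv M x), isAutOver_of_fibreSMul
      ((contMDiff_transPullbackEquiv x).comp h2)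
      (h1.comp (contMDiff_transPullbackEquiv_symm x)) (fun u => ?_) fun c u => ?_⟩
    · obtain ⟨v, rfl⟩ := Φ.surjective u
      rw [Equiv.trans_apply, Equiv.symm_apply_apply, transPullbackEquiv_proj, hΦp]
    · obtain ⟨v, rfl⟩ := Φ.surjective u
      rw [← hΦc, Equiv.trans_apply, Equiv.symm_apply_apply, transPullbackEquiv_fibreSMul,
        Equiv.trans_apply, Equiv.symm_apply_apply]
  · rintro ⟨φ, h⟩
    have h' := h.inv
    refine ⟨(transPullbackEquiv M x).trans φ.symm,
      h.2.1.comp (contMDiff_transPullbackEquiv x),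
      (contMDiff_transPullbackEquiv_symm x).comp h.1, fun y => ?_⟩
    refine exists_linearMap_of_fibreSMul (F := (transPullbackEquiv M x).trans φ.symm)
      (fun u hu => ?_) fun c u => ?_
    · have := h'.proj_eq (transPullbackEquiv M x u)
      rw [transPullbackEquiv_proj, add_neg_cancel_right, hu] at this
      exact this
    · exact h'.map_fibreSMul c (transPullbackEquiv M x u)

theorem zero_mem_KSet : (0 : ℂ ⧸ S) ∈ KSet M := mem_KSet_iff.2 ⟨1, isAutOver_one⟩

theorem add_mem_KSet {x y : ℂ ⧸ S} (hx : x ∈ KSet M) (hy : y ∈ KSet M) : x + y ∈ KSet M := by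
  obtain ⟨φ, hφ⟩ := mem_KSet_iff.1 hx
  obtain ⟨ψ, hψ⟩ := mem_KSet_iff.1 hy
  exact mem_KSet_iff.2 ⟨_, hφ.mul hψ⟩

theorem neg_mem_KSet {x : ℂ ⧸ S} (hx : x ∈ KSet M) : -x ∈ KSet M := by
  obtain ⟨φ, hφ⟩ := mem_KSet_iff.1 hx
  exact mem_KSet_iff.2 ⟨_, hφ.inv⟩

end Automorphisms

/-! ### Frames on the universal cover -/

section Frame

variable {R : Type*} [CommRing R] [Algebra R ℂ] {S : Submodule R ℂ} [DiscreteTopology S]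
  {M : ℂ ⧸ S → Type*} [TopologicalSpace (TotalSpace ℂ M)]
  [∀ y, TopologicalSpace (M y)] [∀ y, AddCommMonoid (M y)] [∀ y, Module ℂ (M y)]
  [FiberBundle ℂ M] [VectorBundle ℂ ℂ M]

theorem mkQ_add_of_mem {l : ℂ} (hl : l ∈ S) (z : ℂ) : S.mkQ (z + l) = S.mkQ z := by
  rw [map_add, add_eq_left]
  exact (Submodule.Quotient.mk_eq_zero S).2 hl

variable (S) in
theorem contMDiff_mkQ : ContMDiff 𝓘(ℂ) 𝓘(ℂ) ω (S.mkQ : ℂ → ℂ ⧸ S) := by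
  intro z₀
  rw [contMDiffAt_iff]
  refine ⟨S.continuous_mkQ.continuousAt, ContDiffAt.contDiffWithinAt ?_⟩
  have hs := mem_chart_source ℂ (S.mkQ z₀)
  have hc : ContinuousAt (fun z => chartAt ℂ (S.mkQ z₀) (S.mkQ z)) z₀ :=
    ContinuousAt.comp (g := chartAt ℂ (S.mkQ z₀)) ((chartAt ℂ (S.mkQ z₀)).continuousAt hs)
      S.continuous_mkQ.continuousAt
  have hev : ∀ᶠ z in 𝓝 z₀, S.mkQ (chartAt ℂ (S.mkQ z₀) (S.mkQ z)) = S.mkQ z := by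
    filter_upwards [S.continuous_mkQ.continuousAt.preimage_mem_nhds
      ((chartAt ℂ (S.mkQ z₀)).open_source.mem_nhds hs)] with z hz
    exact ComplexTorus.mkQ_chart S (chart_mem_atlas ℂ _) hz
  have h := ComplexTorus.eventually_eq_add S hc continuousAt_id hev
  exact ContDiffAt.congr_of_eventuallyEq (contDiffAt_id.add contDiffAt_const) h

variable (S) in
/-- The projection `ℂ → ℂ ⧸ S` has local holomorphic sections. -/
theorem exists_local_lift (y₀ : ℂ ⧸ S) : ∃ ζ : ℂ ⧸ S → ℂ, ContMDiffAt 𝓘(ℂ) 𝓘(ℂ) ω ζ y₀ ∧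
    ∀ᶠ y in 𝓝 y₀, S.mkQ (ζ y) = y := by
  refine ⟨extChartAt 𝓘(ℂ) y₀, contMDiffAt_extChartAt, ?_⟩
  filter_upwards [(chartAt ℂ y₀).open_source.mem_nhds (mem_chart_source ℂ y₀)] with y hy
  exact ComplexTorus.mkQ_chart S (chart_mem_atlas ℂ _) hy

/-- A holomorphic section without zeros of the pull-back of the line bundle `M` to the universal
cover `ℂ` of `ℂ ⧸ S`, regarded as a map to the total space of `M`. -/
structure IsFrame (e : ℂ → TotalSpace ℂ M) : Prop where
  contMDiff : ContMDiff 𝓘(ℂ) (𝓘(ℂ).prod 𝓘(ℂ)) ω e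
  proj_eq : ∀ z, (e z).proj = S.mkQ z
  ne_zero : ∀ z, (e z).2 ≠ 0

theorem IsFrame.exists_eq_fibreSMul {e : ℂ → TotalSpace ℂ M} (he : IsFrame e)
    (u : TotalSpace ℂ M) : ∃ c z, u = fibreSMul c (e z) := by
  obtain ⟨z, hz⟩ := S.mkQ_surjective u.proj
  obtain ⟨c, hc⟩ := _root_.exists_eq_fibreSMul (hz.symm.trans (he.proj_eq z).symm) (he.ne_zero z)
  exact ⟨c, z, hc⟩

/-- A function `h` on the universal cover which is compatible with the factor of automorphy `j`
defines a map of `M` over a translation. -/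
theorem IsFrame.exists_map {e : ℂ → TotalSpace ℂ M} (he : IsFrame e) {j : ℂ → ℂ → ℂ}
    (hj : ∀ l ∈ S, ∀ z, e (z + l) = fibreSMul (j l z) (e z)) {t : ℂ} {h : ℂ → ℂ}
    (hh : ContDiff ℂ ω h) (hjh : ∀ l ∈ S, ∀ z, h (z + l) * j l (z + t) = j l z * h z) :
    ∃ Φ : TotalSpace ℂ M → TotalSpace ℂ M,
      ContMDiff (𝓘(ℂ).prod 𝓘(ℂ)) (𝓘(ℂ).prod 𝓘(ℂ)) ω Φ ∧
      ∀ c z, Φ (fibreSMul c (e z)) = fibreSMul (c * h z) (e (z + t)) := by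
  choose c₀ z₀ hc₀ using he.exists_eq_fibreSMul
  let Φ (u : TotalSpace ℂ M) := fibreSMul (c₀ u * h (z₀ u)) (e (z₀ u + t))
  have hΦ (c z) : Φ (fibreSMul c (e z)) = fibreSMul (c * h z) (e (z + t)) := by
    have h1 := hc₀ (fibreSMul c (e z))
    simp only [Φ]
    generalize c₀ (fibreSMul c (e z)) = c' at *
    generalize z₀ (fibreSMul c (e z)) = z' at *
    have h2 : S.mkQ z' = S.mkQ z := by
      rw [← he.proj_eq, ← he.proj_eq]
      exact (congrArg TotalSpace.proj h1).symm
    obtain ⟨l, hl, rfl⟩ : ∃ l ∈ S, z' = z + l :=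
      ⟨z' - z, (Submodule.Quotient.eq S).1 h2, by ring⟩
    rw [hj l hl, fibreSMul_fibreSMul] at h1
    have h3 : c = c' * j l z := fibreSMul_left_injective (he.ne_zero z) h1
    rw [show z + l + t = z + t + l by ring, hj l hl, fibreSMul_fibreSMul, h3]
    congr 1
    linear_combination c' * hjh l hl z
  refine ⟨Φ, fun u => ?_, hΦ⟩
  obtain ⟨ζ, hζ, hζ'⟩ := exists_local_lift S u.proj
  have hp : ContMDiffAt (𝓘(ℂ).prod 𝓘(ℂ)) 𝓘(ℂ) ω (fun v : TotalSpace ℂ M => v.proj) u :=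
    contMDiff_proj M u
  have hζp : ContMDiffAt (𝓘(ℂ).prod 𝓘(ℂ)) 𝓘(ℂ) ω (fun v : TotalSpace ℂ M => ζ v.proj) u :=
    ContMDiffAt.comp (g := ζ) u hζ hp
  have hev : ∀ᶠ v : TotalSpace ℂ M in 𝓝 u, S.mkQ (ζ v.proj) = v.proj :=
    hp.continuousAt.eventually hζ'
  have hex (v : TotalSpace ℂ M) : ∃ c : ℂ, S.mkQ (ζ v.proj) = v.proj →
      v = fibreSMul c (e (ζ v.proj)) := by
    by_cases hv : S.mkQ (ζ v.proj) = v.proj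
    · obtain ⟨c, hc⟩ := _root_.exists_eq_fibreSMul (hv.symm.trans (he.proj_eq _).symm)
        (he.ne_zero _)
      exact ⟨c, fun _ => hc⟩
    · exact ⟨0, fun h => absurd h hv⟩
  choose c hc using hex
  have hcs : ContMDiffAt (𝓘(ℂ).prod 𝓘(ℂ)) 𝓘(ℂ) ω c u := by
    refine ContMDiffAt.of_fibreSMul (F := id) (G := fun v => e (ζ v.proj)) contMDiffAt_id
      ((he.contMDiff _).comp u hζp) (he.ne_zero _) ?_
    filter_upwards [hev] with v hv
    exact hc v hv
  have hsm : ContMDiffAt (𝓘(ℂ).prod 𝓘(ℂ)) (𝓘(ℂ).prod 𝓘(ℂ)) ω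
      (fun v => fibreSMul (c v * h (ζ v.proj)) (e (ζ v.proj + t))) u := by
    refine ContMDiffAt.fibreSMul (hcs.mul ?_) ?_
    · exact (hh.contMDiff (ζ u.proj)).comp u hζp
    · exact (he.contMDiff _).comp u (hζp.add contMDiffAt_const)
  refine hsm.congr_of_eventuallyEq ?_
  filter_upwards [hev] with v hv
  conv_lhs => rw [hc v hv]
  exact hΦ _ _

/-- A function without zeros which is compatible with the factor of automorphy defines an
automorphism over a translation. -/
theorem IsFrame.mkQ_mem_KSet {e : ℂ → TotalSpace ℂ M} (he : IsFrame e) {j : ℂ → ℂ → ℂ}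
    (hj : ∀ l ∈ S, ∀ z, e (z + l) = fibreSMul (j l z) (e z)) {t : ℂ} {h : ℂ → ℂ}
    (hh : ContDiff ℂ ω h) (h0 : ∀ z, h z ≠ 0)
    (hjh : ∀ l ∈ S, ∀ z, h (z + l) * j l (z + t) = j l z * h z) : S.mkQ t ∈ KSet M := by
  obtain ⟨Φ, hΦs, hΦ⟩ := he.exists_map hj hh hjh
  obtain ⟨Ψ, hΨs, hΨ⟩ := he.exists_map hj (t := -t) (h := fun z => (h (z - t))⁻¹)
    (ContDiff.inv (hh.comp (contDiff_id.sub contDiff_const)) fun z => h0 _) fun l hl z => by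
      have h1 := hjh l hl (z - t)
      have h2 := h0 (z - t)
      have h3 := h0 (z - t + l)
      rw [sub_add_cancel] at h1
      rw [show z + l - t = z - t + l by ring, ← sub_eq_add_neg]
      field_simp
      linear_combination -h1
  let φ : Equiv.Perm (TotalSpace ℂ M) := ⟨Φ, Ψ, fun u => by
    obtain ⟨c, z, rfl⟩ := he.exists_eq_fibreSMul u
    rw [hΦ, hΨ]
    rw [add_sub_cancel_right, mul_inv_cancel_right₀ (h0 z), add_neg_cancel_right], fun u => by
    obtain ⟨c, z, rfl⟩ := he.exists_eq_fibreSMul u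
    rw [hΨ, hΦ, ← sub_eq_add_neg, inv_mul_cancel_right₀ (h0 _), sub_add_cancel]⟩
  refine mem_KSet_iff.2 ⟨φ, isAutOver_of_fibreSMul hΦs hΨs (fun u => ?_) fun c u => ?_⟩
  · obtain ⟨c, z, rfl⟩ := he.exists_eq_fibreSMul u
    change (Φ _).proj = _
    rw [hΦ, fibreSMul_proj, fibreSMul_proj, he.proj_eq, he.proj_eq, map_add]
  · obtain ⟨d, z, rfl⟩ := he.exists_eq_fibreSMul u
    change Φ _ = fibreSMul c (Φ _)
    rw [fibreSMul_fibreSMul, hΦ, hΦ, fibreSMul_fibreSMul, mul_assoc]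

instance : DiscreteTopology S.toAddSubgroup.toIntSubmodule :=
  inferInstanceAs (DiscreteTopology S)

/-- Every line bundle has a frame on the universal cover whose factor of automorphy is the
exponential of an affine function. -/
theorem exists_isFrame [IsZLattice ℝ S.toAddSubgroup.toIntSubmodule]
    [ContMDiffVectorBundle ω ℂ M 𝓘(ℂ)] :
    ∃ e : ℂ → TotalSpace ℂ M, IsFrame e ∧
      ∃ C β : ℂ → ℂ, ∀ l ∈ S, ∀ z, e (z + l) = fibreSMul (C l * Complex.exp (β l * z)) (e z) := by
  choose s hs using exists_local_section M
  choose W hW hWo hWm using fun y => eventually_nhds_iff.1 (hs y)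
  -- the transition functions
  have hex (i k : ℂ ⧸ S) (z : ℂ) : ∃ c : ℂ, S.mkQ z ∈ W i → S.mkQ z ∈ W k →
      s i (S.mkQ z) = fibreSMul c (s k (S.mkQ z)) := by
    by_cases h : S.mkQ z ∈ W i ∧ S.mkQ z ∈ W k
    · obtain ⟨c, hc⟩ := exists_eq_fibreSMul (((hW i _ h.1).2.1).trans (hW k _ h.2).2.1.symm)
        (hW k _ h.2).2.2
      exact ⟨c, fun _ _ => hc⟩
    · exact ⟨0, fun h1 h2 => absurd ⟨h1, h2⟩ h⟩
  choose g hg using hex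
  have hinj {i : ℂ ⧸ S} {z : ℂ} (hi : S.mkQ z ∈ W i) := fibreSMul_left_injective (hW i _ hi).2.2
  have hUo (i : ℂ ⧸ S) : IsOpen (S.mkQ ⁻¹' W i) := (hWo i).preimage S.continuous_mkQ
  have hss (i : ℂ ⧸ S) (z : ℂ) (hz : S.mkQ z ∈ W i) :
      ContMDiffAt 𝓘(ℂ) (𝓘(ℂ).prod 𝓘(ℂ)) ω (fun z => s i (S.mkQ z)) z :=
    (hW i _ hz).1.comp z (contMDiff_mkQ S z)
  obtain ⟨f, hf1, hf2, hf3⟩ := exists_multiplicative_splitting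
    (Λ := S.toAddSubgroup.toIntSubmodule) (U := fun i => S.mkQ ⁻¹' W i) (g := g) hUo
    (fun z => ⟨S.mkQ z, hWm _⟩)
    (fun i z hz l hl => by
      change S.mkQ (z + l) ∈ W i
      rw [mkQ_add_of_mem (S := S) hl]
      exact hz)
    (fun i k z hz => by
      refine DifferentiableAt.differentiableWithinAt ?_
      have : ContMDiffAt 𝓘(ℂ) 𝓘(ℂ) ω (g i k) z := by
        refine ContMDiffAt.of_fibreSMul (hss i z hz.1) (hss k z hz.2) (hW k _ hz.2).2.2 ?_
        filter_upwards [(hUo i).mem_nhds hz.1, (hUo k).mem_nhds hz.2] with w h1 h2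
        exact hg i k w h1 h2
      exact (contMDiffAt_iff_contDiffAt.1 this).differentiableAt (by simp))
    (fun i k z hi hk h0 => by
      have h1 := hg i k z hi hk
      rw [h0] at h1
      apply (hW i _ hi).2.2
      rw [h1]
      exact zero_smul ℂ _)
    (fun i k z hi hk l hl => by
      have h1 := hg i k (z + l)
      rw [mkQ_add_of_mem (S := S) hl] at h1
      exact hinj hk ((h1 hi hk).symm.trans (hg i k z hi hk)))
    (fun i k m z hi hk hm => by
      have h1 := hg i k z hi hk
      rw [hg k m z hk hm, fibreSMul_fibreSMul] at h1
      exact hinj hm ((hg i m z hi hm).symm.trans h1))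
  have hfs (i : ℂ ⧸ S) (z : ℂ) (hz : S.mkQ z ∈ W i) : ContMDiffAt 𝓘(ℂ) 𝓘(ℂ) ω (f i) z := by
    rw [contMDiffAt_iff_contDiffAt]
    have : DifferentiableOn ℂ (f i) (S.mkQ ⁻¹' W i) := fun w hw =>
      (hf1 i w hw).2.differentiableWithinAt
    exact (this.analyticAt ((hUo i).mem_nhds hz)).contDiffAt
  let e (z : ℂ) : TotalSpace ℂ M := fibreSMul (f (S.mkQ z) z) (s (S.mkQ z) (S.mkQ z))
  have he (i : ℂ ⧸ S) (z : ℂ) (hz : S.mkQ z ∈ W i) :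
      e z = fibreSMul (f i z) (s i (S.mkQ z)) := by
    rw [hg i (S.mkQ z) z hz (hWm _), fibreSMul_fibreSMul, mul_comm, ← hf2 i _ z hz (hWm _)]
  refine ⟨e, ⟨fun z => ?_, fun z => (hW _ _ (hWm _)).2.1, fun z => ?_⟩, ?_⟩
  · refine ((hfs _ z (hWm _)).fibreSMul (hss _ z (hWm _))).congr_of_eventuallyEq ?_
    filter_upwards [(hUo (S.mkQ z)).mem_nhds (hWm _)] with w hw
    exact he _ w hw
  · exact fibreSMul_snd_ne_zero (hf1 _ z (hWm _)).1 (hW _ _ (hWm _)).2.2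
  · have hex (l : ℂ) : ∃ C β : ℂ, l ∈ S → ∀ i, ∀ z, S.mkQ z ∈ W i →
        f i (z + l) = C * Complex.exp (β * z) * f i z := by
      by_cases hl : l ∈ S
      · obtain ⟨C, β, h⟩ := hf3 l hl
        exact ⟨C, β, fun _ => h⟩
      · exact ⟨0, 0, fun h => absurd h hl⟩
    choose C β hCβ using hex
    refine ⟨C, β, fun l hl z => ?_⟩
    rw [he (S.mkQ z) (z + l) (by rw [mkQ_add_of_mem hl]; exact hWm _), he (S.mkQ z) z (hWm _),
      mkQ_add_of_mem hl, fibreSMul_fibreSMul, hCβ l hl _ z (hWm _)]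

end Frame

/-! ### Lifting automorphisms along the maps `(ab)^* L → a^* L` -/

section CM

theorem totalSpace_mk_cast {B : Type*} {M : B → Type*} {z w : B} (h : z = w) (v : M z) :
    (⟨w, cast (congrArg M h) v⟩ : TotalSpace ℂ M) = ⟨z, v⟩ := by
  subst h; rfl

theorem cast_smul_fibre {B : Type*} {M : B → Type*} [∀ y, SMul ℂ (M y)] {z w : B} (h : z = w)
    (c : ℂ) (v : M z) : cast (congrArg M h) (c • v) = c • cast (congrArg M h) v := by
  subst h; rfl

variable {K : Type*} [Field K] [NumberField K] [Algebra.IsQuadraticExtension ℚ K]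
  [NumberField.IsTotallyComplex K] [Algebra K ℂ] {Λ : FractionalIdeal (𝓞 K)⁰ K}
  {L : CMCurve Λ → Type*} [TopologicalSpace (TotalSpace ℂ L)] [∀ y, TopologicalSpace (L y)]
  [∀ y, AddCommMonoid (L y)] [∀ y, Module ℂ (L y)] [FiberBundle ℂ L] [VectorBundle ℂ ℂ L]

variable (Λ) in
/-- `E` is divisible. -/
theorem exists_smul_eq (b : (𝓞 K)⁰) (y : CMCurve Λ) : ∃ z : CMCurve Λ, (b : 𝓞 K) • z = y := by
  obtain ⟨w, rfl⟩ := (cmLattice Λ).mkQ_surjective y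
  have hb : algebraMap (𝓞 K) ℂ b ≠ 0 := by
    rw [IsScalarTower.algebraMap_apply (𝓞 K) K ℂ]
    refine (map_ne_zero _).2 ?_
    exact (map_ne_zero_iff _ (NumberField.RingOfIntegers.coe_injective)).2
      (nonZeroDivisors.ne_zero b.2)
  refine ⟨(cmLattice Λ).mkQ ((algebraMap (𝓞 K) ℂ b)⁻¹ * w), ?_⟩
  rw [← map_smul, Algebra.smul_def, mul_inv_cancel_left₀ hb]

theorem lift_mulPullbackMap (a b : (𝓞 K)⁰) (u : TotalSpace ℂ (mulPullback Λ L (a * b))) :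
    (Pullback.lift (ComplexTorus.mulBy (cmLattice Λ) (a : 𝓞 K)) (mulPullbackMap Λ a b u) :
      TotalSpace ℂ L) =
    Pullback.lift (ComplexTorus.mulBy (cmLattice Λ) ((a * b : (𝓞 K)⁰) : 𝓞 K)) u :=
  totalSpace_mk_cast (M := L) (mul_smul (a : 𝓞 K) (b : 𝓞 K) u.proj) u.2

theorem mulPullbackMap_proj (a b : (𝓞 K)⁰) (u : TotalSpace ℂ (mulPullback Λ L (a * b))) :
    (mulPullbackMap Λ a b u).proj = (b : 𝓞 K) • u.proj := rfl

theorem mulPullbackMap_fibreSMul (a b : (𝓞 K)⁰) (c : ℂ)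
    (u : TotalSpace ℂ (mulPullback Λ L (a * b))) :
    mulPullbackMap Λ a b (fibreSMul c u) = fibreSMul c (mulPullbackMap Λ a b u) :=
  congrArg (TotalSpace.mk _)
    (cast_smul_fibre (M := L) (mul_smul (a : 𝓞 K) (b : 𝓞 K) u.proj) c u.2)

theorem contMDiff_mulPullbackMap (a b : (𝓞 K)⁰) :
    ContMDiff (𝓘(ℂ).prod 𝓘(ℂ)) (𝓘(ℂ).prod 𝓘(ℂ)) ω (mulPullbackMap (L := L) Λ a b) := by
  rw [contMDiff_pullback_iff]
  refine ⟨?_, ?_⟩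
  · exact (ComplexTorus.mulBy (cmLattice Λ) (b : 𝓞 K)).contMDiff.comp (contMDiff_proj _)
  · exact (contMDiff_pullback_lift _).congr fun u => lift_mulPullbackMap a b u

/-- A map into `(ab)^* L` is holomorphic if its composites with the projection to the base and
with the map to `a^* L` are. -/
theorem contMDiff_of_mulPullbackMap {a b : (𝓞 K)⁰} {V : Type*} [NormedAddCommGroup V]
    [NormedSpace ℂ V] {H : Type*} [TopologicalSpace H] {I : ModelWithCorners ℂ V H} {X : Type*}
    [TopologicalSpace X] [ChartedSpace H X] {F : X → TotalSpace ℂ (mulPullback Λ L (a * b))}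
    (h1 : ContMDiff I 𝓘(ℂ) ω fun x => (F x).proj)
    (h2 : ContMDiff I (𝓘(ℂ).prod 𝓘(ℂ)) ω fun x => mulPullbackMap Λ a b (F x)) :
    ContMDiff I (𝓘(ℂ).prod 𝓘(ℂ)) ω F := by
  rw [contMDiff_pullback_iff] at h2 ⊢
  exact ⟨h1, h2.2.congr fun x => (lift_mulPullbackMap a b (F x)).symm⟩

theorem mulPullbackMap_injective_fibre {a b : (𝓞 K)⁰}
    {u u' : TotalSpace ℂ (mulPullback Λ L (a * b))} (hp : u.proj = u'.proj)
    (h : mulPullbackMap Λ a b u = mulPullbackMap Λ a b u') : u = u' := by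
  obtain ⟨y, v⟩ := u
  obtain ⟨y', v'⟩ := u'
  obtain rfl : y = y' := hp
  have h' := congrArg (Pullback.lift (ComplexTorus.mulBy (cmLattice Λ) (a : 𝓞 K)) :
    _ → TotalSpace ℂ L) h
  rw [lift_mulPullbackMap, lift_mulPullbackMap] at h'
  exact congrArg (TotalSpace.mk y) (eq_of_heq (TotalSpace.mk.inj h').2)

theorem exists_mulPullbackMap_eq {a b : (𝓞 K)⁰} (y : CMCurve Λ)
    (w : TotalSpace ℂ (mulPullback Λ L a)) (hw : w.proj = (b : 𝓞 K) • y) :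
    ∃ u : TotalSpace ℂ (mulPullback Λ L (a * b)), u.proj = y ∧ mulPullbackMap Λ a b u = w := by
  obtain ⟨z, w⟩ := w
  obtain rfl : z = (b : 𝓞 K) • y := hw
  refine ⟨⟨y, cast (congrArg L (mul_smul (a : 𝓞 K) (b : 𝓞 K) y).symm) w⟩, rfl, ?_⟩
  exact congrArg (TotalSpace.mk ((b : 𝓞 K) • y))
    (eq_of_heq ((cast_heq _ _).trans (cast_heq _ _)))

theorem mulPullbackMap_surjective (a b : (𝓞 K)⁰) :
    Function.Surjective (mulPullbackMap (L := L) Λ a b) := fun w => by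
  obtain ⟨y, hy⟩ := exists_smul_eq Λ b w.proj
  obtain ⟨u, -, hu⟩ := exists_mulPullbackMap_eq y w hy.symm
  exact ⟨u, hu⟩

/-- An automorphism of `a^* L` over `b x` lifts to a holomorphic map of `(ab)^* L` over `x`. -/
theorem exists_covering_map {a b : (𝓞 K)⁰} {x : CMCurve Λ}
    {φ : Equiv.Perm (TotalSpace ℂ (mulPullback Λ L a))}
    (hφ : IsAutOver (mulPullback Λ L a) ((b : 𝓞 K) • x) φ) :
    ∃ F : TotalSpace ℂ (mulPullback Λ L (a * b)) → TotalSpace ℂ (mulPullback Λ L (a * b)),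
      ContMDiff (𝓘(ℂ).prod 𝓘(ℂ)) (𝓘(ℂ).prod 𝓘(ℂ)) ω F ∧
      (∀ u, (F u).proj = u.proj + x) ∧
      ∀ u, mulPullbackMap Λ a b (F u) = φ (mulPullbackMap Λ a b u) := by
  have hex (u : TotalSpace ℂ (mulPullback Λ L (a * b))) :=
    exists_mulPullbackMap_eq (b := b) (u.proj + x) (φ (mulPullbackMap Λ a b u))
      (by rw [hφ.proj_eq, smul_add, mulPullbackMap_proj])
  choose F hF1 hF2 using hex
  refine ⟨F, contMDiff_of_mulPullbackMap ?_ ?_, hF1, hF2⟩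
  · simp only [hF1]
    exact (ComplexTorus.trans (cmLattice Λ) x).contMDiff.comp (contMDiff_proj _)
  · simp only [hF2]
    exact hφ.1.comp (contMDiff_mulPullbackMap a b)

/-- An automorphism of `a^* L` over `b x` lifts to an automorphism of `(ab)^* L` over `x`. -/
theorem IsAutOver.exists_lift {a b : (𝓞 K)⁰} {x : CMCurve Λ}
    {φ : Equiv.Perm (TotalSpace ℂ (mulPullback Λ L a))}
    (hφ : IsAutOver (mulPullback Λ L a) ((b : 𝓞 K) • x) φ) :
    ∃ ψ, IsAutOver (mulPullback Λ L (a * b)) x ψ ∧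
      ∀ u, mulPullbackMap Λ a b (ψ u) = φ (mulPullbackMap Λ a b u) := by
  obtain ⟨F, hF, hFp, hFc⟩ := exists_covering_map hφ
  have hφ' := hφ.inv
  rw [← smul_neg] at hφ'
  obtain ⟨G, hG, hGp, hGc⟩ := exists_covering_map hφ'
  refine ⟨⟨F, G, fun u => ?_, fun u => ?_⟩, isAutOver_of_fibreSMul hF hG hFp fun c u => ?_, hFc⟩
  · refine mulPullbackMap_injective_fibre (by rw [hGp, hFp, add_neg_cancel_right]) ?_
    rw [hGc, hFc]
    exact φ.symm_apply_apply _
  · refine mulPullbackMap_injective_fibre (by rw [hFp, hGp, neg_add_cancel_right]) ?_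
    rw [hFc, hGc]
    exact φ.apply_symm_apply _
  · refine mulPullbackMap_injective_fibre (b := b) ?_ ?_
    · change (F (fibreSMul c u)).proj = (F u).proj
      rw [hFp, hFp, fibreSMul_proj]
    · change mulPullbackMap Λ a b (F (fibreSMul c u)) = mulPullbackMap Λ a b (fibreSMul c (F u))
      rw [hFc, mulPullbackMap_fibreSMul, mulPullbackMap_fibreSMul, hFc, hφ.map_fibreSMul]

/-- The automorphism `ψ` of `(ab)^* L` covers the automorphism `φ` of `a^* L`. -/
def Covers (a b : (𝓞 K)⁰) (ψ : Heisenberg (mulPullback Λ L (a * b)))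
    (φ : Heisenberg (mulPullback Λ L a)) : Prop :=
  ∀ u, mulPullbackMap Λ a b (ψ.1 u) = φ.1 (mulPullbackMap Λ a b u)

theorem Covers.mul {a b : (𝓞 K)⁰} {ψ ψ' : Heisenberg (mulPullback Λ L (a * b))}
    {φ φ' : Heisenberg (mulPullback Λ L a)} (h : Covers a b ψ φ) (h' : Covers a b ψ' φ') :
    Covers a b (ψ * ψ') (φ * φ') := fun u => (h _).trans (congrArg φ.1 (h' u))

theorem Covers.eq_of_base_eq {a b : (𝓞 K)⁰} {ψ ψ' : Heisenberg (mulPullback Λ L (a * b))}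
    {φ : Heisenberg (mulPullback Λ L a)} (h : Covers a b ψ φ) (h' : Covers a b ψ' φ)
    (hb : Heisenberg.base _ ψ = Heisenberg.base _ ψ') : ψ = ψ' := by
  have h1 := (Heisenberg.base_eq_iff _ ψ (Heisenberg.base _ ψ).toAdd).1 rfl
  have h2 := (Heisenberg.base_eq_iff _ ψ' (Heisenberg.base _ ψ).toAdd).1 hb.symm
  refine Subtype.ext (Equiv.ext fun u => ?_)
  exact mulPullbackMap_injective_fibre (by rw [h1.proj_eq, h2.proj_eq]) ((h u).trans (h' u).symm)

theorem Covers.unique {a b : (𝓞 K)⁰} {ψ : Heisenberg (mulPullback Λ L (a * b))}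
    {φ φ' : Heisenberg (mulPullback Λ L a)} (h : Covers a b ψ φ) (h' : Covers a b ψ φ') :
    φ = φ' := by
  refine Subtype.ext (Equiv.ext fun w => ?_)
  obtain ⟨u, rfl⟩ := mulPullbackMap_surjective a b w
  exact (h u).symm.trans (h' u)

variable (L) in
/-- Multiplication by a nonzero number, as an element of the Heisenberg group. -/
def scalarHeisenberg (a : (𝓞 K)⁰) : ℂˣ →* Heisenberg (mulPullback Λ L a) :=
  (scalarAut (mulPullback Λ L a)).codRestrict _ fun c => ⟨0, isAutOver_scalarAut c⟩

theorem covers_scalarHeisenberg (a b : (𝓞 K)⁰) (c : ℂˣ) :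
    Covers a b (scalarHeisenberg L (a * b) c) (scalarHeisenberg L a c) :=
  fun u => mulPullbackMap_fibreSMul a b (c : ℂ) u

theorem base_scalarHeisenberg (a : (𝓞 K)⁰) (c : ℂˣ) :
    Heisenberg.base _ (scalarHeisenberg L a c) = 1 :=
  (Heisenberg.base_eq_iff _ _ 0).2 (isAutOver_scalarAut c)

theorem exists_base_eq {a : (𝓞 K)⁰} {x : CMCurve Λ} (hx : x ∈ KSet (mulPullback Λ L a)) :
    ∃ φ : Heisenberg (mulPullback Λ L a), Heisenberg.base _ φ = Multiplicative.ofAdd x := by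
  obtain ⟨φ, hφ⟩ := mem_KSet_iff.1 hx
  exact ⟨⟨φ, x, hφ⟩, (Heisenberg.base_eq_iff _ _ _).2 hφ⟩

theorem mem_KSet_of_base_eq {a : (𝓞 K)⁰} {x : CMCurve Λ} {φ : Heisenberg (mulPullback Λ L a)}
    (h : Heisenberg.base _ φ = Multiplicative.ofAdd x) : x ∈ KSet (mulPullback Λ L a) :=
  mem_KSet_iff.2 ⟨_, (Heisenberg.base_eq_iff _ _ _).1 h⟩

theorem exists_eq_mul_scalarHeisenberg [CompactSpace (CMCurve Λ)]
    [ContMDiffVectorBundle ω ℂ L 𝓘(ℂ)] {a : (𝓞 K)⁰} {φ ψ : Heisenberg (mulPullback Λ L a)}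
    (h : Heisenberg.base _ φ = Heisenberg.base _ ψ) : ∃ c : ℂˣ, φ = ψ * scalarHeisenberg L a c := by
  obtain ⟨c, hc⟩ := ((Heisenberg.base_eq_iff _ φ (Heisenberg.base _ ψ).toAdd).1
    h).exists_eq_mul_scalarAut ((Heisenberg.base_eq_iff _ ψ (Heisenberg.base _ ψ).toAdd).1 rfl)
  exact ⟨c, Subtype.ext hc⟩

theorem exists_covers {a b : (𝓞 K)⁰} {x : CMCurve Λ} {φ : Heisenberg (mulPullback Λ L a)}
    (h : Heisenberg.base _ φ = Multiplicative.ofAdd ((b : 𝓞 K) • x)) :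
    ∃ ψ : Heisenberg (mulPullback Λ L (a * b)),
      Heisenberg.base _ ψ = Multiplicative.ofAdd x ∧ Covers a b ψ φ := by
  obtain ⟨ψ, h1, h2⟩ := ((Heisenberg.base_eq_iff _ _ _).1 h).exists_lift
  exact ⟨⟨ψ, x, h1⟩, (Heisenberg.base_eq_iff _ _ _).2 h1, h2⟩

end CM

/-! ### Coherent systems of automorphisms -/

section Coherent

variable {K : Type*} [Field K] [NumberField K] [Algebra.IsQuadraticExtension ℚ K]
  [NumberField.IsTotallyComplex K] [Algebra K ℂ] {Λ : FractionalIdeal (𝓞 K)⁰ K}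
  {L : CMCurve Λ → Type*} [TopologicalSpace (TotalSpace ℂ L)] [∀ y, TopologicalSpace (L y)]
  [∀ y, AddCommMonoid (L y)] [∀ y, Module ℂ (L y)] [FiberBundle ℂ L] [VectorBundle ℂ ℂ L]

/-- The canonical map `a^* L → L`. -/
def toBundle (a : (𝓞 K)⁰) (u : TotalSpace ℂ (mulPullback Λ L a)) : TotalSpace ℂ L :=
  Pullback.lift (ComplexTorus.mulBy (cmLattice Λ) (a : 𝓞 K)) u

theorem toBundle_mulPullbackMap (a b : (𝓞 K)⁰) (u : TotalSpace ℂ (mulPullback Λ L (a * b))) :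
    toBundle a (mulPullbackMap Λ a b u) = toBundle (a * b) u := lift_mulPullbackMap a b u

theorem eq_of_toBundle_eq {a : (𝓞 K)⁰} {u u' : TotalSpace ℂ (mulPullback Λ L a)}
    (hp : u.proj = u'.proj) (h : toBundle a u = toBundle a u') : u = u' := by
  obtain ⟨y, v⟩ := u
  obtain ⟨y', v'⟩ := u'
  obtain rfl : y = y' := hp
  exact congrArg (TotalSpace.mk y) (eq_of_heq (TotalSpace.mk.inj h).2)

/-- The automorphism `ψ` of `c^* L` covers the automorphism `φ` of `a^* L`. Unlike in `Covers`, the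
index `c` is only propositionally a multiple of `a`, so that multiples can be compared without
transport along equalities of indices. -/
def CoversDvd {a c : (𝓞 K)⁰} (ψ : Heisenberg (mulPullback Λ L c))
    (φ : Heisenberg (mulPullback Λ L a)) : Prop :=
  ∃ b, c = a * b ∧ ∀ u w, w.proj = (b : 𝓞 K) • u.proj → toBundle c u = toBundle a w →
    (φ.1 w).proj = (b : 𝓞 K) • (ψ.1 u).proj ∧ toBundle c (ψ.1 u) = toBundle a (φ.1 w)

theorem coversDvd_iff {a b : (𝓞 K)⁰} {ψ : Heisenberg (mulPullback Λ L (a * b))}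
    {φ : Heisenberg (mulPullback Λ L a)} : CoversDvd ψ φ ↔ Covers a b ψ φ := by
  constructor
  · rintro ⟨b', hb', h⟩ u
    obtain rfl : b = b' := by
      refine Subtype.ext (mul_left_cancel₀ (nonZeroDivisors.ne_zero a.2) ?_)
      exact congrArg Subtype.val hb'
    obtain ⟨h1, h2⟩ := h u (mulPullbackMap Λ a b u) rfl (toBundle_mulPullbackMap a b u).symm
    refine eq_of_toBundle_eq h1.symm ?_
    rw [toBundle_mulPullbackMap, h2]
  · refine fun h => ⟨b, rfl, fun u w hp hq => ?_⟩
    obtain rfl : mulPullbackMap Λ a b u = w :=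
      eq_of_toBundle_eq hp.symm ((toBundle_mulPullbackMap a b u).trans hq)
    rw [← h u]
    exact ⟨rfl, (toBundle_mulPullbackMap _ _ _).symm⟩

theorem CoversDvd.trans {a c d : (𝓞 K)⁰} {χ : Heisenberg (mulPullback Λ L d)}
    {ψ : Heisenberg (mulPullback Λ L c)} {φ : Heisenberg (mulPullback Λ L a)}
    (h : CoversDvd χ ψ) (h' : CoversDvd ψ φ) : CoversDvd χ φ := by
  obtain ⟨b', rfl, h⟩ := h
  obtain ⟨b, rfl, h'⟩ := h'
  refine ⟨b * b', mul_assoc a b b', fun u w hp hq => ?_⟩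
  obtain ⟨h1, h2⟩ := h u _ rfl (toBundle_mulPullbackMap _ _ u).symm
  obtain ⟨h3, h4⟩ := h' (mulPullbackMap Λ (a * b) b' u) w
    (by rw [hp, mulPullbackMap_proj, smul_smul]; rfl) (by rw [toBundle_mulPullbackMap, hq])
  exact ⟨by rw [h3, h1, smul_smul]; rfl, h2.trans h4⟩

theorem CoversDvd.eq_of_base_eq {a c : (𝓞 K)⁰} {ψ ψ' : Heisenberg (mulPullback Λ L c)}
    {φ : Heisenberg (mulPullback Λ L a)} (h : CoversDvd ψ φ) (h' : CoversDvd ψ' φ)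
    (hb : Heisenberg.base _ ψ = Heisenberg.base _ ψ') : ψ = ψ' := by
  obtain ⟨b, rfl, -⟩ := id h
  exact (coversDvd_iff.1 h).eq_of_base_eq (coversDvd_iff.1 h') hb

theorem CoversDvd.unique {a c : (𝓞 K)⁰} {ψ : Heisenberg (mulPullback Λ L c)}
    {φ φ' : Heisenberg (mulPullback Λ L a)} (h : CoversDvd ψ φ) (h' : CoversDvd ψ φ') :
    φ = φ' := by
  obtain ⟨b, rfl, -⟩ := id h
  exact (coversDvd_iff.1 h).unique (coversDvd_iff.1 h')

theorem CoversDvd.mul {a c : (𝓞 K)⁰} {ψ ψ' : Heisenberg (mulPullback Λ L c)}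
    {φ φ' : Heisenberg (mulPullback Λ L a)} (h : CoversDvd ψ φ) (h' : CoversDvd ψ' φ') :
    CoversDvd (ψ * ψ') (φ * φ') := by
  obtain ⟨b, rfl, -⟩ := id h
  exact coversDvd_iff.2 ((coversDvd_iff.1 h).mul (coversDvd_iff.1 h'))

theorem coversDvd_scalarHeisenberg {a c : (𝓞 K)⁰} (h : a ∣ c) (t : ℂˣ) :
    CoversDvd (scalarHeisenberg (Λ := Λ) L c t) (scalarHeisenberg L a t) := by
  obtain ⟨b, rfl⟩ := h
  exact coversDvd_iff.2 (covers_scalarHeisenberg a b t)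

theorem smul_nu_mul (x : AdelicCurve Λ) (a b : (𝓞 K)⁰) :
    (b : 𝓞 K) • nu Λ (a * b) x = nu Λ a x := x.2.1 a b

theorem exists_coversDvd (x : AdelicCurve Λ) {a c : (𝓞 K)⁰} (hac : a ∣ c)
    {φ : Heisenberg (mulPullback Λ L a)}
    (h : Heisenberg.base _ φ = Multiplicative.ofAdd (nu Λ a x)) :
    ∃ ψ : Heisenberg (mulPullback Λ L c),
      Heisenberg.base _ ψ = Multiplicative.ofAdd (nu Λ c x) ∧ CoversDvd ψ φ := by
  obtain ⟨b, rfl⟩ := hac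
  rw [← smul_nu_mul x a b] at h
  obtain ⟨ψ, h1, h2⟩ := exists_covers h
  exact ⟨ψ, h1, coversDvd_iff.2 h2⟩

theorem mem_JSet_of_dvd {x : AdelicCurve Λ} {a c : (𝓞 K)⁰} (hac : a ∣ c)
    (ha : a ∈ JSet Λ L x) : c ∈ JSet Λ L x := by
  obtain ⟨φ, hφ⟩ := exists_base_eq ha
  obtain ⟨ψ, hψ, -⟩ := exists_coversDvd x hac hφ
  exact mem_KSet_of_base_eq hψ

theorem one_mem_JSet_of_nu_eq_zero {x : AdelicCurve Λ} (hx : nu Λ 1 x = 0) :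
    1 ∈ JSet Λ L x := by
  change nu Λ 1 x ∈ KSet _
  rw [hx]
  exact zero_mem_KSet

namespace AdelicHeisenberg

theorem coversDvd (α : AdelicHeisenberg Λ L) {a c : (𝓞 K)⁰} (hac : a ∣ c)
    (ha : a ∈ JSet Λ L α.pt) (hc : c ∈ JSet Λ L α.pt) : CoversDvd (α.aut c hc) (α.aut a ha) := by
  obtain ⟨b, rfl⟩ := hac
  exact coversDvd_iff.2 (α.covers a b ha hc)

/-- An element of the adelic Heisenberg group is determined by its point and one component: the
components `φ_a` and `φ_b` determine each other through `φ_{ab}`. -/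
theorem eq_of_aut_eq {α β : AdelicHeisenberg Λ L} (hpt : α.pt = β.pt) {a : (𝓞 K)⁰}
    (hα : a ∈ JSet Λ L α.pt) (hβ : a ∈ JSet Λ L β.pt) (h : α.aut a hα = β.aut a hβ) : α = β := by
  have key (b) (hb : b ∈ JSet Λ L α.pt) (hb' : b ∈ JSet Λ L β.pt) :
      α.aut b hb = β.aut b hb' := by
    have hab := mem_JSet_of_dvd (dvd_mul_right a b) hα
    have hab' := mem_JSet_of_dvd (dvd_mul_right a b) hβ
    have h1 : α.aut (a * b) hab = β.aut (a * b) hab' := by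
      refine (α.coversDvd (dvd_mul_right a b) hα hab).eq_of_base_eq ?_ ?_
      · rw [h]
        exact β.coversDvd (dvd_mul_right a b) hβ hab'
      · rw [α.base_aut, β.base_aut, hpt]
    have h2 := α.coversDvd (dvd_mul_left b a) hb hab
    rw [h1] at h2
    exact h2.unique (β.coversDvd (dvd_mul_left b a) hb' hab')
  obtain ⟨x, φ, h1, h2⟩ := α
  obtain ⟨y, ψ, h3, h4⟩ := β
  obtain rfl : x = y := hpt
  congr 1
  funext b hb
  exact key b hb hb

variable [CompactSpace (CMCurve Λ)] [ContMDiffVectorBundle ω ℂ L 𝓘(ℂ)]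

/-- Every automorphism of `a^* L` over `x_a` is a component of an element of the adelic Heisenberg
group. Its `b`-component is the automorphism of `b^* L` with the same lift to `(ab)^* L`; it exists
since automorphisms over the same point differ by a constant. -/
theorem exists_aut_eq (x : AdelicCurve Λ) {a : (𝓞 K)⁰} {φ : Heisenberg (mulPullback Λ L a)}
    (h : Heisenberg.base _ φ = Multiplicative.ofAdd (nu Λ a x)) :
    ∃ α : AdelicHeisenberg Λ L, α.pt = x ∧ ∀ ha, α.aut a ha = φ := by
  have hex (b) (hb : b ∈ JSet Λ L x) : ∃ φ' : Heisenberg (mulPullback Λ L b),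
      Heisenberg.base _ φ' = Multiplicative.ofAdd (nu Λ b x) ∧
      ∀ ψ : Heisenberg (mulPullback Λ L (a * b)), CoversDvd ψ φ →
        Heisenberg.base _ ψ = Multiplicative.ofAdd (nu Λ (a * b) x) → CoversDvd ψ φ' := by
    obtain ⟨φ₁, hφ₁⟩ := exists_base_eq hb
    obtain ⟨ψ₁, hψ₁, hc₁⟩ := exists_coversDvd x (dvd_mul_left b a) hφ₁
    obtain ⟨ψ₂, hψ₂, hc₂⟩ := exists_coversDvd x (dvd_mul_right a b) h
    obtain ⟨t, ht⟩ := exists_eq_mul_scalarHeisenberg (hψ₂.trans hψ₁.symm)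
    refine ⟨φ₁ * scalarHeisenberg L b t, ?_, fun ψ hψ hbase => ?_⟩
    · rw [map_mul, base_scalarHeisenberg, mul_one, hφ₁]
    · obtain rfl := hψ.eq_of_base_eq hc₂ (hbase.trans hψ₂.symm)
      rw [ht]
      exact hc₁.mul (coversDvd_scalarHeisenberg (dvd_mul_left b a) t)
  choose Φ hΦ hΦc using hex
  have hcov (b c) (hb : b ∈ JSet Λ L x) (hc : c ∈ JSet Λ L x) (hbc : b ∣ c) :
      CoversDvd (Φ c hc) (Φ b hb) := by
    obtain ⟨χ, hχ, hχc⟩ := exists_coversDvd x hbc (hΦ b hb)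
    obtain ⟨ψ, hψ, hψc⟩ := exists_coversDvd x (dvd_mul_right a b) h
    obtain ⟨ψ', hψ', hψc'⟩ := exists_coversDvd x (mul_dvd_mul_left a hbc) hψ
    obtain ⟨χ', hχ', hχc'⟩ := exists_coversDvd x (dvd_mul_left c a) hχ
    have h1 : χ' = ψ' := (hχc'.trans hχc).eq_of_base_eq
      (hψc'.trans (hΦc b hb ψ hψc hψ)) (hχ'.trans hψ'.symm)
    have h2 := hΦc c hc ψ' (hψc'.trans hψc) hψ'
    rw [← h1] at h2
    rwa [h2.unique hχc']
  refine ⟨⟨x, Φ, hΦ, fun b c hb hbc => coversDvd_iff.1 (hcov b (b * c) hb hbc (dvd_mul_right b c))⟩,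
    rfl, fun ha => ?_⟩
  obtain ⟨ψ, hψ, hψc⟩ := exists_coversDvd x (dvd_mul_right a a) h
  exact (hΦc a ha ψ hψc hψ).unique hψc

theorem exists_mul (hJ : ∀ x, (JSet Λ L x).Nonempty) (α β : AdelicHeisenberg Λ L) :
    ∃ γ : AdelicHeisenberg Λ L, γ.pt = α.pt + β.pt ∧ ∀ a hα hβ, ∃ h : a ∈ JSet Λ L γ.pt,
      γ.aut a h = α.aut a hα * β.aut a hβ := by
  obtain ⟨a, ha⟩ := hJ α.pt
  obtain ⟨b, hb⟩ := hJ β.pt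
  have hα := mem_JSet_of_dvd (dvd_mul_right a b) ha
  have hβ := mem_JSet_of_dvd (dvd_mul_left b a) hb
  have hbase (c hα hβ) : Heisenberg.base _ (α.aut c hα * β.aut c hβ) =
      Multiplicative.ofAdd (nu Λ c (α.pt + β.pt)) := by
    rw [map_mul, α.base_aut, β.base_aut, map_add, ofAdd_add]
  obtain ⟨γ, hγ, hγa⟩ := exists_aut_eq (α.pt + β.pt) (hbase _ hα hβ)
  refine ⟨γ, hγ, fun c hα' hβ' => ?_⟩
  obtain ⟨δ, hδ, hδc⟩ := exists_aut_eq (α.pt + β.pt) (hbase _ hα' hβ')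
  have hc : c ∈ JSet Λ L γ.pt := hγ ▸ add_mem_KSet hα' hβ'
  have hcδ : c ∈ JSet Λ L δ.pt := hδ ▸ add_mem_KSet hα' hβ'
  refine ⟨hc, ?_⟩
  -- both `γ` and `δ` have the component `α_{abc} β_{abc}`
  have comp (ε : AdelicHeisenberg Λ L) (hε : ε.pt = α.pt + β.pt) (e d : (𝓞 K)⁰) (hed : e ∣ d)
      (hα₁ hβ₁ hα₂ hβ₂ h₁ h₂) (he : ε.aut e h₁ = α.aut e hα₁ * β.aut e hβ₁) :
      ε.aut d h₂ = α.aut d hα₂ * β.aut d hβ₂ := by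
    refine (ε.coversDvd hed h₁ h₂).eq_of_base_eq ?_ (by rw [ε.base_aut, hbase, hε])
    rw [he]
    exact (α.coversDvd hed hα₁ hα₂).mul (β.coversDvd hed hβ₁ hβ₂)
  have hα₂ := mem_JSet_of_dvd (dvd_mul_right (a * b) c) hα
  have hβ₂ := mem_JSet_of_dvd (dvd_mul_right (a * b) c) hβ
  have hγ₁ : a * b ∈ JSet Λ L γ.pt := hγ ▸ add_mem_KSet hα hβ
  have hγ₂ := mem_JSet_of_dvd (dvd_mul_right (a * b) c) hγ₁
  have hδ₂ := mem_JSet_of_dvd (dvd_mul_left c (a * b)) hcδ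
  have h1 := comp γ hγ (a * b) (a * b * c) (dvd_mul_right _ _) hα hβ hα₂ hβ₂ hγ₁ hγ₂ (hγa _)
  have h2 := comp δ hδ c (a * b * c) (dvd_mul_left _ _) hα' hβ' hα₂ hβ₂ hcδ hδ₂ (hδc _)
  have h3 : γ = δ := eq_of_aut_eq (hγ.trans hδ.symm) hγ₂ hδ₂ (h1.trans h2.symm)
  subst h3
  exact hδc _

end AdelicHeisenberg

end Coherent

/-! ### The adelic Heisenberg group -/

namespace AdelicHeisenberg

variable {K : Type*} [Field K] [NumberField K] [Algebra.IsQuadraticExtension ℚ K]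
  [NumberField.IsTotallyComplex K] [Algebra K ℂ] {Λ : FractionalIdeal (𝓞 K)⁰ K}
  {L : CMCurve Λ → Type*} [TopologicalSpace (TotalSpace ℂ L)] [∀ y, TopologicalSpace (L y)]
  [∀ y, AddCommMonoid (L y)] [∀ y, Module ℂ (L y)] [FiberBundle ℂ L] [VectorBundle ℂ ℂ L]

/-- The element of the adelic Heisenberg group whose components are all equal to the
multiplication by `c`. -/
def scalar (c : ℂˣ) : AdelicHeisenberg Λ L where
  pt := 0
  aut a _ := scalarHeisenberg L a c
  base_aut a _ := by rw [base_scalarHeisenberg, map_zero, ofAdd_zero]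
  covers a b _ _ := covers_scalarHeisenberg a b c

theorem neg_mem_JSet {x : AdelicCurve Λ} {a : (𝓞 K)⁰} (h : a ∈ JSet Λ L x) :
    a ∈ JSet Λ L (-x) := by
  change nu Λ a (-x) ∈ KSet _
  rw [map_neg]
  exact neg_mem_KSet h

theorem exists_common_mem_JSet (hJ : ∀ x, (JSet Λ L x).Nonempty) (x y z : AdelicCurve Λ) :
    ∃ a, a ∈ JSet Λ L x ∧ a ∈ JSet Λ L y ∧ a ∈ JSet Λ L z := by
  obtain ⟨a, ha⟩ := hJ x
  obtain ⟨b, hb⟩ := hJ y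
  obtain ⟨c, hc⟩ := hJ z
  exact ⟨a * b * c, mem_JSet_of_dvd ⟨b * c, mul_assoc a b c⟩ ha,
    mem_JSet_of_dvd ⟨a * c, by rw [mul_comm a b, mul_assoc]⟩ hb,
    mem_JSet_of_dvd ⟨a * b, mul_comm _ _⟩ hc⟩

variable [CompactSpace (CMCurve Λ)] [ContMDiffVectorBundle ω ℂ L 𝓘(ℂ)]

theorem exists_isCompositionLaw (hJ : ∀ x, (JSet Λ L x).Nonempty) :
    ∃ G : Group (AdelicHeisenberg Λ L), IsCompositionLaw Λ L G := by
  choose mul mul_pt mul_aut using exists_mul hJ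
  have mul_aut' (α β) (a) (hα hβ h) : (mul α β).aut a h = α.aut a hα * β.aut a hβ :=
    (mul_aut α β a hα hβ).2
  have inv_ex (α : AdelicHeisenberg Λ L) : ∃ β : AdelicHeisenberg Λ L, β.pt = -α.pt ∧
      ∃ (a : (𝓞 K)⁰) (hα : a ∈ JSet Λ L α.pt), ∀ h, β.aut a h = (α.aut a hα)⁻¹ := by
    obtain ⟨a, ha⟩ := hJ α.pt
    obtain ⟨β, hβ, hβa⟩ := exists_aut_eq (-α.pt) (a := a) (φ := (α.aut a ha)⁻¹)
      (by rw [map_inv, α.base_aut, map_neg, ofAdd_neg])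
    exact ⟨β, hβ, a, ha, hβa⟩
  choose inv inv_pt inv_aut using inv_ex
  let _ : Mul (AdelicHeisenberg Λ L) := ⟨mul⟩
  let _ : One (AdelicHeisenberg Λ L) := ⟨scalar 1⟩
  let _ : Inv (AdelicHeisenberg Λ L) := ⟨inv⟩
  have hassoc (α β γ : AdelicHeisenberg Λ L) : α * β * γ = α * (β * γ) := by
    obtain ⟨a, h1, h2, h3⟩ := exists_common_mem_JSet hJ α.pt β.pt γ.pt
    have h12 := (mul_aut α β a h1 h2).1
    have h23 := (mul_aut β γ a h2 h3).1
    have h123 := (mul_aut (mul α β) γ a h12 h3).1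
    have h123' := (mul_aut α (mul β γ) a h1 h23).1
    refine eq_of_aut_eq (α := mul (mul α β) γ) (β := mul α (mul β γ))
      (by rw [mul_pt, mul_pt, mul_pt, mul_pt, add_assoc]) h123 h123' ?_
    rw [mul_aut' _ _ a h12 h3, mul_aut' _ _ a h1 h2, mul_aut' _ _ a h1 h23,
      mul_aut' _ _ a h2 h3, mul_assoc]
  have hone (α : AdelicHeisenberg Λ L) : 1 * α = α := by
    obtain ⟨a, ha⟩ := hJ α.pt
    have h0 : a ∈ JSet Λ L (scalar (L := L) (Λ := Λ) 1).pt := zero_mem_KSet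
    obtain ⟨h1, h2⟩ := mul_aut (scalar 1) α a h0 ha
    refine eq_of_aut_eq (α := mul (scalar 1) α) ((mul_pt _ _).trans (zero_add _)) h1 ha
      (h2.trans ?_)
    change scalarHeisenberg L a 1 * _ = _
    rw [map_one, one_mul]
  have hinv (α : AdelicHeisenberg Λ L) : α⁻¹ * α = 1 := by
    obtain ⟨a, hα, hβ⟩ := inv_aut α
    have hi : a ∈ JSet Λ L (inv α).pt := by
      rw [inv_pt]
      exact neg_mem_JSet hα
    have h0 : a ∈ JSet Λ L (scalar (L := L) (Λ := Λ) 1).pt := zero_mem_KSet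
    obtain ⟨h1, h2⟩ := mul_aut (inv α) α a hi hα
    refine eq_of_aut_eq (α := mul (inv α) α) (β := scalar 1) ?_ h1 h0 ?_
    · rw [mul_pt, inv_pt, neg_add_cancel]
      rfl
    · rw [h2, hβ, inv_mul_cancel]
      exact (map_one (scalarHeisenberg L a)).symm
  exact ⟨Group.ofLeftAxioms hassoc hone hinv, fun α β => ⟨mul_pt α β, mul_aut α β⟩⟩

theorem isCompositionLaw_unique (hJ : ∀ x, (JSet Λ L x).Nonempty)
    {G G' : Group (AdelicHeisenberg Λ L)} (h : IsCompositionLaw Λ L G)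
    (h' : IsCompositionLaw Λ L G') : G = G' := by
  refine Group.ext (funext₂ fun α β => ?_)
  obtain ⟨a, h1, h2, -⟩ := exists_common_mem_JSet hJ α.pt β.pt 0
  obtain ⟨h3, h4⟩ := (h α β).2 a h1 h2
  obtain ⟨h5, h6⟩ := (h' α β).2 a h1 h2
  exact eq_of_aut_eq ((h α β).1.trans (h' α β).1.symm) h3 h5 (h4.trans h6.symm)

end AdelicHeisenberg

namespace IsCompositionLaw

open AdelicHeisenberg

variable {K : Type*} [Field K] [NumberField K] [Algebra.IsQuadraticExtension ℚ K]
  [NumberField.IsTotallyComplex K] [Algebra K ℂ] {Λ : FractionalIdeal (𝓞 K)⁰ K}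
  {L : CMCurve Λ → Type*} [TopologicalSpace (TotalSpace ℂ L)] [∀ y, TopologicalSpace (L y)]
  [∀ y, AddCommMonoid (L y)] [∀ y, Module ℂ (L y)] [FiberBundle ℂ L] [VectorBundle ℂ ℂ L]
  [G : Group (AdelicHeisenberg Λ L)]

theorem mul_pt (h : IsCompositionLaw Λ L G) (α β : AdelicHeisenberg Λ L) :
    (α * β).pt = α.pt + β.pt := (h α β).1

theorem mul_aut (h : IsCompositionLaw Λ L G) (α β : AdelicHeisenberg Λ L) {a : (𝓞 K)⁰} (hα hβ h') :
    (α * β).aut a h' = α.aut a hα * β.aut a hβ := ((h α β).2 a hα hβ).2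

theorem one_pt (h : IsCompositionLaw Λ L G) : (1 : AdelicHeisenberg Λ L).pt = 0 := by
  have := h.mul_pt 1 1
  rw [mul_one] at this
  exact left_eq_add.1 this

/-- The projection `(x, (φ_a)) ↦ x`. -/
def toPt (h : IsCompositionLaw Λ L G) : AdelicHeisenberg Λ L →* Multiplicative (AdelicCurve Λ) where
  toFun α := Multiplicative.ofAdd α.pt
  map_one' := by rw [h.one_pt, ofAdd_zero]
  map_mul' α β := by rw [h.mul_pt, ofAdd_add]

theorem mem_comap_toPt (h : IsCompositionLaw Λ L G) {W : AddSubgroup (AdelicCurve Λ)}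
    {α : AdelicHeisenberg Λ L} : α ∈ (AddSubgroup.toSubgroup W).comap h.toPt ↔ α.pt ∈ W :=
  Iff.rfl

/-- The central embedding of `ℂ*`. -/
def scalarHom (h : IsCompositionLaw Λ L G) : ℂˣ →* AdelicHeisenberg Λ L :=
  MonoidHom.mk' scalar fun c d => by
    have h1 : (1 : (𝓞 K)⁰) ∈ JSet Λ L (scalar (L := L) (Λ := Λ) c).pt := zero_mem_KSet
    have h2 : (1 : (𝓞 K)⁰) ∈ JSet Λ L (scalar (L := L) (Λ := Λ) d).pt := zero_mem_KSet
    have h3 : (1 : (𝓞 K)⁰) ∈ JSet Λ L (scalar (L := L) (Λ := Λ) (c * d)).pt := zero_mem_KSet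
    obtain ⟨h4, h5⟩ := (h (scalar c) (scalar d)).2 1 h1 h2
    refine eq_of_aut_eq ?_ h3 h4 (Eq.trans ?_ h5.symm)
    · rw [h.mul_pt]
      exact (add_zero 0).symm
    · exact map_mul (scalarHeisenberg L 1) c d

theorem scalarHom_apply (h : IsCompositionLaw Λ L G) (c : ℂˣ) : h.scalarHom c = scalar c := rfl

theorem scalarHom_injective (h : IsCompositionLaw Λ L G) : Function.Injective h.scalarHom := by
  intro c d hcd
  have key (α β : AdelicHeisenberg Λ L) (hαβ : α = β) (hα : 1 ∈ JSet Λ L α.pt)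
      (hβ : 1 ∈ JSet Λ L β.pt) : α.aut 1 hα = β.aut 1 hβ := by subst hαβ; rfl
  have h1 : scalarHeisenberg L 1 c = scalarHeisenberg L 1 d :=
    key _ _ hcd zero_mem_KSet zero_mem_KSet
  obtain ⟨u, -, hu⟩ := exists_ne_zero_over (mulPullback Λ L 1) 0
  have h2 := congrArg (fun φ : Heisenberg (mulPullback Λ L 1) => φ.1 u) h1
  exact Units.ext (fibreSMul_left_injective hu h2)

/-- `𝒱_a` is a subgroup of `V(E)`. -/
def _root_.VSubgroup (L : CMCurve Λ → Type*) [TopologicalSpace (TotalSpace ℂ L)]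
    [∀ y, TopologicalSpace (L y)] [∀ y, AddCommMonoid (L y)] [∀ y, Module ℂ (L y)]
    [FiberBundle ℂ L] [VectorBundle ℂ ℂ L] (a : (𝓞 K)⁰) : AddSubgroup (AdelicCurve Λ) where
  carrier := VSet Λ L a
  zero_mem' := zero_mem_KSet
  add_mem' hx hy := add_mem_KSet hx hy
  neg_mem' hx := neg_mem_JSet hx

theorem mem_JSet_of_mem_comap (h : IsCompositionLaw Λ L G) {a : (𝓞 K)⁰}
    (α : (AddSubgroup.toSubgroup (VSubgroup L a)).comap h.toPt) : a ∈ JSet Λ L α.1.pt := by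
  have h1 : α.1.pt ∈ VSubgroup L a := α.2
  exact h1

/-- The homomorphism `(x, (φ_b)) ↦ (x, φ_a)` on the part of the adelic Heisenberg group that lies
over `𝒱_a`. -/
def component (h : IsCompositionLaw Λ L G) (a : (𝓞 K)⁰) :
    (AddSubgroup.toSubgroup (VSubgroup L a)).comap h.toPt →*
      pullbackHeisenberg Λ L a (VSubgroup L a) :=
  MonoidHom.mk' (fun α =>
    ⟨(Multiplicative.ofAdd ⟨α.1.pt, α.2⟩, α.1.aut a (h.mem_JSet_of_mem_comap α)),
    (α.1.base_aut a (h.mem_JSet_of_mem_comap α)).symm⟩) fun α β => by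
      refine Subtype.ext (Prod.ext (Subtype.ext (h.mul_pt _ _)) ?_)
      exact h.mul_aut _ _ _ _ _

variable [CompactSpace (CMCurve Λ)] [ContMDiffVectorBundle ω ℂ L 𝓘(ℂ)]

theorem range_scalarHom (h : IsCompositionLaw Λ L G) : h.scalarHom.range = h.toPt.ker := by
  ext α
  constructor
  · rintro ⟨c, rfl⟩
    rfl
  · intro hα
    have hpt : α.pt = 0 := hα
    have h1 : 1 ∈ JSet Λ L α.pt := hpt ▸ zero_mem_KSet
    obtain ⟨c, hc⟩ := exists_eq_mul_scalarHeisenberg (φ := α.aut 1 h1) (ψ := 1)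
      (by rw [α.base_aut, hpt, map_zero, ofAdd_zero, map_one])
    refine ⟨c, eq_of_aut_eq (a := 1) (h.scalarHom_apply c ▸ hpt.symm) zero_mem_KSet h1 ?_⟩
    rw [hc, one_mul]
    rfl

theorem toPt_surjective (h : IsCompositionLaw Λ L G) (hJ : ∀ x, (JSet Λ L x).Nonempty) :
    Function.Surjective h.toPt := by
  intro x
  obtain ⟨a, ha⟩ := hJ x.toAdd
  obtain ⟨φ, hφ⟩ := exists_base_eq ha
  obtain ⟨α, hα, -⟩ := exists_aut_eq x.toAdd hφ
  exact ⟨α, congrArg Multiplicative.ofAdd hα⟩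

theorem component_bijective (h : IsCompositionLaw Λ L G) (a : (𝓞 K)⁰) :
    Function.Bijective (h.component a) := by
  constructor
  · intro α β hαβ
    have h1 : α.1.pt = β.1.pt := congrArg (fun p => (p.1.1.toAdd : AdelicCurve Λ)) hαβ
    exact Subtype.ext (eq_of_aut_eq h1 (h.mem_JSet_of_mem_comap α)
      (h.mem_JSet_of_mem_comap β) (congrArg (fun p => p.1.2) hαβ))
  · rintro ⟨⟨x, φ⟩, hφ⟩
    obtain ⟨α, hα, hαa⟩ := exists_aut_eq (x.toAdd : AdelicCurve Λ) (φ := φ) hφ.symm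
    have hmem : α.pt ∈ VSubgroup L a := hα ▸ x.toAdd.2
    refine ⟨⟨α, hmem⟩, Subtype.ext (Prod.ext (Subtype.ext hα) ?_)⟩
    exact hαa _

theorem nu_one_eq_zero (x : TateModule Λ) : nu Λ 1 (x : AdelicCurve Λ) = 0 := by
  exact (tateModule_eq_ker Λ).le x.2

theorem one_mem_JSet (x : TateModule Λ) : 1 ∈ JSet Λ L (x : AdelicCurve Λ) :=
  one_mem_JSet_of_nu_eq_zero (nu_one_eq_zero x)

theorem exists_tateSection (h : IsCompositionLaw Λ L G) :
    ∃ σ : Multiplicative (TateModule Λ) →* AdelicHeisenberg Λ L,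
      ∀ x, (σ x).pt = (x.toAdd : AdelicCurve Λ) ∧ ∀ h', (σ x).aut 1 h' = 1 := by
  have hex (x : Multiplicative (TateModule Λ)) : ∃ α : AdelicHeisenberg Λ L,
      α.pt = (x.toAdd : AdelicCurve Λ) ∧ ∀ h', α.aut 1 h' = 1 := by
    refine exists_aut_eq (a := 1) (φ := 1) (x.toAdd : AdelicCurve Λ) ?_
    rw [nu_one_eq_zero, map_one, ofAdd_zero]
  choose σ hσ hσ1 using hex
  have hm (x) : 1 ∈ JSet Λ L (σ x).pt := hσ x ▸ one_mem_JSet x.toAdd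
  refine ⟨MonoidHom.mk' σ fun x y => ?_, fun x => ⟨hσ x, hσ1 x⟩⟩
  obtain ⟨h1, h2⟩ := (h (σ x) (σ y)).2 1 (hm x) (hm y)
  refine eq_of_aut_eq ?_ (hm (x * y)) h1 ?_
  · rw [h.mul_pt, hσ, hσ, hσ]
    rfl
  · rw [h2, hσ1, hσ1, hσ1, mul_one]

theorem tateSection_mul_scalarHom (h : IsCompositionLaw Λ L G)
    {σ : Multiplicative (TateModule Λ) →* AdelicHeisenberg Λ L}
    (hσ : ∀ x, (σ x).pt = (x.toAdd : AdelicCurve Λ) ∧ ∀ h', (σ x).aut 1 h' = 1)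
    (x : Multiplicative (TateModule Λ)) (c : ℂˣ) :
    (σ x * h.scalarHom c).pt = (x.toAdd : AdelicCurve Λ) ∧
      ∀ h', (σ x * h.scalarHom c).aut 1 h' = scalarHeisenberg L 1 c := by
  have h1 : 1 ∈ JSet Λ L (σ x).pt := (hσ x).1 ▸ one_mem_JSet x.toAdd
  have h2 : 1 ∈ JSet Λ L (h.scalarHom c).pt := zero_mem_KSet
  refine ⟨?_, fun h' => ?_⟩
  · rw [h.mul_pt, (hσ x).1]
    exact add_zero _
  · rw [h.mul_aut _ _ h1 h2, (hσ x).2, one_mul]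
    rfl

theorem eq_of_aut_one_eq {α β : AdelicHeisenberg Λ L} {x : TateModule Λ}
    {φ : Heisenberg (mulPullback Λ L 1)} (hα : α.pt = (x : AdelicCurve Λ))
    (hβ : β.pt = (x : AdelicCurve Λ)) (hα' : ∀ h', α.aut 1 h' = φ)
    (hβ' : ∀ h', β.aut 1 h' = φ) : α = β := by
  have h1 : 1 ∈ JSet Λ L α.pt := hα ▸ one_mem_JSet x
  have h2 : 1 ∈ JSet Λ L β.pt := hβ ▸ one_mem_JSet x
  exact eq_of_aut_eq (hα.trans hβ.symm) h1 h2 ((hα' h1).trans (hβ' h2).symm)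

theorem commute_scalarHom (h : IsCompositionLaw Λ L G)
    {σ : Multiplicative (TateModule Λ) →* AdelicHeisenberg Λ L}
    (hσ : ∀ x, (σ x).pt = (x.toAdd : AdelicCurve Λ) ∧ ∀ h', (σ x).aut 1 h' = 1)
    (x : Multiplicative (TateModule Λ)) (c : ℂˣ) : Commute (σ x) (h.scalarHom c) := by
  have h1 : 1 ∈ JSet Λ L (σ x).pt := (hσ x).1 ▸ one_mem_JSet x.toAdd
  have h2 : 1 ∈ JSet Λ L (h.scalarHom c).pt := zero_mem_KSet
  obtain ⟨h3, h4⟩ := tateSection_mul_scalarHom h hσ x c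
  refine eq_of_aut_one_eq h3 ?_ h4 fun h' => ?_
  · rw [h.mul_pt, (hσ x).1]
    exact zero_add _
  · rw [h.mul_aut _ _ h2 h1, (hσ x).2, mul_one]
    rfl

/-- Over `T(E)` the adelic Heisenberg group is the product of the image of the section and the
centre. -/
theorem exists_tateEquiv (h : IsCompositionLaw Λ L G) :
    ∃ e : (AddSubgroup.toSubgroup (TateModule Λ)).comap h.toPt ≃*
        Multiplicative (TateModule Λ) × ℂˣ,
      ∀ α, ((Multiplicative.toAdd (e α).1 : TateModule Λ) : AdelicCurve Λ) = α.1.pt ∧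
        ∃ h : 1 ∈ JSet Λ L α.1.pt, α.1.aut 1 h = scalarHeisenberg L 1 (e α).2 := by
  obtain ⟨σ, hσ⟩ := h.exists_tateSection
  have hp := fun p : Multiplicative (TateModule Λ) × ℂˣ =>
    tateSection_mul_scalarHom h hσ p.1 p.2
  let f₀ : Multiplicative (TateModule Λ) × ℂˣ →* AdelicHeisenberg Λ L :=
    MonoidHom.noncommCoprod σ h.scalarHom (commute_scalarHom h hσ)
  have hf₀ (p) : f₀ p = σ p.1 * h.scalarHom p.2 := rfl
  have hmem (p) : f₀ p ∈ (AddSubgroup.toSubgroup (TateModule Λ)).comap h.toPt := by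
    rw [h.mem_comap_toPt, hf₀, (hp p).1]
    exact p.1.toAdd.2
  have hinj : Function.Injective (f₀.codRestrict _ hmem) := by
    refine (injective_iff_map_eq_one _).2 fun p hp' => ?_
    have hp'' : σ p.1 * h.scalarHom p.2 = 1 := congrArg Subtype.val hp'
    have h1 := (hp p).1
    rw [hp'', h.one_pt] at h1
    obtain ⟨x, c⟩ := p
    obtain rfl : x = 1 := Subtype.ext h1.symm
    rw [map_one, one_mul] at hp''
    rw [(injective_iff_map_eq_one _).1 h.scalarHom_injective c hp'']
    rfl
  have hsurj : Function.Surjective (f₀.codRestrict _ hmem) := by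
    rintro ⟨α, hα⟩
    have hα' : α.pt ∈ TateModule Λ := hα
    have h1 : 1 ∈ JSet Λ L α.pt := one_mem_JSet ⟨α.pt, hα'⟩
    obtain ⟨c, hc⟩ := exists_eq_mul_scalarHeisenberg (φ := α.aut 1 h1) (ψ := 1)
      (by rw [α.base_aut, nu_one_eq_zero ⟨α.pt, hα'⟩, ofAdd_zero, map_one])
    rw [one_mul] at hc
    refine ⟨(Multiplicative.ofAdd ⟨α.pt, hα'⟩, c), Subtype.ext ?_⟩
    exact eq_of_aut_one_eq (x := ⟨α.pt, hα'⟩) (hp _).1 rfl (hp _).2 fun _ => hc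
  have hE (α) : σ ((MulEquiv.ofBijective _ ⟨hinj, hsurj⟩).symm α).1 *
      h.scalarHom ((MulEquiv.ofBijective _ ⟨hinj, hsurj⟩).symm α).2 = α.1 :=
    congrArg Subtype.val ((MulEquiv.ofBijective _ ⟨hinj, hsurj⟩).apply_symm_apply α)
  generalize (MulEquiv.ofBijective _ ⟨hinj, hsurj⟩).symm = E at hE
  refine ⟨E, fun α => ?_⟩
  obtain ⟨h3, h4⟩ := hp (E α)
  rw [hE α] at h3 h4
  have h1 : 1 ∈ JSet Λ L α.1.pt := h3 ▸ one_mem_JSet (E α).1.toAdd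
  exact ⟨h3.symm, h1, h4 h1⟩

end IsCompositionLaw

/-! ### The lattice of a CM curve -/

section Lattice

variable {K : Type*} [Field K] [NumberField K] [Algebra.IsQuadraticExtension ℚ K]
  [NumberField.IsTotallyComplex K] [Algebra K ℂ] {Λ : FractionalIdeal (𝓞 K)⁰ K}

/-- Some integer of `K` is not real. -/
theorem exists_integer_im_ne_zero : ∃ r : 𝓞 K, (algebraMap K ℂ r).im ≠ 0 := by
  by_contra! h
  have hK (x : K) : (algebraMap K ℂ x).im = 0 := by
    obtain ⟨a, b, -, rfl⟩ := IsFractionRing.div_surjective (A := 𝓞 K) x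
    have ha : ((algebraMap K ℂ a).re : ℂ) = algebraMap K ℂ a := Complex.ext rfl (h a).symm
    have hb : ((algebraMap K ℂ b).re : ℂ) = algebraMap K ℂ b := Complex.ext rfl (h b).symm
    change (algebraMap K ℂ (a / b)).im = 0
    rw [map_div₀, ← ha, ← hb, ← Complex.ofReal_div, Complex.ofReal_im]
  refine NumberField.IsTotallyComplex.complexEmbedding_not_isReal (algebraMap K ℂ) ?_
  rw [NumberField.ComplexEmbedding.isReal_iff]
  exact RingHom.ext fun x => Complex.conj_eq_iff_im.2 (hK x)

/-- A nonzero fractional ideal spans `ℂ` over `ℝ`: with `a` it contains `r a`, for `r ∈ R` not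
real. -/
theorem isZLattice_cmLattice (hΛ : Λ ≠ 0) :
    IsZLattice ℝ (cmLattice Λ).toAddSubgroup.toIntSubmodule := by
  obtain ⟨u, hu, hu0⟩ : ∃ u ∈ (Λ : Submodule (𝓞 K) K), u ≠ 0 := by
    by_contra! h
    exact hΛ (FractionalIdeal.coeToSubmodule_eq_bot.1 ((Submodule.eq_bot_iff _).2 h))
  obtain ⟨r, hr⟩ := exists_integer_im_ne_zero (K := K)
  set a := algebraMap K ℂ u with ha
  set b := algebraMap K ℂ r with hb
  have ha0 : a ≠ 0 := (map_ne_zero _).2 hu0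
  have h1 : a ∈ cmLattice Λ := ⟨u, hu, rfl⟩
  have h2 : b * a ∈ cmLattice Λ := by
    have := (cmLattice Λ).smul_mem r h1
    rwa [Algebra.smul_def] at this
  refine ⟨(Submodule.eq_top_iff').2 fun z => ?_⟩
  have hz : z = ((z / a).re - (z / a).im / b.im * b.re) • a + ((z / a).im / b.im) • (b * a) := by
    have hw : z / a =
        ((z / a).re - (z / a).im / b.im * b.re : ℝ) + ((z / a).im / b.im : ℝ) * b := by
      apply Complex.ext
      · simp
      · simp [div_mul_cancel₀ _ hr]
    rw [Complex.real_smul, Complex.real_smul]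
    nth_rewrite 1 [← div_mul_cancel₀ z ha0, hw]
    ring
  rw [hz]
  exact add_mem (Submodule.smul_mem _ _ (Submodule.subset_span h1))
    (Submodule.smul_mem _ _ (Submodule.subset_span h2))

theorem compactSpace_cmCurve (hΛ : Λ ≠ 0) : CompactSpace (CMCurve Λ) := by
  have := isZLattice_cmLattice hΛ
  obtain ⟨B, hB⟩ := exists_norm_add_le_of_isZLattice (cmLattice Λ).toAddSubgroup.toIntSubmodule
  refine ⟨?_⟩
  have h : (cmLattice Λ).mkQ '' Metric.closedBall 0 B = Set.univ := by
    refine Set.eq_univ_of_forall fun y => ?_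
    obtain ⟨z, rfl⟩ := (cmLattice Λ).mkQ_surjective y
    obtain ⟨l, hl, hz⟩ := hB z
    exact ⟨z + l, by simpa using hz, mkQ_add_of_mem hl z⟩
  rw [← h]
  exact (isCompact_closedBall 0 B).image (cmLattice Λ).continuous_mkQ

end Lattice

/-! ### Lifting torsion translations to a pull-back of the line bundle -/

/-- Two exponentials of affine functions which agree have the same slope. -/
theorem eq_of_mul_exp_eq {C C' a b : ℂ} (hC : C ≠ 0)
    (h : ∀ z : ℂ, C * Complex.exp (a * z) = C' * Complex.exp (b * z)) : a = b := by
  have h0 : C = C' := by simpa using h 0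
  subst h0
  have h1 (c : ℂ) : HasDerivAt (fun z : ℂ => C * Complex.exp (c * z)) (C * c) 0 := by
    simpa using (((hasDerivAt_id (0 : ℂ)).const_mul c).cexp.const_mul C)
  have h2 := (h1 a).unique ((h1 b).congr_of_eventuallyEq (Filter.Eventually.of_forall h))
  exact mul_left_cancel₀ hC h2

section Factor

variable {R : Type*} [CommRing R] [Algebra R ℂ] {S : Submodule R ℂ} [DiscreteTopology S]
  {M : ℂ ⧸ S → Type*} [TopologicalSpace (TotalSpace ℂ M)]
  [∀ y, TopologicalSpace (M y)] [∀ y, AddCommMonoid (M y)] [∀ y, Module ℂ (M y)]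
  [FiberBundle ℂ M] [VectorBundle ℂ ℂ M] {e : ℂ → TotalSpace ℂ M} {C β : ℂ → ℂ}

theorem IsFrame.const_ne_zero (he : IsFrame e)
    (hj : ∀ l ∈ S, ∀ z, e (z + l) = fibreSMul (C l * Complex.exp (β l * z)) (e z))
    {l : ℂ} (hl : l ∈ S) : C l ≠ 0 := by
  intro h
  have h1 := hj l hl 0
  rw [h, zero_mul] at h1
  apply he.ne_zero (0 + l)
  rw [h1]
  exact zero_smul ℂ _

/-- Comparison of `e (l + m)` and `e (m + l)`; this is the integrality of the Chern class. -/
theorem IsFrame.exp_mul_comm (he : IsFrame e)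
    (hj : ∀ l ∈ S, ∀ z, e (z + l) = fibreSMul (C l * Complex.exp (β l * z)) (e z))
    {l m : ℂ} (hl : l ∈ S) (hm : m ∈ S) :
    Complex.exp (β l * m) = Complex.exp (β m * l) := by
  have h1 : e (0 + l + m) = e (0 + m + l) := by rw [add_right_comm]
  rw [hj l hl, hj m hm, hj m hm, hj l hl, fibreSMul_fibreSMul, fibreSMul_fibreSMul] at h1
  have h2 := fibreSMul_left_injective (he.ne_zero 0) h1
  simp only [mul_zero, Complex.exp_zero, mul_one, zero_add] at h2
  have h3 := mul_ne_zero (he.const_ne_zero hj hl) (he.const_ne_zero hj hm)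
  apply mul_left_cancel₀ h3
  linear_combination -h2

theorem IsFrame.slope_add (he : IsFrame e)
    (hj : ∀ l ∈ S, ∀ z, e (z + l) = fibreSMul (C l * Complex.exp (β l * z)) (e z))
    {l m : ℂ} (hl : l ∈ S) (hm : m ∈ S) : β (l + m) = β l + β m := by
  refine eq_of_mul_exp_eq (C' := C m * C l * Complex.exp (β m * l))
    (he.const_ne_zero hj (add_mem hl hm)) fun z => ?_
  have h1 := hj (l + m) (add_mem hl hm) z
  rw [← add_assoc, hj m hm, hj l hl, fibreSMul_fibreSMul] at h1
  have h2 := fibreSMul_left_injective (he.ne_zero z) h1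
  rw [← h2, mul_add, add_mul, Complex.exp_add, Complex.exp_add]
  ring

/-- The slopes of the factor of automorphy are homogeneous for multiplication by integers. -/
theorem IsFrame.slope_natCast_mul (he : IsFrame e)
    (hj : ∀ l ∈ S, ∀ z, e (z + l) = fibreSMul (C l * Complex.exp (β l * z)) (e z))
    {l : ℂ} (hl : l ∈ S) (n : ℕ) : (n : ℂ) * l ∈ S ∧ β (n * l) = n * β l := by
  induction n with
  | zero =>
    have := he.slope_add hj S.zero_mem S.zero_mem
    rw [add_zero] at this
    simpa using this
  | succ n ih =>
    rw [Nat.cast_succ, add_one_mul, add_one_mul]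
    exact ⟨add_mem ih.1 hl, by rw [he.slope_add hj ih.1 hl, ih.2]⟩

end Factor

section Torsion

variable {K : Type*} [Field K] [NumberField K] [Algebra.IsQuadraticExtension ℚ K]
  [NumberField.IsTotallyComplex K] [Algebra K ℂ] {Λ : FractionalIdeal (𝓞 K)⁰ K}
  (L : CMCurve Λ → Type*) [TopologicalSpace (TotalSpace ℂ L)] [∀ y, TopologicalSpace (L y)]
  [∀ y, AddCommMonoid (L y)] [∀ y, Module ℂ (L y)] [FiberBundle ℂ L] [VectorBundle ℂ ℂ L]

/-- A positive natural number `n`, as an index of the adelic families. -/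
def natIndex (K : Type*) [Field K] [NumberField K] {n : ℕ} (hn : n ≠ 0) : (𝓞 K)⁰ :=
  ⟨n, mem_nonZeroDivisors_of_ne_zero (Nat.cast_ne_zero.2 hn)⟩

theorem natIndex_smul {n : ℕ} (hn : n ≠ 0) (z : ℂ) :
    (natIndex K hn : 𝓞 K) • z = n * z := by
  rw [Algebra.smul_def]
  congr 1
  exact map_natCast (algebraMap (𝓞 K) ℂ) n

/-- If `n x = 0`, then the translation by any `y` with `n y = x` lifts to `n^* L`. For a lift `t` of
`y` and a frame `e` of `L` with slopes `β`, the frame `z ↦ e (n z)` of `n^* L` goes to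
`z ↦ exp (-β(n² t) z) e (n (z + t))`. -/
theorem mkQ_mem_KSet_natIndex (hΛ : Λ ≠ 0) [ContMDiffVectorBundle ω ℂ L 𝓘(ℂ)] {n : ℕ}
    (hn : n ≠ 0) {t : ℂ} (ht : (n : ℂ) * (n * t) ∈ cmLattice Λ) :
    (cmLattice Λ).mkQ t ∈ KSet (mulPullback Λ L (natIndex K hn)) := by
  have := isZLattice_cmLattice hΛ
  obtain ⟨e, he, C, β, hj⟩ := exists_isFrame (S := cmLattice Λ) (M := L)
  let f := ComplexTorus.mulBy (cmLattice Λ) (natIndex K hn : 𝓞 K)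
  have hmk (z : ℂ) : (natIndex K hn : 𝓞 K) • (cmLattice Λ).mkQ z = (cmLattice Λ).mkQ (n * z) := by
    rw [← map_smul, natIndex_smul]
  have hex (z : ℂ) : ∃ v : L ((natIndex K hn : 𝓞 K) • (cmLattice Λ).mkQ z),
      e (n * z) = ⟨(natIndex K hn : 𝓞 K) • (cmLattice Λ).mkQ z, v⟩ := by
    have h := (he.proj_eq (n * z)).trans (hmk z).symm
    generalize e (n * z) = u at h
    obtain ⟨y, v⟩ := u
    subst h
    exact ⟨v, rfl⟩
  choose v hv using hex
  let e' (z : ℂ) : TotalSpace ℂ (mulPullback Λ L (natIndex K hn)) := ⟨(cmLattice Λ).mkQ z, v z⟩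
  have hlift (z : ℂ) : (Pullback.lift f (e' z) : TotalSpace ℂ L) = e (n * z) := (hv z).symm
  have he' : IsFrame e' := by
    refine ⟨(contMDiff_pullback_iff (f := f)).2 ⟨contMDiff_mkQ _, ?_⟩, fun _ => rfl, fun z h0 => ?_⟩
    · simp only [hlift]
      refine he.contMDiff.comp ?_
      exact (contDiff_const.mul contDiff_id).contMDiff
    · apply he.ne_zero (n * z)
      rw [hv z]
      exact h0
  have hnl {l : ℂ} (hl : l ∈ cmLattice Λ) := he.slope_natCast_mul hj hl n
  have hj' (l : ℂ) (hl : l ∈ cmLattice Λ) (z : ℂ) :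
      e' (z + l) = fibreSMul (C (n * l) * Complex.exp (β (n * l) * (n * z))) (e' z) := by
    have hp : (e' (z + l)).proj = (e' z).proj := mkQ_add_of_mem hl z
    obtain ⟨c, hc⟩ := exists_eq_fibreSMul hp (he'.ne_zero z)
    have h1 : (Pullback.lift f (e' (z + l)) : TotalSpace ℂ L) =
        fibreSMul c (Pullback.lift f (e' z) : TotalSpace ℂ L) := by rw [hc]; rfl
    rw [hlift, hlift, mul_add, hj _ (hnl hl).1] at h1
    rw [hc, fibreSMul_left_injective (he.ne_zero _) h1]
  refine he'.mkQ_mem_KSet (j := fun l z => C (n * l) * Complex.exp (β (n * l) * (n * z))) hj'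
    (h := fun z => Complex.exp (-(β (n * (n * t)) * z))) ?_ (fun _ => Complex.exp_ne_zero _) ?_
  · exact (contDiff_const.mul contDiff_id).neg.cexp
  · -- the slope of the frame at `n l`, applied to `n t`, is the slope at `l`, applied to `n (n t)`
    intro l hl z
    have h1 := he.exp_mul_comm hj hl ht
    have h2 : β (n * l) * (n * (z + t)) = β (n * l) * (n * z) + β l * (n * (n * t)) := by
      rw [(hnl hl).2]
      ring
    rw [h2, Complex.exp_add, h1, mul_add, neg_add, Complex.exp_add]
    have h3 : Complex.exp (-(β (n * (n * t)) * l)) * Complex.exp (β (n * (n * t)) * l) = 1 := by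
      rw [← Complex.exp_add, neg_add_cancel, Complex.exp_zero]
    linear_combination (Complex.exp (-(β (n * (n * t)) * z)) * C (n * l) *
      Complex.exp (β (n * l) * (n * z))) * h3

/-- If `n x_1 = 0`, then `n ∈ J_x`. -/
theorem JSet_nonempty (hΛ : Λ ≠ 0) [ContMDiffVectorBundle ω ℂ L 𝓘(ℂ)] (x : AdelicCurve Λ) :
    (JSet Λ L x).Nonempty := by
  obtain ⟨n, hn, hx⟩ := isOfFinAddOrder_iff_nsmul_eq_zero.1 x.2.2
  refine ⟨natIndex K hn.ne', ?_⟩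
  obtain ⟨t, ht⟩ := (cmLattice Λ).mkQ_surjective (nu Λ (natIndex K hn.ne') x)
  change nu Λ (natIndex K hn.ne') x ∈ KSet (mulPullback Λ L (natIndex K hn.ne'))
  rw [← ht]
  refine mkQ_mem_KSet_natIndex L hΛ hn.ne' ?_
  have h1 : (natIndex K hn.ne' : 𝓞 K) • nu Λ (natIndex K hn.ne') x = x.1 1 := by
    have := x.2.1 1 (natIndex K hn.ne')
    rwa [one_mul] at this
  rw [← (Submodule.Quotient.mk_eq_zero (cmLattice Λ)), ← nsmul_eq_mul,
    ← natIndex_smul (K := K) hn.ne' t]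
  change (cmLattice Λ).mkQ _ = 0
  rw [map_nsmul, map_smul, ht, h1, hx]

end Torsion

end

theorem mainTheorem7 {K : Type*} [Field K] [NumberField K] [Algebra.IsQuadraticExtension ℚ K]
    [NumberField.IsTotallyComplex K] [Algebra K ℂ]
    (Λ : FractionalIdeal (𝓞 K)⁰ K) (hΛ : Λ ≠ 0)
    (L : CMCurve Λ → Type*) [TopologicalSpace (TotalSpace ℂ L)] [∀ y, TopologicalSpace (L y)]
    [∀ y, AddCommMonoid (L y)] [∀ y, Module ℂ (L y)] [FiberBundle ℂ L] [VectorBundle ℂ ℂ L]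
    [ContMDiffVectorBundle ω ℂ L 𝓘(ℂ)] :
    -- the adelic Heisenberg group is a group under composition, in exactly one way
    (∃! G : Group (AdelicHeisenberg Λ L), IsCompositionLaw Λ L G) ∧
    ∀ [G : Group (AdelicHeisenberg Λ L)], IsCompositionLaw Λ L G →
      ∃ g : AdelicHeisenberg Λ L →* Multiplicative (AdelicCurve Λ),
        (∀ α, g α = Multiplicative.ofAdd α.pt) ∧
        -- (1) the exact sequence
        (∃ i : ℂˣ →* AdelicHeisenberg Λ L,
          (∀ c, (i c).pt = 0 ∧ ∀ a : (𝓞 K)⁰, ∃ h : a ∈ JSet Λ L (i c).pt,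
            ∀ u, ((i c).aut a h).1 u = ⟨u.proj, (c : ℂ) • u.2⟩) ∧
          Function.Injective i ∧ i.range = g.ker ∧ Function.Surjective g) ∧
        -- (2) the restriction to `𝒱_a` is a pull-back
        (∀ a : (𝓞 K)⁰, ∃ W : AddSubgroup (AdelicCurve Λ), (W : Set (AdelicCurve Λ)) = VSet Λ L a ∧
          ∃ e : (AddSubgroup.toSubgroup W).comap g ≃* pullbackHeisenberg Λ L a W,
            ∀ α, ((Multiplicative.toAdd (e α).1.1 : W) : AdelicCurve Λ) = α.1.pt ∧
              ∃ h : a ∈ JSet Λ L α.1.pt, (e α).1.2 = α.1.aut a h) ∧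
        -- (3) the splitting over `T(E)`
        (∃ e : (AddSubgroup.toSubgroup (TateModule Λ)).comap g ≃*
              Multiplicative (TateModule Λ) × ℂˣ,
            ∀ α, ((Multiplicative.toAdd (e α).1 : TateModule Λ) : AdelicCurve Λ) = α.1.pt ∧
              ∃ h : 1 ∈ JSet Λ L α.1.pt,
                ∀ u, (α.1.aut 1 h).1 u = ⟨u.proj, ((e α).2 : ℂ) • u.2⟩) ∧
        (∃ σ : Multiplicative (TateModule Λ) →* AdelicHeisenberg Λ L,
          ∀ x : TateModule Λ,
            g (σ (Multiplicative.ofAdd x)) = Multiplicative.ofAdd (x : AdelicCurve Λ) ∧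
            (∃ h : 1 ∈ JSet Λ L (σ (Multiplicative.ofAdd x)).pt,
              (σ (Multiplicative.ofAdd x)).aut 1 h = 1) ∧
            ∀ α : AdelicHeisenberg Λ L, α.pt = x → (∀ h : 1 ∈ JSet Λ L α.pt, α.aut 1 h = 1) →
              α = σ (Multiplicative.ofAdd x)) := by
  have hcompact := compactSpace_cmCurve hΛ
  have hJ := JSet_nonempty L hΛ
  refine ⟨?_, ?_⟩
  · obtain ⟨G, hG⟩ := AdelicHeisenberg.exists_isCompositionLaw hJ
    exact ⟨G, hG, fun G' hG' => AdelicHeisenberg.isCompositionLaw_unique hJ hG' hG⟩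
  intro G h
  refine ⟨h.toPt, fun α => rfl, ?_, ?_, ?_, ?_⟩
  · exact ⟨h.scalarHom, fun c => ⟨rfl, fun a => ⟨zero_mem_KSet, fun u => rfl⟩⟩,
      h.scalarHom_injective, h.range_scalarHom, h.toPt_surjective hJ⟩
  · exact fun a => ⟨VSubgroup L a, rfl, MulEquiv.ofBijective _ (h.component_bijective a),
      fun α => ⟨rfl, h.mem_JSet_of_mem_comap α, rfl⟩⟩
  · obtain ⟨e, he⟩ := h.exists_tateEquiv
    refine ⟨e, fun α => ⟨(he α).1, ?_⟩⟩
    obtain ⟨h1, h2⟩ := (he α).2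
    exact ⟨h1, fun u => by rw [h2]; rfl⟩
  · obtain ⟨σ, hσ⟩ := h.exists_tateSection
    refine ⟨σ, fun x => ?_⟩
    have hx : (σ (Multiplicative.ofAdd x)).pt = (x : AdelicCurve Λ) :=
      (hσ (Multiplicative.ofAdd x)).1
    have h1 : 1 ∈ JSet Λ L (σ (Multiplicative.ofAdd x)).pt :=
      hx ▸ IsCompositionLaw.one_mem_JSet x
    refine ⟨congrArg Multiplicative.ofAdd hx, ⟨h1, (hσ _).2 h1⟩, fun α hα hα1 => ?_⟩
    exact IsCompositionLaw.eq_of_aut_one_eq hα hx hα1 (hσ _).2
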